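/- **Model.** Fix $K,p\in\mathbb N$, a window length $dT>0$, an open set $\Theta\subseteq\mathbb R^p$, $\theta^*\in\Theta$, and block intensities $\lambda_{kl}(t;\theta)$, $k,l\in[K]$, $t\ge 0$. For each number of nodes $m$ let $A=A_m\subseteq[m]\times[m]$ be the edge set, $z^*=z^*_m\in[K]^m$ the true labels, and let $N_{ij}$, $(i,j)\in A$, be independent Poisson point processes on $[0,\infty)$ with intensities $\lambda_{z_i^*z_j^*}(t;\theta^*)$. For $z\in[K]^m$ and the $n$-th window $I_n=((n-1)dT,n\,dT]$ put $$l_n(\theta|z)=\sum_{(i,j)\in A}\Big\{\int_{I_n}\log\lambda_{z_iz_j}(t;\theta)\,dN_{ij}(t)-\int_{I_n}\lambda_{z_iz_j}(t;\theta)\,dt\Big\}.$$ **Algorithm.** Let $\pi^{(0)}$ be a fixed probability vector with positive entries, $q^{(0)}=\prod_i q_i^{(0)}$ a product law on $[K]^m$, $S^{(0)}_i(k)=1/K$, $\theta^{(0)}$ given, $\eta_n=n^{-\alpha}$. For $n\ge1$ let $e_{ik}=\mathbb E_{q^{(n-1)}(z_{-i})}\,l_n(\theta^{(n-1)}|z_i=k,z_{-i})$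 and $$q_i^{(n)}(k)\propto\pi_k^{(n-1)}e^{e_{ik}}S_i^{(n-1)}(k),\quad S_i^{(n)}(k)=S_i^{(n-1)}(k)e^{e_{ik}},\quad \pi^{(n)}_k=\tfrac1m\sum_i q_i^{(n)}(k),$$ $$\theta^{(n)}=\theta^{(n-1)}+\eta_n\frac1{|A|}\nabla_\theta\,\mathbb E_{q^{(n)}(z)}\,l_n(\theta|z)\Big|_{\theta=\theta^{(n-1)}} .$$ **Conditions.** Let $\bar l_n(\theta|z)=\mathbb E\,\frac1{|A|}l_n(\theta|z)$, $\bar l=\bar l_1$, $Q(\theta,q)=\mathbb E_{q(z)}\frac1{|A|}l_1(\theta|z)$, $\bar Q=\mathbb E\,Q$; let $d(q)=\mathrm{TV}(q,\delta_{z^*})$, $d_m=m^{r_d}$, let $d_i$ be the number of nodes joined to $i$ by an edge in either direction, and let $B(x,r)$ denote the open Euclidean ball. There are constants $c,\delta,r_d>0$ and $C$, not depending on $m$, such that $\lambda_{kl}$ is measurable in $t$, positive and $C^1$ in $\theta\in\Theta$, with $\lambda_{kl},|\log\lambda_{kl}|,\|\nabla_\theta\lambda_{kl}\|,\|\nabla_\theta\log\lambda_{kl}\|\le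 C$ for all $t\ge0$, $\theta\in\Theta$; and, for all sufficiently large $m$: 1. $\bar l_n(\theta|z)=\bar l(\theta|z)$ for all $n\ge1$, $\theta\in\Theta$, $z$; 2. $\bar l(\theta|z)\le\bar l(\theta|z^*)-c\,d_m\,\#\{i:z_i\ne z_i^*\}/|A|$ for all $z\neq z^*$ and $\theta\in\Theta\cap B(\theta^*,\delta)$; 3. for every product law $q$ with $d(q)<\delta$: $\bar Q(\theta,q)-\bar l(\theta|z^*)\le C\,d(q)$ for $\theta\in\Theta\cap B(\theta^*,\delta)$, and $\bar Q(\cdot,q)$ has a maximizer $\theta(q)$ over $\Theta$ with $\|\theta(q)-\theta^*\|_2\le C\,d(q)$; 4. for these $q$ and all $\theta\in\Theta\cap B(\theta(q),\delta)$: $\nabla_\theta\bar Q(\theta,q)^T(\theta-\theta(q))\le-c\|\theta-\theta(q)\|_2^2$ and $\mathbb E\|\nabla_\theta Q(\theta,q)\|_2^2\le C$; 5. $c\,d_m\le d_i\le C\,d_m$ for all $i$; 6. $\mathbb E_{q^{(0)}(z_{-i})}\bar l(\theta^*|z_i=k,z_{-i})\le\mathbb E_{q^{(0)}(z_{-i})}\bar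 l(\theta^*|z_i=z_i^*,z_{-i})-c\,d_i/|A|$ for all $i$ and $k\ne z_i^*$. **Claim.** Let $0<\alpha<1$. There is $\delta_0\in(0,\delta]$ such that for all initial values $\theta^{(0)}=\theta^{(0)}_m\in B(\theta^*,\delta_0)$ and all numbers of windows $W=W_m$, with $T=W\,dT$, $$\|\theta^{(n)}-\theta^*\|_2=O_p\Big(n^{-\alpha}\log(T|A|)^2+\frac1{\sqrt{|A|}}\Big)\quad(m\to\infty),$$ uniformly in $1\le n\le W$: for every $\varepsilon>0$ there is $C_0>0$ such that for all large $m$ and all $1\le n\le W_m$, $$\mathbb P\Big(\|\theta^{(n)}-\theta^*\|_2>C_0\big(n^{-\alpha}\log(T|A|)^2+|A|^{-1/2}\big)\Big)\le\varepsilon .$$ -/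

import Mathlib

open MeasureTheory ProbabilityTheory Filter Topology

namespace StreamNet

/-- The parameter space `ℝ^p` with its Euclidean norm. -/
abbrev Param (p : ℕ) := EuclideanSpace ℝ (Fin p)

/-- Block intensities: `lam k l t θ` is the intensity at time `t`, under the parameter `θ`, of the
events sent by a node of class `k` to a node of class `l`. -/
abbrev BlockIntensity (K p : ℕ) := Fin K → Fin K → ℝ → Param p → ℝ

/-- The random measure `N` on `[0, ∞)` is a Poisson point process with intensity function `r`:
the number of points in a bounded Borel set `B` is Poisson with mean `∫_B r`, and the
numbers of points in disjoint sets are independent. -/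
structure IsPoissonProcess {Ω : Type*} [MeasurableSpace Ω] (P : Measure Ω)
    (N : Ω → Measure ℝ) (r : ℝ → ℝ) : Prop where
  measurable : Measurable N
  law : ∀ B : Set ℝ, MeasurableSet B → B ⊆ Set.Ici 0 → Bornology.IsBounded B →
    P.map (fun ω => N ω B) =
      (poissonMeasure (∫ t in B, r t).toNNReal).map (fun k : ℕ => (k : ENNReal))
  indep : ∀ (s : ℕ) (B : Fin s → Set ℝ), (∀ a, MeasurableSet (B a)) →
    (∀ a, B a ⊆ Set.Ici 0) → (∀ a, Bornology.IsBounded (B a)) →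
    Pairwise (Function.onFun Disjoint B) →
    iIndepFun (fun a ω => N ω (B a)) P

/-- The `n`-th time window, `n = 1, 2, …`, of length `dT`. -/
def window (dT : ℝ) (n : ℕ) : Set ℝ := Set.Ioc (((n : ℝ) - 1) * dT) ((n : ℝ) * dT)

section Likelihood

variable {K p m : ℕ}

/-- The log-likelihood of the events of the `n`-th window given the labels `z`. Here `N e` is the
counting measure of the event times on the edge `e`. -/
noncomputable def windowLogLik (lam : BlockIntensity K p) (dT : ℝ) (A : Finset (Fin m × Fin m))
    (N : Fin m × Fin m → Measure ℝ) (n : ℕ) (θ : Param p) (z : Fin m → Fin K) : ℝ :=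
  ∑ e ∈ A, ((∫ t in window dT n, Real.log (lam (z e.1) (z e.2) t θ) ∂(N e))
    - ∫ t in window dT n, lam (z e.1) (z e.2) t θ)

/-- `q i` is a probability vector on the classes for each node `i`. -/
def IsMeanField (q : Fin m → Fin K → ℝ) : Prop :=
  (∀ i k, 0 ≤ q i k) ∧ ∀ i, ∑ k, q i k = 1

/-- The expectation of `f z` when the labels `z i` are independent with laws `q i`. -/
noncomputable def mfExp (q : Fin m → Fin K → ℝ) (f : (Fin m → Fin K) → ℝ) : ℝ :=
  ∑ z, (∏ i, q i (z i)) * f z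

/-- The expectation of `f z` when `z i = k` is fixed and the remaining labels `z j`, `j ≠ i`, are
independent with laws `q j`. -/
noncomputable def mfExpAt (q : Fin m → Fin K → ℝ) (i : Fin m) (k : Fin K)
    (f : (Fin m → Fin K) → ℝ) : ℝ :=
  ∑ z with z i = k, (∏ j ∈ Finset.univ.erase i, q j (z j)) * f z

/-- Total variation distance between the product law `q` and the point mass at `zs`. -/
noncomputable def tvDirac (q : Fin m → Fin K → ℝ) (zs : Fin m → Fin K) : ℝ :=
  (1 / 2) * ∑ z, |(∏ i, q i (z i)) - if z = zs then 1 else 0|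

/-- The number of nodes that node `i` is connected to by an edge in either direction. -/
def nodeDegree (A : Finset (Fin m × Fin m)) (i : Fin m) : ℕ :=
  (Finset.univ.filter fun j => (i, j) ∈ A ∨ (j, i) ∈ A).card

end Likelihood

section Algorithm

variable {K p m : ℕ}

/-- The quantities carried by the online algorithm: the parameter, the variational label laws,
the cumulative evidence matrix and the class proportions. -/
structure State (K p m : ℕ) where
  θ : Param p
  q : Fin m → Fin K → ℝ
  S : Fin m → Fin K → ℝ
  π : Fin K → ℝ

/-- The factor by which the evidence of node `i` for class `k` is multiplied, given the
log-likelihood `L` of the current window. -/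
noncomputable def evidence (L : Param p → (Fin m → Fin K) → ℝ) (s : State K p m)
    (i : Fin m) (k : Fin K) : ℝ :=
  Real.exp (mfExpAt s.q i k (L s.θ))

/-- The approximation step: the new variational label laws. -/
noncomputable def newQ (L : Param p → (Fin m → Fin K) → ℝ) (s : State K p m)
    (i : Fin m) (k : Fin K) : ℝ :=
  (s.π k * evidence L s i k * s.S i k) / ∑ l, s.π l * evidence L s i l * s.S i l

/-- One step of the online algorithm with step size `η`, network size `a = |A|` and current
window log-likelihood `L`. -/
noncomputable def step (L : Param p → (Fin m → Fin K) → ℝ) (a η : ℝ) (s : State K p m) :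
    State K p m where
  θ := s.θ + η • ((1 / a) • gradient (fun ϑ => mfExp (newQ L s) (L ϑ)) s.θ)
  q := newQ L s
  S := fun i k => s.S i k * evidence L s i k
  π := fun k => (1 / (m : ℝ)) * ∑ i, newQ L s i k

/-- The state of the online algorithm after `n` windows, with step sizes `η`, started from
`θ₀`, `q₀`, `π₀` and evidence `1 / K`. -/
noncomputable def run (lam : BlockIntensity K p) (dT : ℝ) (A : Finset (Fin m × Fin m))
    (N : Fin m × Fin m → Measure ℝ) (η : ℕ → ℝ)
    (θ₀ : Param p) (q₀ : Fin m → Fin K → ℝ) (π₀ : Fin K → ℝ) : ℕ → State K p m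
  | 0 => { θ := θ₀, q := q₀, S := fun _ _ => 1 / (K : ℝ), π := π₀ }
  | n + 1 => step (windowLogLik lam dT A N (n + 1)) (A.card : ℝ) (η (n + 1))
      (run lam dT A N η θ₀ q₀ π₀ n)

end Algorithm

section Population

variable {K p m : ℕ} {Ω : Type*} [MeasurableSpace Ω]

/-- The expected normalized log-likelihood of the `n`-th window. -/
noncomputable def meanLogLik (lam : BlockIntensity K p) (dT : ℝ) (A : Finset (Fin m × Fin m))
    (P : Measure Ω) (N : Fin m × Fin m → Ω → Measure ℝ) (n : ℕ) (θ : Param p)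
    (z : Fin m → Fin K) : ℝ :=
  ∫ ω, (1 / (A.card : ℝ)) * windowLogLik lam dT A (fun e => N e ω) n θ z ∂P

/-- The random `Q` function `Q(θ, q) = E_q l_w(θ | z)` of the first window. -/
noncomputable def Qfun (lam : BlockIntensity K p) (dT : ℝ) (A : Finset (Fin m × Fin m))
    (N : Fin m × Fin m → Ω → Measure ℝ) (θ : Param p) (q : Fin m → Fin K → ℝ) (ω : Ω) : ℝ :=
  mfExp q (fun z => (1 / (A.card : ℝ)) * windowLogLik lam dT A (fun e => N e ω) 1 θ z)

/-- The population `Q` function. -/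
noncomputable def Qbar (lam : BlockIntensity K p) (dT : ℝ) (A : Finset (Fin m × Fin m))
    (P : Measure Ω) (N : Fin m × Fin m → Ω → Measure ℝ) (θ : Param p)
    (q : Fin m → Fin K → ℝ) : ℝ :=
  ∫ ω, Qfun lam dT A N θ q ω ∂P

end Population

section Conditions

/-- Boundedness: on the parameter domain `Θ` the intensities are measurable in time and
continuously differentiable in the parameter; intensities, log-intensities and their derivatives
in the parameter are bounded by `C`. -/
structure Bounded {K p : ℕ} (lam : BlockIntensity K p) (Θ : Set (Param p)) (C : ℝ) : Prop where
  meas : ∀ k l, ∀ θ ∈ Θ, Measurable fun t => lam k l t θ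
  pos : ∀ k l t, 0 ≤ t → ∀ θ ∈ Θ, 0 < lam k l t θ
  smooth : ∀ k l t, 0 ≤ t → ContDiffOn ℝ 1 (fun θ => lam k l t θ) Θ
  bound : ∀ k l t, 0 ≤ t → ∀ θ ∈ Θ, lam k l t θ ≤ C
  bound_log : ∀ k l t, 0 ≤ t → ∀ θ ∈ Θ, |Real.log (lam k l t θ)| ≤ C
  bound_deriv : ∀ k l t, 0 ≤ t → ∀ θ ∈ Θ, ‖gradient (fun ϑ => lam k l t ϑ) θ‖ ≤ C
  bound_log_deriv : ∀ k l t, 0 ≤ t → ∀ θ ∈ Θ,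
    ‖gradient (fun ϑ => Real.log (lam k l t ϑ)) θ‖ ≤ C

/-- The conditions on the network with `m` nodes, edge set `A`, true labels `zs`, event data `N`
and initial label laws `q₀`, with constants `c`, `C`, `δ`, `rd`. The conditions on `Q` are only
required of product laws `q` within total variation `δ` of the point mass at `zs`. -/
structure Regular {K p m : ℕ} {Ω : Type*} [MeasurableSpace Ω] (lam : BlockIntensity K p)
    (dT : ℝ) (Θ : Set (Param p)) (θs : Param p) (A : Finset (Fin m × Fin m))
    (zs : Fin m → Fin K) (P : Measure Ω) (N : Fin m × Fin m → Ω → Measure ℝ)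
    (q₀ : Fin m → Fin K → ℝ) (c C δ rd : ℝ) : Prop where
  /-- Expectation: the mean log-likelihood does not depend on the window. -/
  stationary : ∀ n, 1 ≤ n → ∀ θ ∈ Θ, ∀ z,
    meanLogLik lam dT A P N n θ z = meanLogLik lam dT A P N 1 θ z
  /-- Latent membership identification. -/
  identification : ∀ z, z ≠ zs → ∀ θ ∈ Θ ∩ Metric.ball θs δ,
    meanLogLik lam dT A P N 1 θ z ≤ meanLogLik lam dT A P N 1 θ zs
      - c * ((m : ℝ) ^ rd * (hammingDist z zs : ℝ) / (A.card : ℝ))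
  /-- Continuity, first part. -/
  continuity : ∀ q, IsMeanField q → tvDirac q zs < δ → ∀ θ ∈ Θ ∩ Metric.ball θs δ,
    Qbar lam dT A P N θ q - meanLogLik lam dT A P N 1 θ zs ≤ C * tvDirac q zs
  /-- Continuity, second part, and the gradient condition, for a maximizer `θq`. -/
  maximizer : ∀ q, IsMeanField q → tvDirac q zs < δ →
    ∃ θq ∈ Θ, IsMaxOn (fun θ => Qbar lam dT A P N θ q) Θ θq ∧
      ‖θq - θs‖ ≤ C * tvDirac q zs ∧
      ∀ θ ∈ Θ ∩ Metric.ball θq δ,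
        inner ℝ (gradient (fun ϑ => Qbar lam dT A P N ϑ q) θ) (θ - θq)
            ≤ -c * ‖θ - θq‖ ^ 2 ∧
        ∫⁻ ω, ENNReal.ofReal (‖gradient (fun ϑ => Qfun lam dT A N ϑ q ω) θ‖ ^ 2) ∂P
            ≤ ENNReal.ofReal C
  /-- Network degree. -/
  degree : ∀ i, c * (m : ℝ) ^ rd ≤ (nodeDegree A i : ℝ) ∧
    (nodeDegree A i : ℝ) ≤ C * (m : ℝ) ^ rd
  /-- Initial condition on the label laws. -/
  initial : ∀ i, ∀ k, k ≠ zs i →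
    mfExpAt q₀ i k (meanLogLik lam dT A P N 1 θs) ≤
      mfExpAt q₀ i (zs i) (meanLogLik lam dT A P N 1 θs)
        - c * ((nodeDegree A i : ℝ) / (A.card : ℝ))

end Conditions

end StreamNet

/-! Write `a = |A|`, `d = m ^ rd`, `η n = n ^ (-α)`. The argument is pathwise on an event `GoodData`
that concerns all windows at once and has probability close to one; second moments at the fixed
window `n` then give the rate.

Localisation. The likelihood is controlled only for parameters in `Θ`. `clampRun` therefore
evaluates it at the parameter retracted onto a closed ball of radius `ρ` around `θs` inside `Θ`.
This version is adapted to the events of the past windows, and `Bounded.run_eq_clampRun` identifies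
it with the algorithm whenever it never leaves the open ball.

Labels. The odds of a wrong class `k` against the true class of node `i` are, up to the class
proportions, the exponential of the accumulated likelihood gains. In each gain, replacing the
parameter by `θs` and the label law by the point mass at the truth costs at most a small `κ` times
the number of events plus observed time on the edges at `i`; the first window keeps the law `q₀`
instead. The resulting sum `excess` is a Poisson integral. By identification and the initial
condition its mean is at most `-(3/4) min c (c ^ 2) n d`, and a Chernoff bound with a union over
windows, nodes and classes makes it at most a negative multiple of `n d` throughout. An induction
over windows (`clampRun_concentrates`) then bounds the mass on wrong labels by a polynomial in `m`
times `exp (-γ n d)`, so that the label error in the gradient step is below `a ^ (-1/2)` in every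
window.

Parameter. With `Δ n = θ n - θs`, one step reads `Δ (n+1) = Δ n + η (n+1) (g n + ξ n + r n)`: `g` is
the population gradient at the true labels, strongly monotone towards `θs` and of linear growth; `ξ`
is noise, centred given the past; `r` is the label error. Subtracting the linear filter `U (n+1) =
(1 - c η (n+1)) U n + η (n+1) ξ n` leaves a recursion for `Δ - U` in which the noise no longer
appears directly. The energy estimate `sgd_step` contracts `‖Δ - U‖ ^ 2` by `1 - c η / 4 + O(η ^ 2)`
up to `O(η) (‖U‖ ^ 2 + ‖r‖ ^ 2)`. Since `α < 1`, the product of the factors is `O(n ^ (-2α))`, so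
the initial error contributes `n ^ (-α)` and the rest is a bounded weighted sum of `‖U‖ ^ 2 + 1 / a`
(`exists_sgd_bound`).

Noise. The filter is linear in the noise, so exponential moments propagate from window to window
(`exists_filtered_noise_mgf`). They yield `E ‖U n‖ ^ 2 = O(1 / a)` uniformly in `n`, and tails `exp
(-s a n ^ α)` that are summable over `n`. The tails keep the whole path in the ball, however many
windows there are; the second moments and Markov's inequality give `n ^ (-α) + a ^ (-1/2)`. Of the
squared logarithm only the lower bound one is needed. -/

namespace StreamNet

/-! ### Laplace transform and mean of the Poisson distribution. -/

section PoissonLaw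

theorem lintegral_poissonMeasure (r : NNReal) (f : ℕ → ENNReal) :
    ∫⁻ k, f k ∂(poissonMeasure r) =
      ∑' k : ℕ, ENNReal.ofReal (Real.exp (-r) * (r : ℝ) ^ k / (Nat.factorial k : ℝ)) * f k := by
  rw [poissonMeasure, lintegral_sum_measure]
  simp [lintegral_smul_measure, lintegral_dirac]

theorem lintegral_exp_mul_poissonMeasure (r : NNReal) (a : ℝ) :
    ∫⁻ k : ℕ, ENNReal.ofReal (Real.exp (a * k)) ∂(poissonMeasure r) =
      ENNReal.ofReal (Real.exp ((r : ℝ) * (Real.exp a - 1))) := by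
  rw [lintegral_poissonMeasure]
  have h : HasSum (fun k : ℕ => Real.exp (-r) * (r : ℝ) ^ k / (Nat.factorial k : ℝ)
      * Real.exp (a * k)) (Real.exp ((r : ℝ) * (Real.exp a - 1))) := by
    have h1 := (NormedSpace.expSeries_div_hasSum_exp ((r : ℝ) * Real.exp a)).mul_left
      (Real.exp (-r))
    rw [← Real.exp_eq_exp_ℝ, ← Real.exp_add] at h1
    convert! h1 using 1
    · ext k
      rw [mul_pow, mul_comm a, Real.exp_nat_mul]
      ring
    · congr 1
      ring
  rw [← h.tsum_eq, ENNReal.ofReal_tsum_of_nonneg (fun k => by positivity) h.summable]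
  congr 1 with k
  rw [← ENNReal.ofReal_mul (by positivity)]

theorem lintegral_natCast_poissonMeasure (r : NNReal) :
    ∫⁻ k : ℕ, (k : ENNReal) ∂(poissonMeasure r) = r := by
  rw [lintegral_poissonMeasure]
  have h : HasSum (fun k : ℕ => Real.exp (-r) * (r : ℝ) ^ k / (Nat.factorial k : ℝ) * k) r := by
    -- The term `k = 0` vanishes, and `k r ^ k / k! = r · r ^ (k-1) / (k-1)!`.
    rw [← hasSum_nat_add_iff' 1]
    have h1 := (hasSum_one_poissonMeasure r).mul_left (r : ℝ)
    simp only [Finset.sum_range_one, Nat.cast_zero, mul_zero, sub_zero]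
    rw [mul_one] at h1
    convert! h1 using 1
    ext k
    rw [Nat.factorial_succ]
    have : ((k : ℝ) + 1) ≠ 0 := by positivity
    have : ((Nat.factorial k : ℕ) : ℝ) ≠ 0 := by positivity
    push_cast
    field_simp
    ring
  have h2 : ∀ k : ℕ, ENNReal.ofReal (Real.exp (-r) * (r : ℝ) ^ k / (Nat.factorial k : ℝ)) * k =
      ENNReal.ofReal (Real.exp (-r) * (r : ℝ) ^ k / (Nat.factorial k : ℝ) * k) := by
    intro k
    rw [ENNReal.ofReal_mul (by positivity), ENNReal.ofReal_natCast]
  simp_rw [h2]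
  rw [← ENNReal.ofReal_tsum_of_nonneg (fun k => by positivity) h.summable, h.tsum_eq]
  simp

end PoissonLaw

/-! ### Measurability of integrals in the measure, and Campbell's formula. -/

section PointProcess

variable {Ω : Type*} [MeasurableSpace Ω] {P : Measure Ω} {N : Ω → Measure ℝ} {r : ℝ → ℝ}

theorem measurable_restrict_measure {α : Type*} [MeasurableSpace α] {I : Set α}
    (hI : MeasurableSet I) :
    Measurable fun ν : Measure α => ν.restrict I := by
  refine Measure.measurable_of_measurable_coe _ fun s hs => ?_
  simp_rw [Measure.restrict_apply hs]
  exact Measure.measurable_coe (hs.inter hI)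

/-- On the measurable set of measures that integrate `f`, the Bochner integral is a difference of
two Lebesgue integrals; elsewhere it is zero by convention. No finiteness assumption is needed. -/
theorem measurable_integral_measure {α : Type*} [MeasurableSpace α] {f : α → ℝ}
    (hf : Measurable f) : Measurable fun ν : Measure α => ∫ x, f x ∂ν := by
  have h1 : Measurable fun ν : Measure α => ∫⁻ x, ENNReal.ofReal (f x) ∂ν :=
    Measure.measurable_lintegral hf.ennreal_ofReal
  have h2 : Measurable fun ν : Measure α => ∫⁻ x, ENNReal.ofReal (-f x) ∂ν :=
    Measure.measurable_lintegral hf.neg.ennreal_ofReal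
  have h3 : Measurable fun ν : Measure α => ∫⁻ x, ‖f x‖ₑ ∂ν :=
    Measure.measurable_lintegral hf.enorm
  have h4 : MeasurableSet {ν : Measure α | ∫⁻ x, ‖f x‖ₑ ∂ν < ⊤} :=
    h3 measurableSet_Iio
  have h5 : (fun ν : Measure α => ∫ x, f x ∂ν) =
      Set.indicator {ν : Measure α | ∫⁻ x, ‖f x‖ₑ ∂ν < ⊤} (fun ν =>
        (∫⁻ x, ENNReal.ofReal (f x) ∂ν).toReal - (∫⁻ x, ENNReal.ofReal (-f x) ∂ν).toReal) := by
    ext ν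
    by_cases hν : ∫⁻ x, ‖f x‖ₑ ∂ν < ⊤
    · rw [Set.indicator_of_mem (by exact hν), integral_eq_lintegral_pos_part_sub_lintegral_neg_part
        ⟨hf.aestronglyMeasurable, hν⟩]
    · rw [Set.indicator_of_notMem (by exact hν), integral_undef]
      exact fun h => hν h.2
  rw [h5]
  exact (h1.ennreal_toReal.sub h2.ennreal_toReal).indicator h4

namespace IsPoissonProcess

theorem measurable_apply (h : IsPoissonProcess P N r) {B : Set ℝ} (hB : MeasurableSet B) :
    Measurable fun ω => N ω B :=
  (Measure.measurable_coe hB).comp h.measurable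

theorem lintegral_comp (h : IsPoissonProcess P N r) {B : Set ℝ} (hB : MeasurableSet B)
    (hB0 : B ⊆ Set.Ici 0) (hBb : Bornology.IsBounded B) {g : ENNReal → ENNReal}
    (hg : Measurable g) :
    ∫⁻ ω, g (N ω B) ∂P = ∫⁻ k : ℕ, g k ∂(poissonMeasure (∫ t in B, r t).toNNReal) := by
  rw [← lintegral_map hg (h.measurable_apply hB), h.law B hB hB0 hBb,
    lintegral_map hg (measurable_from_nat)]

theorem ae_lt_top (h : IsPoissonProcess P N r) {B : Set ℝ} (hB : MeasurableSet B)
    (hB0 : B ⊆ Set.Ici 0) (hBb : Bornology.IsBounded B) : ∀ᵐ ω ∂P, N ω B < ⊤ := by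
  refine MeasureTheory.ae_lt_top (h.measurable_apply hB) ?_
  have := h.lintegral_comp hB hB0 hBb measurable_id
  simp only [id] at this
  rw [this, lintegral_natCast_poissonMeasure]
  exact ENNReal.coe_ne_top

/-- Laplace functional of the number of points in a bounded set. -/
theorem lintegral_exp_mul (h : IsPoissonProcess P N r) {B : Set ℝ} (hB : MeasurableSet B)
    (hB0 : B ⊆ Set.Ici 0) (hBb : Bornology.IsBounded B) (hr : 0 ≤ ∫ t in B, r t) (a : ℝ) :
    ∫⁻ ω, ENNReal.ofReal (Real.exp (a * (N ω B).toReal)) ∂P =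
      ENNReal.ofReal (Real.exp ((∫ t in B, r t) * (Real.exp a - 1))) := by
  rw [h.lintegral_comp hB hB0 hBb (g := fun x => ENNReal.ofReal (Real.exp (a * x.toReal)))
    (by fun_prop)]
  simp only [ENNReal.toReal_natCast]
  rw [lintegral_exp_mul_poissonMeasure, Real.coe_toNNReal _ hr]

/-- Campbell's formula for non-negative functions. -/
theorem lintegral_lintegral (h : IsPoissonProcess P N r) {B : Set ℝ} (hB : MeasurableSet B)
    (hB0 : B ⊆ Set.Ici 0) (hBb : Bornology.IsBounded B) (hr : IntegrableOn r B)
    (hr0 : ∀ t ∈ B, 0 ≤ r t) {g : ℝ → ENNReal} (hg : Measurable g) :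
    ∫⁻ ω, ∫⁻ t in B, g t ∂(N ω) ∂P = ∫⁻ t in B, g t * ENNReal.ofReal (r t) := by
  have hm : Measurable fun ω => (N ω).restrict B :=
    (measurable_restrict_measure hB).comp h.measurable
  -- The mean of the random measure `N` on `B` has density `r`. Both measures need to be compared
  -- only on sets, where the mean of the Poisson law enters.
  have key : P.bind (fun ω => (N ω).restrict B) =
      (volume.restrict B).withDensity fun t => ENNReal.ofReal (r t) := by
    ext s hs
    rw [Measure.bind_apply hs hm.aemeasurable, withDensity_apply _ hs]
    simp_rw [Measure.restrict_apply hs]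
    have hsB : s ∩ B ⊆ B := Set.inter_subset_right
    have := h.lintegral_comp (hs.inter hB) (hsB.trans hB0) (hBb.subset hsB) measurable_id
    simp only [id] at this
    rw [this, lintegral_natCast_poissonMeasure, Measure.restrict_restrict hs,
      ← ofReal_integral_eq_lintegral_ofReal (hr.mono_set hsB)]
    · rfl
    · exact (ae_restrict_iff' (hs.inter hB)).2 (Eventually.of_forall fun t ht => hr0 t (hsB ht))
  rw [← Measure.lintegral_bind hm.aemeasurable hg.aemeasurable, key,
    lintegral_withDensity_eq_lintegral_mul₀' hr.aestronglyMeasurable.aemeasurable.ennreal_ofReal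
      hg.aemeasurable]
  refine lintegral_congr fun t => ?_
  simp [mul_comm]

/-- Campbell's formula. -/
theorem integral_integral (h : IsPoissonProcess P N r) {B : Set ℝ} (hB : MeasurableSet B)
    (hB0 : B ⊆ Set.Ici 0) (hBb : Bornology.IsBounded B) (hr : IntegrableOn r B)
    (hr0 : ∀ t ∈ B, 0 ≤ r t) {f : ℝ → ℝ} (hf : Measurable f) {b : ℝ} (hfb : ∀ t ∈ B, |f t| ≤ b) :
    Integrable (fun ω => ∫ t in B, f t ∂(N ω)) P ∧
      ∫ ω, ∫ t in B, f t ∂(N ω) ∂P = ∫ t in B, f t * r t := by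
  have hm : Measurable fun ω => (N ω).restrict B :=
    (measurable_restrict_measure hB).comp h.measurable
  have hfr : IntegrableOn (fun t => f t * r t) B :=
    Integrable.bdd_mul (c := b) hr hf.aestronglyMeasurable
      ((ae_restrict_iff' hB).2 (Eventually.of_forall fun t ht => by simpa using hfb t ht))
  have aux : ∀ g : ℝ → ℝ, Measurable g → (∀ t ∈ B, |g t| ≤ b) →
      Integrable (fun ω => (∫⁻ t in B, ENNReal.ofReal (g t) ∂(N ω)).toReal) P ∧
      ∫ ω, (∫⁻ t in B, ENNReal.ofReal (g t) ∂(N ω)).toReal ∂P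
        = (∫⁻ t in B, ENNReal.ofReal (g t * r t)).toReal ∧
      ∫⁻ t in B, ENNReal.ofReal (g t * r t) ≠ ⊤ := by
    intro g hg hgb
    have hgm : Measurable fun ω => ∫⁻ t in B, ENNReal.ofReal (g t) ∂(N ω) :=
      (Measure.measurable_lintegral hg.ennreal_ofReal).comp hm
    have e1 : ∫⁻ ω, ∫⁻ t in B, ENNReal.ofReal (g t) ∂(N ω) ∂P
        = ∫⁻ t in B, ENNReal.ofReal (g t * r t) := by
      rw [h.lintegral_lintegral hB hB0 hBb hr hr0 hg.ennreal_ofReal]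
      refine setLIntegral_congr_fun hB fun t ht => ?_
      rw [ENNReal.ofReal_mul' (hr0 t ht)]
    have hgr : IntegrableOn (fun t => g t * r t) B :=
      Integrable.bdd_mul (c := b) hr hg.aestronglyMeasurable
        ((ae_restrict_iff' hB).2 (Eventually.of_forall fun t ht => by simpa using hgb t ht))
    have e2 : ∫⁻ t in B, ENNReal.ofReal (g t * r t) ≠ ⊤ := hgr.lintegral_lt_top.ne
    refine ⟨integrable_toReal_of_lintegral_ne_top hgm.aemeasurable (e1 ▸ e2), ?_, e2⟩
    rw [integral_toReal hgm.aemeasurable (MeasureTheory.ae_lt_top hgm (e1 ▸ e2)), e1]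
  obtain ⟨p1, p2, p3⟩ := aux f hf hfb
  obtain ⟨n1, n2, n3⟩ := aux (fun t => -f t) hf.neg (fun t ht => by simpa using hfb t ht)
  have hae : ∀ᵐ ω ∂P, ∫ t in B, f t ∂(N ω) =
      (∫⁻ t in B, ENNReal.ofReal (f t) ∂(N ω)).toReal
        - (∫⁻ t in B, ENNReal.ofReal (-f t) ∂(N ω)).toReal := by
    filter_upwards [h.ae_lt_top hB hB0 hBb] with ω hω
    refine integral_eq_lintegral_pos_part_sub_lintegral_neg_part ?_
    refine Measure.integrableOn_of_bounded (M := b) hω.ne hf.aestronglyMeasurable ?_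
    exact (ae_restrict_iff' hB).2 (Eventually.of_forall fun t ht => by simpa using hfb t ht)
  refine ⟨(integrable_congr hae).2 (p1.sub n1), ?_⟩
  rw [integral_congr_ae hae, integral_sub p1 n1, p2, n2,
    integral_eq_lintegral_pos_part_sub_lintegral_neg_part hfr]
  simp only [neg_mul]

end IsPoissonProcess

end PointProcess

/-! ### The Laplace functional of a Poisson process. -/

section PointProcess

variable {Ω : Type*} [MeasurableSpace Ω] {P : Measure Ω} {N : Ω → Measure ℝ} {r : ℝ → ℝ}

namespace IsPoissonProcess

theorem iIndepFun_apply (h : IsPoissonProcess P N r) {ι : Type*} [Fintype ι] (B : ι → Set ℝ)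
    (hB : ∀ a, MeasurableSet (B a)) (hB0 : ∀ a, B a ⊆ Set.Ici 0)
    (hBb : ∀ a, Bornology.IsBounded (B a)) (hd : Pairwise (Function.onFun Disjoint B)) :
    iIndepFun (fun a ω => N ω (B a)) P := by
  have e := Fintype.equivFin ι
  have h1 := h.indep (Fintype.card ι) (fun a => B (e.symm a)) (fun a => hB _) (fun a => hB0 _)
    (fun a => hBb _) (fun a b hab => hd (e.symm.injective.ne hab))
  have h2 := h1.precomp e.injective
  simpa [Function.comp_def] using h2

/-- The level sets of `s` are disjoint, so their point counts are independent and the exponential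
moment factors into Poisson Laplace transforms. -/
theorem lintegral_exp_integral_simpleFunc (h : IsPoissonProcess P N r) {B : Set ℝ}
    (hB : MeasurableSet B) (hB0 : B ⊆ Set.Ici 0) (hBb : Bornology.IsBounded B)
    (hr : IntegrableOn r B) (hr0 : ∀ t ∈ B, 0 ≤ r t) (s : SimpleFunc ℝ ℝ) :
    ∫⁻ ω, ENNReal.ofReal (Real.exp (∫ t in B, s t ∂(N ω))) ∂P =
      ENNReal.ofReal (Real.exp (∫ t in B, (Real.exp (s t) - 1) * r t)) := by
  have hsm : ∀ x, MeasurableSet (s ⁻¹' {x} ∩ B) := fun x => (s.measurableSet_fiber x).inter hB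
  have hsB : ∀ x, s ⁻¹' {x} ∩ B ⊆ B := fun x => Set.inter_subset_right
  have hae : ∀ᵐ ω ∂P, ENNReal.ofReal (Real.exp (∫ t in B, s t ∂(N ω))) =
      ∏ x ∈ s.range.attach, ENNReal.ofReal
        (Real.exp (x.1 * (N ω (s ⁻¹' {x.1} ∩ B)).toReal)) := by
    filter_upwards [h.ae_lt_top hB hB0 hBb] with ω hω
    have : IsFiniteMeasure ((N ω).restrict B) := ⟨by simpa using hω⟩
    rw [← SimpleFunc.integral_eq_integral s (SimpleFunc.integrable_of_isFiniteMeasure s),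
      SimpleFunc.integral_eq, Real.exp_sum, ENNReal.ofReal_prod_of_nonneg
        (fun _ _ => (Real.exp_pos _).le), ← Finset.prod_attach]
    refine Finset.prod_congr rfl fun x _ => ?_
    rw [Measure.real, Measure.restrict_apply (s.measurableSet_fiber x.1), smul_eq_mul, mul_comm]
  have hind := h.iIndepFun_apply (fun x : {x // x ∈ s.range} => s ⁻¹' {x.1} ∩ B)
    (fun x => hsm _) (fun x => (hsB _).trans hB0) (fun x => hBb.subset (hsB _))
    (fun x y hxy => by
      refine Set.disjoint_left.2 fun t ht ht' => hxy (Subtype.ext ?_)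
      exact ht.1.symm.trans ht'.1)
  have hind' := hind.comp (fun x v => ENNReal.ofReal (Real.exp (x.1 * ENNReal.toReal v)))
    (fun x => by fun_prop)
  rw [lintegral_congr_ae hae]
  have := lintegral_prod_eq_prod_lintegral_of_indepFun s.range.attach _ hind'
    (fun x => by
      have := h.measurable_apply (hsm x.1)
      simp only [Function.comp_def]
      fun_prop)
  simp only [Function.comp_def] at this
  rw [this]
  have hx : ∀ x : {x // x ∈ s.range}, ∫⁻ ω, ENNReal.ofReal
      (Real.exp (x.1 * (N ω (s ⁻¹' {x.1} ∩ B)).toReal)) ∂P =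
      ENNReal.ofReal (Real.exp ((∫ t in s ⁻¹' {x.1} ∩ B, r t) * (Real.exp x.1 - 1))) := fun x =>
    h.lintegral_exp_mul (hsm _) ((hsB _).trans hB0) (hBb.subset (hsB _))
      (setIntegral_nonneg (hsm _) fun t ht => hr0 t ht.2) x.1
  rw [Finset.prod_congr rfl fun x _ => hx x, ← ENNReal.ofReal_prod_of_nonneg
    (fun _ _ => (Real.exp_pos _).le), ← Real.exp_sum]
  congr 2
  have hdecomp : ∀ t, (Real.exp (s t) - 1) * r t =
      ∑ x ∈ s.range, (s ⁻¹' {x}).indicator (fun t => (Real.exp x - 1) * r t) t := by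
    intro t
    rw [Finset.sum_eq_single (s t)]
    · rw [Set.indicator_of_mem (by simp)]
    · intro x _ hx
      rw [Set.indicator_of_notMem (by simpa using hx.symm)]
    · intro h
      exact absurd (s.mem_range_self t) h
  simp_rw [hdecomp]
  rw [integral_finsetSum, ← Finset.sum_attach s.range]
  · refine Finset.sum_congr rfl fun x _ => ?_
    rw [integral_indicator (s.measurableSet_fiber _), Measure.restrict_restrict
      (s.measurableSet_fiber _), integral_const_mul, mul_comm]
  · intro x _
    exact (hr.const_mul _).indicator (s.measurableSet_fiber _)

/-- Upper bound for the Laplace functional of a Poisson process. -/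
theorem lintegral_exp_integral_le (h : IsPoissonProcess P N r) {B : Set ℝ}
    (hB : MeasurableSet B) (hB0 : B ⊆ Set.Ici 0) (hBb : Bornology.IsBounded B)
    (hr : IntegrableOn r B) (hr0 : ∀ t ∈ B, 0 ≤ r t) {f : ℝ → ℝ} (hf : Measurable f) {b : ℝ}
    (hb : 0 ≤ b) (hfb : ∀ t ∈ B, |f t| ≤ b) :
    ∫⁻ ω, ENNReal.ofReal (Real.exp (∫ t in B, f t ∂(N ω))) ∂P ≤
      ENNReal.ofReal (Real.exp (∫ t in B, (Real.exp (f t) - 1) * r t)) := by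
  have hm : Measurable fun ω => (N ω).restrict B :=
    (measurable_restrict_measure hB).comp h.measurable
  set s : ℕ → SimpleFunc ℝ ℝ := hf.stronglyMeasurable.approxBounded b with hs
  have hsb : ∀ n t, ‖s n t‖ ≤ b := fun n t => hf.stronglyMeasurable.norm_approxBounded_le hb n t
  have hst : ∀ t ∈ B, Tendsto (fun n => s n t) atTop (𝓝 (f t)) := fun t ht =>
    hf.stronglyMeasurable.tendsto_approxBounded_of_norm_le (by simpa using hfb t ht)
  have hl : ∀ᵐ ω ∂P, Tendsto (fun n => ENNReal.ofReal (Real.exp (∫ t in B, s n t ∂(N ω)))) atTop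
      (𝓝 (ENNReal.ofReal (Real.exp (∫ t in B, f t ∂(N ω))))) := by
    filter_upwards [h.ae_lt_top hB hB0 hBb] with ω hω
    have : IsFiniteMeasure ((N ω).restrict B) := ⟨by simpa using hω⟩
    refine ENNReal.tendsto_ofReal ((Real.continuous_exp.tendsto _).comp ?_)
    refine tendsto_integral_of_dominated_convergence (fun _ => b)
      (fun n => (s n).measurable.aestronglyMeasurable) (integrable_const b)
      (fun n => Eventually.of_forall (hsb n)) ?_
    exact (ae_restrict_iff' hB).2 (Eventually.of_forall hst)
  have hrlim : Tendsto (fun n => ENNReal.ofReal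
      (Real.exp (∫ t in B, (Real.exp (s n t) - 1) * r t))) atTop
      (𝓝 (ENNReal.ofReal (Real.exp (∫ t in B, (Real.exp (f t) - 1) * r t)))) := by
    refine ENNReal.tendsto_ofReal ((Real.continuous_exp.tendsto _).comp ?_)
    refine tendsto_integral_of_dominated_convergence (fun t => (Real.exp b + 1) * ‖r t‖)
      (fun n => ?_) (hr.norm.const_mul _) (fun n => Eventually.of_forall fun t => ?_) ?_
    · exact (((Real.measurable_exp.comp (s n).measurable).sub_const 1).aestronglyMeasurable).mul
        hr.aestronglyMeasurable
    · rw [norm_mul]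
      gcongr
      refine (norm_sub_le _ _).trans ?_
      rw [Real.norm_eq_abs, abs_of_pos (Real.exp_pos _), norm_one]
      gcongr
      exact (le_abs_self _).trans (hsb n t)
    · refine (ae_restrict_iff' hB).2 (Eventually.of_forall fun t ht => ?_)
      exact (((Real.continuous_exp.tendsto _).comp (hst t ht)).sub_const 1).mul_const _
  -- Fatou's lemma needs no uniform integrability and gives an inequality, which is all that a
  -- Chernoff bound requires.
  calc ∫⁻ ω, ENNReal.ofReal (Real.exp (∫ t in B, f t ∂(N ω))) ∂P
      = ∫⁻ ω, liminf (fun n => ENNReal.ofReal (Real.exp (∫ t in B, s n t ∂(N ω)))) atTop ∂P :=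
        lintegral_congr_ae (hl.mono fun ω hω => hω.liminf_eq.symm)
    _ ≤ liminf (fun n => ∫⁻ ω, ENNReal.ofReal (Real.exp (∫ t in B, s n t ∂(N ω))) ∂P) atTop := by
        refine lintegral_liminf_le fun n => ?_
        have := (measurable_integral_measure (s n).measurable).comp hm
        simp only [Function.comp_def] at this
        fun_prop
    _ = liminf (fun n => ENNReal.ofReal
          (Real.exp (∫ t in B, (Real.exp (s n t) - 1) * r t))) atTop := by
        simp_rw [h.lintegral_exp_integral_simpleFunc hB hB0 hBb hr hr0]
    _ = _ := hrlim.liminf_eq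

end IsPoissonProcess

end PointProcess

/-! ### Independence of the events in disjoint time sets. -/

/-- Finite intersections of events of the `m₁ i` form a π-system that generates the supremum, and
each of them involves finitely many indices only. -/
theorem indep_iSup_of_forall_finset {Ω ι κ : Type*} {mΩ : MeasurableSpace Ω} {P : Measure Ω}
    [IsProbabilityMeasure P] {m₁ : ι → MeasurableSpace Ω} {m₂ : κ → MeasurableSpace Ω}
    (h₁ : ∀ i, m₁ i ≤ mΩ) (h₂ : ∀ i, m₂ i ≤ mΩ)
    (h : ∀ (F : Finset ι) (G : Finset κ), Indep (⨆ i ∈ F, m₁ i) (⨆ i ∈ G, m₂ i) P) :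
    Indep (⨆ i, m₁ i) (⨆ i, m₂ i) P := by
  have e₁ := generateFrom_piiUnionInter_measurableSet m₁ Set.univ
  have e₂ := generateFrom_piiUnionInter_measurableSet m₂ Set.univ
  simp only [Set.mem_univ, iSup_pos] at e₁ e₂
  refine IndepSets.indep (iSup_le h₁) (iSup_le h₂)
    (isPiSystem_piiUnionInter _ (fun n => @MeasurableSpace.isPiSystem_measurableSet Ω (m₁ n)) _)
    (isPiSystem_piiUnionInter _ (fun n => @MeasurableSpace.isPiSystem_measurableSet Ω (m₂ n)) _)
    e₁.symm e₂.symm ?_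
  rw [IndepSets_iff]
  rintro _ _ ⟨F, -, f, hf, rfl⟩ ⟨G, -, g, hg, rfl⟩
  refine (Indep_iff _ _ _).1 (h F G) _ _ ?_ ?_
  · refine Finset.measurableSet_biInter _ fun i hi => ?_
    exact (le_iSup₂_of_le (f := fun i (_ : i ∈ F) => m₁ i) i hi le_rfl) _ (hf i hi)
  · refine Finset.measurableSet_biInter _ fun i hi => ?_
    exact (le_iSup₂_of_le (f := fun i (_ : i ∈ G) => m₂ i) i hi le_rfl) _ (hg i hi)

theorem comap_restrict_eq_iSup {Ω : Type*} (N : Ω → Measure ℝ) {I : Set ℝ}  :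
    MeasurableSpace.comap (fun ω => (N ω).restrict I) inferInstance =
      ⨆ s : {s : Set ℝ // MeasurableSet s},
        MeasurableSpace.comap (fun ω => N ω (s.1 ∩ I)) inferInstance := by
  have : (inferInstance : MeasurableSpace (Measure ℝ)) =
    ⨆ s : {s : Set ℝ // MeasurableSet s}, (borel ENNReal).comap fun μ => μ s.1 := by
    rw [iSup_subtype]
    rfl
  rw [this, MeasurableSpace.comap_iSup]
  refine iSup_congr fun s => ?_
  rw [MeasurableSpace.comap_comp, ← BorelSpace.measurable_eq]
  congr 1
  ext ω
  simp [Measure.restrict_apply s.2]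

namespace IsPoissonProcess

variable {Ω : Type*} [MeasurableSpace Ω] {P : Measure Ω} {N : Ω → Measure ℝ} {r : ℝ → ℝ}

/-- Makes a window independent of the past. Finitely many counts on overlapping sets are sums of
counts on disjoint atoms, and those are independent by the definition of the process. -/
theorem indepFun_restrict [IsProbabilityMeasure P] (h : IsPoissonProcess P N r) {I J : Set ℝ}
    (hI : MeasurableSet I) (hJ : MeasurableSet J) (hI0 : I ⊆ Set.Ici 0) (hJ0 : J ⊆ Set.Ici 0)
    (hIb : Bornology.IsBounded I) (hJb : Bornology.IsBounded J) (hIJ : Disjoint I J) :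
    IndepFun (fun ω => (N ω).restrict I) (fun ω => (N ω).restrict J) P := by
  classical
  rw [IndepFun_iff_Indep, comap_restrict_eq_iSup, comap_restrict_eq_iSup]
  refine indep_iSup_of_forall_finset
    (fun s => (h.measurable_apply (s.2.inter hI)).comap_le)
    (fun s => (h.measurable_apply (s.2.inter hJ)).comap_le) fun F₁ F₂ => ?_
  set G := F₁ ∪ F₂ with hG
  -- A point is classified by the members of `G` that contain it; the fibres of `c` are the atoms of
  -- the finite algebra generated by `G`.
  set c : ℝ → Finset {s : Set ℝ // MeasurableSet s} := fun t => G.filter fun s => t ∈ s.1 with hc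
  have hcG : ∀ t, c t ∈ G.powerset := fun t => Finset.mem_powerset.2 (Finset.filter_subset _ _)
  have hcm : ∀ g, MeasurableSet (c ⁻¹' {g}) := by
    intro g
    by_cases hg : g ⊆ G
    · have : c ⁻¹' {g} = ⋂ s ∈ G, if s ∈ g then s.1 else s.1ᶜ := by
        ext t
        simp only [Set.mem_preimage, Set.mem_singleton_iff, Set.mem_iInter, hc, Finset.ext_iff,
          Finset.mem_filter]
        constructor
        · intro ht s hs
          by_cases hsg : s ∈ g
          · simpa [hsg] using ((ht s).2 hsg).2
          · simp only [hsg, if_false]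
            exact fun hts => hsg ((ht s).1 ⟨hs, hts⟩)
        · intro ht s
          constructor
          · rintro ⟨hs, hts⟩
            by_contra hsg
            have := ht s hs
            simp only [hsg, if_false] at this
            exact this hts
          · intro hsg
            have := ht s (hg hsg)
            simp only [hsg, if_true] at this
            exact ⟨hg hsg, this⟩
      rw [this]
      refine Finset.measurableSet_biInter _ fun s _ => ?_
      split_ifs
      exacts [s.2, s.2.compl]
    · have : c ⁻¹' {g} = ∅ := by
        ext t
        simp only [Set.mem_preimage, Set.mem_singleton_iff, Set.mem_empty_iff_false, iff_false]
        rintro rfl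
        exact hg (Finset.filter_subset _ _)
      rw [this]
      exact MeasurableSet.empty
  let I' : Bool → Set ℝ := fun b => if b then I else J
  have hI'm : ∀ b, MeasurableSet (I' b) := by rintro (_ | _) <;> simpa [I']
  have hI'0 : ∀ b, I' b ⊆ Set.Ici 0 := by rintro (_ | _) <;> simpa [I']
  have hI'b : ∀ b, Bornology.IsBounded (I' b) := by rintro (_ | _) <;> simpa [I']
  have hI'd : ∀ b b', b ≠ b' → Disjoint (I' b) (I' b') := by
    rintro (_ | _) (_ | _) <;> simp [I', hIJ, hIJ.symm]
  -- Each atom is cut by `I` (for `true`) and by `J` (for `false`), which gives one finite family of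
  -- disjoint sets.
  let a : Bool × {g // g ∈ G.powerset} → Set ℝ := fun x => c ⁻¹' {x.2.1} ∩ I' x.1
  have hind := h.iIndepFun_apply a (fun x => (hcm _).inter (hI'm _))
    (fun x => Set.inter_subset_right.trans (hI'0 _))
    (fun x => (hI'b _).subset Set.inter_subset_right) (by
      rintro ⟨b, g⟩ ⟨b', g'⟩ hne
      by_cases hb : b = b'
      · subst hb
        refine Set.disjoint_left.2 fun t ht ht' => hne ?_
        have : g = g' := Subtype.ext (ht.1.symm.trans ht'.1)
        rw [this]
      · exact (hI'd b b' hb).mono Set.inter_subset_right Set.inter_subset_right)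
  have ham : ∀ x, Measurable fun ω => N ω (a x) := fun x =>
    h.measurable_apply ((hcm _).inter (hI'm _))
  have hdis : Disjoint (Finset.univ.filter fun x : Bool × {g // g ∈ G.powerset} => x.1 = true)
      (Finset.univ.filter fun x : Bool × {g // g ∈ G.powerset} => x.1 = false) := by
    rw [Finset.disjoint_filter]
    intro x _ hx
    simp [hx]
  have hind2 := hind.indepFun_finset _ _ hdis ham
  rw [IndepFun_iff_Indep] at hind2
  have key : ∀ (b : Bool) (s : {s : Set ℝ // MeasurableSet s}), s ∈ G →
      MeasurableSpace.comap (fun ω => N ω (s.1 ∩ I' b)) inferInstance ≤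
      MeasurableSpace.comap (fun ω (x : ↥(Finset.univ.filter
        fun x : Bool × {g // g ∈ G.powerset} => x.1 = b)) => N ω (a x.1)) inferInstance := by
    intro b s hs
    refine Measurable.comap_le ?_
    have hsum : (fun ω => N ω (s.1 ∩ I' b)) = fun ω =>
        ∑ g ∈ G.powerset.attach, if s ∈ g.1 then N ω (a (b, g)) else 0 := by
      ext ω
      rw [Finset.sum_attach G.powerset
        (fun g => if s ∈ g then N ω (c ⁻¹' {g} ∩ I' b) else 0), ← Finset.sum_filter]
      simp_rw [← Measure.restrict_apply (hcm _)]
      rw [sum_measure_preimage_singleton _ fun g _ => hcm g, Measure.restrict_apply]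
      · congr 1
        ext t
        simp only [Set.mem_inter_iff, Set.mem_preimage, Finset.coe_filter, Set.mem_ofPred_eq,
          and_congr_left_iff]
        intro _
        simp [hc, hs]
      · exact Finset.measurableSet_biUnion (G.powerset.filter (s ∈ ·)) (fun g _ => hcm g) |>.congr
          (by ext t; simp)
    rw [hsum]
    refine Finset.measurable_sum _ fun g _ => ?_
    split_ifs
    · have h1 := comap_measurable (m := MeasurableSpace.pi) (fun ω (x : ↥(Finset.univ.filter
        fun x : Bool × {g // g ∈ G.powerset} => x.1 = b)) => N ω (a x.1))
      exact (measurable_pi_apply (⟨(b, g), by simp⟩ : ↥(Finset.univ.filter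
        fun x : Bool × {g // g ∈ G.powerset} => x.1 = b))).comp h1
    · exact measurable_const
  refine indep_of_indep_of_le_left (indep_of_indep_of_le_right hind2 ?_) ?_
  · exact iSup₂_le fun s hs => by simpa [I'] using key false s (Finset.mem_union_right _ hs)
  · exact iSup₂_le fun s hs => by simpa [I'] using key true s (Finset.mem_union_left _ hs)

end IsPoissonProcess

/-- Past and future of an independent family are independent when they are so for each member. -/
theorem indep_iSup_comap_of_iIndepFun {Ω ι : Type*} [Fintype ι] {mΩ : MeasurableSpace Ω}
    {P : Measure Ω} [IsProbabilityMeasure P] {β γ : Type*} [MeasurableSpace β]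
    [MeasurableSpace γ]
    {X : ι → Ω → β} (hX : iIndepFun X P) (hXm : ∀ i, Measurable (X i)) {f g : β → γ}
    (hf : Measurable f) (hg : Measurable g)
    (h : ∀ i, IndepFun (fun ω => f (X i ω)) (fun ω => g (X i ω)) P) :
    Indep (⨆ i, MeasurableSpace.comap (fun ω => f (X i ω)) inferInstance)
      (⨆ i, MeasurableSpace.comap (fun ω => g (X i ω)) inferInstance) P := by
  classical
  have hfm : ∀ i, Measurable fun ω => f (X i ω) := fun i => hf.comp (hXm i)
  have hgm : ∀ i, Measurable fun ω => g (X i ω) := fun i => hg.comp (hXm i)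
  set m₁ : ι → MeasurableSpace Ω := fun i => .comap (fun ω => f (X i ω)) inferInstance
  set m₂ : ι → MeasurableSpace Ω := fun i => .comap (fun ω => g (X i ω)) inferInstance
  have e₁ := generateFrom_piiUnionInter_measurableSet m₁ Set.univ
  have e₂ := generateFrom_piiUnionInter_measurableSet m₂ Set.univ
  simp only [Set.mem_univ, iSup_pos] at e₁ e₂
  refine IndepSets.indep (iSup_le fun i => (hfm i).comap_le) (iSup_le fun i => (hgm i).comap_le)
    (isPiSystem_piiUnionInter _ (fun n => @MeasurableSpace.isPiSystem_measurableSet Ω (m₁ n)) _)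
    (isPiSystem_piiUnionInter _ (fun n => @MeasurableSpace.isPiSystem_measurableSet Ω (m₂ n)) _)
    e₁.symm e₂.symm ?_
  rw [IndepSets_iff]
  rintro _ _ ⟨F, -, u, hu, rfl⟩ ⟨G, -, v, hv, rfl⟩
  -- Both intersections are extended by the whole space so that they run over the same index set and
  -- can be merged factor by factor.
  set u' : ι → Set Ω := fun i => if i ∈ F then u i else Set.univ with hu'
  set v' : ι → Set Ω := fun i => if i ∈ G then v i else Set.univ with hv'
  have eu : ⋂ i ∈ F, u i = ⋂ i ∈ (Finset.univ : Finset ι), u' i := by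
    ext ω
    simp only [Set.mem_iInter, hu', Finset.mem_univ, true_imp_iff]
    exact forall_congr' fun i => by split_ifs with hi <;> simp [hi]
  have ev : ⋂ i ∈ G, v i = ⋂ i ∈ (Finset.univ : Finset ι), v' i := by
    ext ω
    simp only [Set.mem_iInter, hv', Finset.mem_univ, true_imp_iff]
    exact forall_congr' fun i => by split_ifs with hi <;> simp [hi]
  have hu1 : ∀ i, MeasurableSet[m₁ i] (u' i) := fun i => by
    simp only [hu']
    split_ifs with hi
    exacts [hu i hi, @MeasurableSet.univ _ (m₁ i)]
  have hv1 : ∀ i, MeasurableSet[m₂ i] (v' i) := fun i => by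
    simp only [hv']
    split_ifs with hi
    exacts [hv i hi, @MeasurableSet.univ _ (m₂ i)]
  have hle1 : ∀ i, m₁ i ≤ MeasurableSpace.comap (X i) inferInstance := fun i =>
    Measurable.comap_le (hf.comp (comap_measurable (X i)))
  have hle2 : ∀ i, m₂ i ≤ MeasurableSpace.comap (X i) inferInstance := fun i =>
    Measurable.comap_le (hg.comp (comap_measurable (X i)))
  have hI := (iIndepFun_iff_iIndep _ _ _).1 hX
  rw [eu, ev]
  have huv : (⋂ i ∈ (Finset.univ : Finset ι), u' i) ∩ (⋂ i ∈ (Finset.univ : Finset ι), v' i) =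
      ⋂ i ∈ (Finset.univ : Finset ι), (u' i ∩ v' i) := by
    ext ω
    simp only [Set.mem_inter_iff, Set.mem_iInter, Finset.mem_univ, true_imp_iff]
    exact forall_and.symm
  rw [huv, hI.meas_biInter fun i _ => hle1 i _ (hu1 i),
    hI.meas_biInter fun i _ => hle2 i _ (hv1 i),
    hI.meas_biInter fun i _ =>
      @MeasurableSet.inter _ (MeasurableSpace.comap (X i) inferInstance) _ _
        (hle1 i _ (hu1 i)) (hle2 i _ (hv1 i)), ← Finset.prod_mul_distrib]
  refine Finset.prod_congr rfl fun i _ => ?_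
  exact (Indep_iff _ _ _).1 ((IndepFun_iff_Indep _ _ _).1 (h i)) _ _ (hu1 i) (hv1 i)

/-! ### Product laws on the label vectors. -/

section MeanField

variable {K m : ℕ} {q : Fin m → Fin K → ℝ}

theorem IsMeanField.sum_prod (hq : IsMeanField q) : ∑ z : Fin m → Fin K, ∏ i, q i (z i) = 1 := by
  have := Finset.prod_univ_sum (fun _ : Fin m => (Finset.univ : Finset (Fin K))) (fun i k => q i k)
  rw [Fintype.piFinset_univ] at this
  rw [← this]
  simp [hq.2]

theorem IsMeanField.prod_nonneg (hq : IsMeanField q) (z : Fin m → Fin K) :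
    0 ≤ ∏ i, q i (z i) := Finset.prod_nonneg fun i _ => hq.1 i _

theorem IsMeanField.le_one (hq : IsMeanField q) (i : Fin m) (k : Fin K) : q i k ≤ 1 := by
  rw [← hq.2 i]
  exact Finset.single_le_sum (fun l _ => hq.1 i l) (Finset.mem_univ k)

/-- The expected number of labels that differ from `zs`. -/
noncomputable def offMass (q : Fin m → Fin K → ℝ) (zs : Fin m → Fin K) : ℝ :=
  ∑ i, ∑ k ∈ Finset.univ.erase (zs i), q i k

theorem IsMeanField.offMass_nonneg (hq : IsMeanField q) (zs : Fin m → Fin K) :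
    0 ≤ offMass q zs :=
  Finset.sum_nonneg fun i _ => Finset.sum_nonneg fun k _ => hq.1 i k

theorem one_sub_sum_le_prod_one_sub {ι : Type*} (s : Finset ι) (x : ι → ℝ)
    (h0 : ∀ i ∈ s, 0 ≤ x i) (h1 : ∀ i ∈ s, x i ≤ 1) :
    1 - ∑ i ∈ s, x i ≤ ∏ i ∈ s, (1 - x i) := by
  classical
  induction s using Finset.induction_on with
  | empty => simp
  | insert a s ha ih =>
    rw [Finset.sum_insert ha, Finset.prod_insert ha]
    have ih' := ih (fun i hi => h0 i (Finset.mem_insert_of_mem hi))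
      (fun i hi => h1 i (Finset.mem_insert_of_mem hi))
    have ha0 := h0 a (Finset.mem_insert_self _ _)
    have ha1 := h1 a (Finset.mem_insert_self _ _)
    have hp : ∏ i ∈ s, (1 - x i) ≤ 1 := Finset.prod_le_one
      (fun i hi => sub_nonneg.2 (h1 i (Finset.mem_insert_of_mem hi)))
      (fun i hi => sub_le_self _ (h0 i (Finset.mem_insert_of_mem hi)))
    nlinarith

/-- Union bound: a label vector drawn from `q` differs from `zs` only if some coordinate does. -/
theorem IsMeanField.one_sub_prod_le (hq : IsMeanField q) (zs : Fin m → Fin K) :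
    1 - ∏ i, q i (zs i) ≤ offMass q zs := by
  have h : ∀ i, q i (zs i) = 1 - ∑ k ∈ Finset.univ.erase (zs i), q i k := fun i => by
    rw [← hq.2 i, ← Finset.add_sum_erase _ _ (Finset.mem_univ (zs i))]
    ring
  have := one_sub_sum_le_prod_one_sub Finset.univ
    (fun i => ∑ k ∈ Finset.univ.erase (zs i), q i k)
    (fun i _ => Finset.sum_nonneg fun k _ => hq.1 i k)
    (fun i _ => by have := h i; have := hq.1 i (zs i); linarith)
  rw [Finset.prod_congr rfl fun i _ => h i]
  unfold offMass
  linarith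

/-- Only the vectors `z ≠ zs` contribute; they carry mass `1 - ∏ i, q i (zs i)`, and there `v z - v
zs` has norm at most `2 * b`. -/
theorem IsMeanField.norm_sum_smul_sub_le {E : Type*} [NormedAddCommGroup E] [NormedSpace ℝ E]
    (hq : IsMeanField q) (zs : Fin m → Fin K) {v : (Fin m → Fin K) → E} {b : ℝ}
    (hv : ∀ z, ‖v z‖ ≤ b) :
    ‖∑ z : Fin m → Fin K, (∏ i, q i (z i)) • v z - v zs‖ ≤ 2 * b * offMass q zs := by
  have hb : 0 ≤ b := (norm_nonneg _).trans (hv zs)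
  have h1 : ∑ z : Fin m → Fin K, (∏ i, q i (z i)) • v z - v zs =
      ∑ z ∈ Finset.univ.erase zs, (∏ i, q i (z i)) • (v z - v zs) := by
    rw [Finset.sum_erase _ (by simp)]
    simp_rw [smul_sub]
    rw [Finset.sum_sub_distrib, ← Finset.sum_smul, hq.sum_prod, one_smul]
  rw [h1]
  calc _ ≤ ∑ z ∈ Finset.univ.erase zs, (∏ i, q i (z i)) * (2 * b) := by
        refine norm_sum_le_of_le _ fun z _ => ?_
        rw [norm_smul, Real.norm_of_nonneg (hq.prod_nonneg z)]
        refine mul_le_mul_of_nonneg_left ?_ (hq.prod_nonneg z)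
        have := norm_sub_le (v z) (v zs)
        linarith [hv z, hv zs]
    _ = (1 - ∏ i, q i (zs i)) * (2 * b) := by
        rw [← Finset.sum_mul, ← hq.sum_prod, ← Finset.add_sum_erase _ _ (Finset.mem_univ zs)]
        ring
    _ ≤ _ := by
        rw [mul_comm]
        exact mul_le_mul_of_nonneg_left (hq.one_sub_prod_le zs) (by positivity)

theorem IsMeanField.abs_mfExp_sub_le (hq : IsMeanField q) (zs : Fin m → Fin K)
    {f : (Fin m → Fin K) → ℝ} {b : ℝ} (hf : ∀ z, |f z| ≤ b) :
    |mfExp q f - f zs| ≤ 2 * b * offMass q zs := by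
  simpa [mfExp] using hq.norm_sum_smul_sub_le zs (v := f) hf

theorem IsMeanField.mfExp_mono (hq : IsMeanField q) {f g : (Fin m → Fin K) → ℝ}
    (h : ∀ z, f z ≤ g z) : mfExp q f ≤ mfExp q g :=
  Finset.sum_le_sum fun z _ => mul_le_mul_of_nonneg_left (h z) (hq.prod_nonneg z)

theorem IsMeanField.mfExp_const (hq : IsMeanField q) (a : ℝ) : mfExp q (fun _ => a) = a := by
  unfold mfExp
  rw [← Finset.sum_mul, hq.sum_prod, one_mul]

theorem mfExp_add (f g : (Fin m → Fin K) → ℝ) :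
    mfExp q (fun z => f z + g z) = mfExp q f + mfExp q g := by
  simp [mfExp, mul_add, Finset.sum_add_distrib]

theorem mfExp_sub (f g : (Fin m → Fin K) → ℝ) :
    mfExp q (fun z => f z - g z) = mfExp q f - mfExp q g := by
  simp [mfExp, mul_sub, Finset.sum_sub_distrib]

theorem mfExp_const_mul (a : ℝ) (f : (Fin m → Fin K) → ℝ) :
    mfExp q (fun z => a * f z) = a * mfExp q f := by
  simp only [mfExp, Finset.mul_sum]
  exact Finset.sum_congr rfl fun z _ => by ring

theorem mfExp_sum {ι : Type*} (s : Finset ι) (f : ι → (Fin m → Fin K) → ℝ) :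
    mfExp q (fun z => ∑ a ∈ s, f a z) = ∑ a ∈ s, mfExp q (f a) := by
  simp only [mfExp, Finset.mul_sum]
  exact Finset.sum_comm

/-- Drawing all labels and then overwriting the `i`-th amounts to leaving it out, because `q i` sums
to one. Expectations for different fixed classes thereby refer to the same random labels and can be
subtracted. -/
theorem IsMeanField.mfExpAt_eq (hq : IsMeanField q) (i : Fin m) (k : Fin K)
    (f : (Fin m → Fin K) → ℝ) :
    mfExpAt q i k f = mfExp q (fun z => f (Function.update z i k)) := by
  classical
  unfold mfExp mfExpAt
  rw [← Finset.sum_fiberwise_of_maps_to (s := Finset.univ)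
    (t := Finset.univ.filter fun w : Fin m → Fin K => w i = k)
    (g := fun z : Fin m → Fin K => Function.update z i k) (fun z _ => by simp)]
  refine Finset.sum_congr rfl fun w hw => ?_
  have hwk : w i = k := by simpa using hw
  have himg : (Finset.univ.filter fun z : Fin m → Fin K => Function.update z i k = w) =
      (Finset.univ : Finset (Fin K)).image fun l => Function.update w i l := by
    ext z
    simp only [Finset.mem_filter, Finset.mem_univ, true_and, Finset.mem_image]
    constructor
    · rintro rfl
      exact ⟨z i, by simp⟩
    · rintro ⟨l, rfl⟩
      simp [← hwk]
  rw [himg, Finset.sum_image fun a _ b _ hab => by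
    have := congrFun hab i
    simpa using this]
  have : ∀ l, (∏ j, q j (Function.update w i l j)) *
      f (Function.update (Function.update w i l) i k) =
      q i l * ((∏ j ∈ Finset.univ.erase i, q j (w j)) * f w) := by
    intro l
    rw [← Finset.mul_prod_erase _ _ (Finset.mem_univ i)]
    have h1 : Function.update (Function.update w i l) i k = w := by simp [← hwk]
    rw [h1, Function.update_self, mul_assoc]
    congr 2
    refine Finset.prod_congr rfl fun j hj => ?_
    rw [Function.update_of_ne (Finset.ne_of_mem_erase hj)]
  simp_rw [this]
  rw [← Finset.sum_mul, hq.2 i, one_mul]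

/-- The product law concentrated at `zs`. -/
def pointLaw (zs : Fin m → Fin K) (i : Fin m) (k : Fin K) : ℝ := if k = zs i then 1 else 0

theorem isMeanField_pointLaw (zs : Fin m → Fin K) : IsMeanField (pointLaw zs) := by
  refine ⟨fun i k => ?_, fun i => by simp [pointLaw]⟩
  unfold pointLaw
  split_ifs <;> norm_num

theorem prod_pointLaw (zs z : Fin m → Fin K) :
    ∏ i, pointLaw zs i (z i) = if z = zs then 1 else 0 := by
  unfold pointLaw
  split_ifs with h
  · simp [h]
  · obtain ⟨i, hi⟩ := Function.ne_iff.1 h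
    exact Finset.prod_eq_zero (Finset.mem_univ i) (by simp [hi])

theorem tvDirac_pointLaw (zs : Fin m → Fin K) : tvDirac (pointLaw zs) zs = 0 := by
  simp [tvDirac, prod_pointLaw]

theorem mfExp_pointLaw (zs : Fin m → Fin K) (f : (Fin m → Fin K) → ℝ) :
    mfExp (pointLaw zs) f = f zs := by
  simp [mfExp, prod_pointLaw]

end MeanField

/-! ### Positivity and odds bounds for the label update. -/

section Update

variable {K p m : ℕ}

/-- Positivity of the quantities carried by the algorithm. -/
structure State.Pos (s : State K p m) : Prop where
  S : ∀ i k, 0 < s.S i k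
  π : ∀ k, 0 < s.π k

theorem evidence_pos (L : Param p → (Fin m → Fin K) → ℝ) (s : State K p m) (i : Fin m)
    (k : Fin K) : 0 < evidence L s i k := Real.exp_pos _

theorem State.Pos.term_pos {s : State K p m} (hs : s.Pos) (L : Param p → (Fin m → Fin K) → ℝ)
    (i : Fin m) (k : Fin K) : 0 < s.π k * evidence L s i k * s.S i k :=
  mul_pos (mul_pos (hs.π k) (evidence_pos L s i k)) (hs.S i k)

theorem State.Pos.denom_pos {s : State K p m} (hs : s.Pos) (L : Param p → (Fin m → Fin K) → ℝ)
    (hK : 0 < K) (i : Fin m) : 0 < ∑ l, s.π l * evidence L s i l * s.S i l :=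
  Finset.sum_pos (fun l _ => hs.term_pos L i l) ⟨⟨0, hK⟩, Finset.mem_univ _⟩

theorem State.Pos.newQ_pos {s : State K p m} (hs : s.Pos) (L : Param p → (Fin m → Fin K) → ℝ)
    (hK : 0 < K) (i : Fin m) (k : Fin K) : 0 < newQ L s i k :=
  div_pos (hs.term_pos L i k) (hs.denom_pos L hK i)

theorem State.Pos.isMeanField_newQ {s : State K p m} (hs : s.Pos)
    (L : Param p → (Fin m → Fin K) → ℝ) (hK : 0 < K) : IsMeanField (newQ L s) := by
  refine ⟨fun i k => (hs.newQ_pos L hK i k).le, fun i => ?_⟩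
  unfold newQ
  rw [← Finset.sum_div, div_self (hs.denom_pos L hK i).ne']

/-- The denominator is at least its single term for class `l`, so the odds against one competitor
bound the probability. -/
theorem State.Pos.newQ_le {s : State K p m} (hs : s.Pos)
    (L : Param p → (Fin m → Fin K) → ℝ) (i : Fin m) (k l : Fin K) :
    newQ L s i k ≤ (s.π k / s.π l) *
      ((evidence L s i k * s.S i k) / (evidence L s i l * s.S i l)) := by
  have h : newQ L s i k ≤
      (s.π k * evidence L s i k * s.S i k) / (s.π l * evidence L s i l * s.S i l) := by
    refine div_le_div_of_nonneg_left (hs.term_pos L i k).le (hs.term_pos L i l) ?_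
    exact Finset.single_le_sum (fun l _ => (hs.term_pos L i l).le) (Finset.mem_univ l)
  refine h.trans (le_of_eq ?_)
  rw [div_mul_div_comm]
  congr 1 <;> ring

end Update

/-! ### Families of functions of the parameter and differentiation under the integral. -/

/-- A family of functions of the parameter, indexed by time, that is bounded with bounded
continuous gradient on `Θ`. -/
structure SmoothFamily {p : ℕ} (F : ℝ → Param p → ℝ) (Θ : Set (Param p)) (C : ℝ) : Prop where
  meas : ∀ θ ∈ Θ, Measurable fun t => F t θ
  smooth : ∀ t, 0 ≤ t → ContDiffOn ℝ 1 (F t) Θ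
  bound : ∀ t, 0 ≤ t → ∀ θ ∈ Θ, |F t θ| ≤ C
  bound_grad : ∀ t, 0 ≤ t → ∀ θ ∈ Θ, ‖gradient (F t) θ‖ ≤ C

theorem Bounded.smoothFamily {K p : ℕ} {lam : BlockIntensity K p} {Θ : Set (Param p)} {C : ℝ}
    (h : Bounded lam Θ C) (k l : Fin K) : SmoothFamily (fun t θ => lam k l t θ) Θ C where
  meas := h.meas k l
  smooth := h.smooth k l
  bound t ht θ hθ := by
    rw [abs_of_pos (h.pos k l t ht θ hθ)]
    exact h.bound k l t ht θ hθ
  bound_grad := h.bound_deriv k l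

theorem Bounded.smoothFamily_log {K p : ℕ} {lam : BlockIntensity K p} {Θ : Set (Param p)} {C : ℝ}
    (h : Bounded lam Θ C) (k l : Fin K) :
    SmoothFamily (fun t θ => Real.log (lam k l t θ)) Θ C where
  meas θ hθ := Real.measurable_log.comp (h.meas k l θ hθ)
  smooth t ht := (h.smooth k l t ht).log fun θ hθ => (h.pos k l t ht θ hθ).ne'
  bound := h.bound_log k l
  bound_grad := h.bound_log_deriv k l

/-- The gradient in the parameter, extended by zero to negative times. -/
noncomputable def gradFam {p : ℕ} (F : ℝ → Param p → ℝ) (t : ℝ) (θ : Param p) : Param p :=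
  if 0 ≤ t then gradient (F t) θ else 0

theorem measurable_euclidean_iff {α : Type*} [MeasurableSpace α] {p : ℕ} {f : α → Param p} :
    Measurable f ↔ ∀ j, Measurable fun x => f x j := by
  constructor
  · intro h j
    exact (EuclideanSpace.proj (𝕜 := ℝ) j).continuous.measurable.comp h
  · intro h
    have : f = fun x => WithLp.toLp 2 (fun j => f x j) := rfl
    rw [this]
    exact (WithLp.measurable_toLp 2 _).comp (measurable_pi_lambda _ h)

namespace SmoothFamily

variable {p : ℕ} {F : ℝ → Param p → ℝ} {Θ : Set (Param p)} {C : ℝ}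

theorem hasGradientAt (h : SmoothFamily F Θ C) (hΘ : IsOpen Θ) {t : ℝ} (ht : 0 ≤ t)
    {θ : Param p} (hθ : θ ∈ Θ) : HasGradientAt (F t) (gradFam F t θ) θ := by
  rw [gradFam, if_pos ht]
  exact (((h.smooth t ht).contDiffAt (hΘ.mem_nhds hθ)).differentiableAt
    (by norm_num)).hasGradientAt

theorem norm_gradFam_le (h : SmoothFamily F Θ C) {θ : Param p} (hθ : θ ∈ Θ) (t : ℝ) :
    ‖gradFam F t θ‖ ≤ C := by
  unfold gradFam
  split_ifs with ht
  · exact h.bound_grad t ht θ hθ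
  · rw [norm_zero]
    exact (norm_nonneg _).trans (h.bound_grad 0 le_rfl θ hθ)

theorem continuousOn_gradFam (h : SmoothFamily F Θ C) (hΘ : IsOpen Θ) (t : ℝ) :
    ContinuousOn (gradFam F t) Θ := by
  by_cases ht : 0 ≤ t
  · have h1 := (h.smooth t ht).continuousOn_fderiv_of_isOpen hΘ le_rfl
    have h2 : gradFam F t = fun θ => (InnerProductSpace.toDual ℝ (Param p)).symm
        (fderiv ℝ (F t) θ) := by
      ext1 θ
      simp [gradFam, ht, gradient]
    rw [h2]
    exact (InnerProductSpace.toDual ℝ (Param p)).symm.continuous.comp_continuousOn h1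
  · have h2 : gradFam F t = fun _ => 0 := by
      ext1 θ
      simp [gradFam, ht]
    rw [h2]
    exact continuousOn_const

/-- Each coordinate of the gradient is a limit of difference quotients that are measurable in time.
-/
theorem measurable_gradFam (h : SmoothFamily F Θ C) (hΘ : IsOpen Θ) {θ : Param p}
    (hθ : θ ∈ Θ) : Measurable fun t => gradFam F t θ := by
  refine measurable_euclidean_iff.2 fun j => ?_
  set v : Param p := EuclideanSpace.single j 1 with hv
  have hc : Tendsto (fun n : ℕ => θ + ((n : ℝ) + 1)⁻¹ • v) atTop (𝓝 θ) := by
    have h0 : Tendsto (fun n : ℕ => ((n : ℝ) + 1)⁻¹) atTop (𝓝 0) := by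
      simpa using tendsto_one_div_add_atTop_nhds_zero_nat (𝕜 := ℝ)
    simpa using (h0.smul_const v).const_add θ
  -- Measurability in time is known only for parameters in `Θ`; from `n₀` on, the shifted point lies
  -- in `Θ`.
  obtain ⟨n₀, hn₀⟩ := eventually_atTop.1 (hc.eventually (hΘ.mem_nhds hθ))
  refine measurable_of_tendsto_metrizable (f := fun n t => Set.indicator (Set.Ici 0)
    (fun t => (((n + n₀ : ℕ) : ℝ) + 1) •
      (F t (θ + (((n + n₀ : ℕ) : ℝ) + 1)⁻¹ • v) - F t θ)) t) (fun n => ?_) ?_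
  · refine Measurable.indicator ?_ measurableSet_Ici
    exact measurable_const.mul ((h.meas _ (hn₀ _ (Nat.le_add_left _ _))).sub (h.meas θ hθ))
  · rw [tendsto_pi_nhds]
    intro t
    by_cases ht : 0 ≤ t
    · simp only [Set.indicator_of_mem (Set.mem_Ici.2 ht)]
      have h1 := (h.hasGradientAt hΘ ht hθ).hasFDerivAt.lim v
        (c := fun n : ℕ => (((n + n₀ : ℕ) : ℝ) + 1)) (l := atTop) ?_
      · convert! h1 using 2
        rw [InnerProductSpace.toDual_apply_apply, hv, EuclideanSpace.inner_single_right]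
        simp
      · refine tendsto_norm_atTop_atTop.comp ?_
        refine tendsto_atTop_add_const_right _ _ ?_
        exact tendsto_natCast_atTop_atTop.comp (tendsto_add_atTop_nat n₀)
    · simp [gradFam, ht]

theorem abs_sub_le (h : SmoothFamily F Θ C) (hΘ : IsOpen Θ) {s : Set (Param p)}
    (hs : Convex ℝ s) (hsΘ : s ⊆ Θ) {t : ℝ} (ht : 0 ≤ t) {θ θ' : Param p} (hθ : θ ∈ s)
    (hθ' : θ' ∈ s) : |F t θ - F t θ'| ≤ C * ‖θ - θ'‖ := by
  refine hs.norm_image_sub_le_of_norm_hasFDerivWithin_le (f := F t) (C := C)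
    (fun x hx => (h.hasGradientAt hΘ ht (hsΘ hx)).hasFDerivAt.hasFDerivWithinAt)
    (fun x hx => ?_) hθ' hθ
  rw [LinearIsometryEquiv.norm_map]
  exact h.norm_gradFam_le (hsΘ hx) t

theorem integrable (h : SmoothFamily F Θ C) {ν : Measure ℝ} [IsFiniteMeasure ν]
    (hν : ∀ᵐ t ∂ν, 0 ≤ t) {θ : Param p} (hθ : θ ∈ Θ) : Integrable (fun t => F t θ) ν :=
  Integrable.of_bound (h.meas θ hθ).aestronglyMeasurable C
    (hν.mono fun t ht => h.bound t ht θ hθ)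

theorem integrable_gradFam (h : SmoothFamily F Θ C) (hΘ : IsOpen Θ) {ν : Measure ℝ}
    [IsFiniteMeasure ν] {θ : Param p} (hθ : θ ∈ Θ) : Integrable (fun t => gradFam F t θ) ν :=
  Integrable.of_bound (h.measurable_gradFam hΘ hθ).aestronglyMeasurable C
    (Eventually.of_forall fun t => h.norm_gradFam_le hθ t)

theorem abs_integral_le (h : SmoothFamily F Θ C) {ν : Measure ℝ} [IsFiniteMeasure ν]
    (hν : ∀ᵐ t ∂ν, 0 ≤ t) {θ : Param p} (hθ : θ ∈ Θ) :
    |∫ t, F t θ ∂ν| ≤ C * ν.real Set.univ :=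
  norm_integral_le_of_norm_le_const (f := fun t => F t θ)
    (hν.mono fun t ht => h.bound t ht θ hθ)

theorem norm_integral_gradFam_le (h : SmoothFamily F Θ C) {ν : Measure ℝ}
    [IsFiniteMeasure ν] {θ : Param p} (hθ : θ ∈ Θ) :
    ‖∫ t, gradFam F t θ ∂ν‖ ≤ C * ν.real Set.univ :=
  norm_integral_le_of_norm_le_const (Eventually.of_forall fun t => h.norm_gradFam_le hθ t)

/-- The weight `w` is the true intensity in the population gradient, and `w = 1` for integrals
against event data or plain Lebesgue measure. -/
theorem hasGradientAt_integral (h : SmoothFamily F Θ C) (hΘ : IsOpen Θ) {ν : Measure ℝ}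
    [IsFiniteMeasure ν] (hν : ∀ᵐ t ∂ν, 0 ≤ t) {w : ℝ → ℝ} (hw : Integrable w ν)
    {θ : Param p} (hθ : θ ∈ Θ) :
    HasGradientAt (fun ϑ => ∫ t, w t * F t ϑ ∂ν) (∫ t, w t • gradFam F t θ ∂ν) θ := by
  obtain ⟨ε, hε, hball⟩ := Metric.isOpen_iff.1 hΘ θ hθ
  set D := InnerProductSpace.toDual ℝ (Param p)
  have key := hasFDerivAt_integral_of_dominated_of_fderiv_le (𝕜 := ℝ) (μ := ν)
    (F := fun ϑ t => w t * F t ϑ) (F' := fun ϑ t => D (w t • gradFam F t ϑ)) (x₀ := θ)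
    (bound := fun t => |w t| * C)
    (s := Metric.ball θ ε) (Metric.ball_mem_nhds θ hε)
    (by
      filter_upwards [hΘ.mem_nhds hθ] with ϑ hϑ
      exact hw.aestronglyMeasurable.mul (h.meas ϑ hϑ).aestronglyMeasurable)
    (hw.mul_bdd (c := C) (h.meas θ hθ).aestronglyMeasurable
      (hν.mono fun t ht => h.bound t ht θ hθ))
    (D.continuous.comp_aestronglyMeasurable
      (hw.aestronglyMeasurable.smul (h.measurable_gradFam hΘ hθ).aestronglyMeasurable))
    (Eventually.of_forall fun t ϑ hϑ => by
      rw [LinearIsometryEquiv.norm_map, norm_smul]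
      exact mul_le_mul_of_nonneg_left (h.norm_gradFam_le (hball hϑ) t) (abs_nonneg _))
    (hw.abs.mul_const C)
    (hν.mono fun t ht ϑ hϑ => by
      have := (h.hasGradientAt hΘ ht (hball hϑ)).hasFDerivAt.const_mul (w t)
      convert! this using 1
      ext v
      simp [D])
  have : ∫ t, D (w t • gradFam F t θ) ∂ν = D (∫ t, w t • gradFam F t θ ∂ν) :=
    D.toContinuousLinearEquiv.integral_comp_comm _
  rw [this] at key
  exact key

theorem hasGradientAt_integral' (h : SmoothFamily F Θ C) (hΘ : IsOpen Θ) {ν : Measure ℝ}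
    [IsFiniteMeasure ν] (hν : ∀ᵐ t ∂ν, 0 ≤ t) {θ : Param p} (hθ : θ ∈ Θ) :
    HasGradientAt (fun ϑ => ∫ t, F t ϑ ∂ν) (∫ t, gradFam F t θ ∂ν) θ := by
  simpa using h.hasGradientAt_integral hΘ hν (integrable_const (1 : ℝ)) hθ

end SmoothFamily

/-! ### Retraction of the parameter and truncation of the data. -/

/-- Radial retraction onto the closed ball of radius `ρ` around `θs`. -/
noncomputable def clamp {p : ℕ} (θs : Param p) (ρ : ℝ) (θ : Param p) : Param p :=
  θs + (ρ / max ρ ‖θ - θs‖) • (θ - θs)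

theorem continuous_clamp {p : ℕ} (θs : Param p) {ρ : ℝ} (hρ : 0 < ρ) :
    Continuous (clamp θs ρ) := by
  have h1 : Continuous fun θ : Param p => max ρ ‖θ - θs‖ := by fun_prop
  have h2 : Continuous fun θ : Param p => ρ / max ρ ‖θ - θs‖ :=
    continuous_const.div h1 fun θ => (lt_max_of_lt_left hρ).ne'
  exact continuous_const.add (h2.smul (by fun_prop))

theorem clamp_mem {p : ℕ} (θs : Param p) {ρ : ℝ} (hρ : 0 < ρ) (θ : Param p) :
    clamp θs ρ θ ∈ Metric.closedBall θs ρ := by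
  have hm : 0 < max ρ ‖θ - θs‖ := lt_max_of_lt_left hρ
  rw [mem_closedBall_iff_norm, clamp, add_sub_cancel_left, norm_smul,
    Real.norm_of_nonneg (by positivity), div_mul_eq_mul_div, div_le_iff₀ hm]
  exact mul_le_mul_of_nonneg_left (le_max_right _ _) hρ.le

theorem clamp_eq {p : ℕ} {θs : Param p} {ρ : ℝ} (hρ : 0 < ρ) {θ : Param p}
    (hθ : ‖θ - θs‖ ≤ ρ) : clamp θs ρ θ = θ := by
  rw [clamp, max_eq_left hθ, div_self hρ.ne', one_smul, add_sub_cancel]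

open Classical in
/-- The points of `ν` in the set `I`, or none if there are infinitely many. -/
noncomputable def winData (I : Set ℝ) (ν : Measure ℝ) : Measure ℝ :=
  if ν I < ⊤ then ν.restrict I else 0

instance (I : Set ℝ) (ν : Measure ℝ) : IsFiniteMeasure (winData I ν) := by
  unfold winData
  split_ifs with h
  · exact ⟨by simpa using h⟩
  · infer_instance

theorem winData_eq {I : Set ℝ} {ν : Measure ℝ} (h : ν I < ⊤) : winData I ν = ν.restrict I :=
  if_pos h

theorem winData_restrict {I J : Set ℝ} (hI : MeasurableSet I) (hIJ : I ⊆ J) (ν : Measure ℝ) :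
    winData I (ν.restrict J) = winData I ν := by
  unfold winData
  rw [Measure.restrict_apply hI, Set.inter_eq_self_of_subset_left hIJ,
    Measure.restrict_restrict hI, Set.inter_eq_self_of_subset_left hIJ]

theorem measurable_winData {I : Set ℝ} (hI : MeasurableSet I) : Measurable (winData I) := by
  unfold winData
  exact Measurable.ite (Measure.measurable_coe hI measurableSet_Iio)
    (measurable_restrict_measure hI) measurable_const

theorem ae_winData {I : Set ℝ} (hI : MeasurableSet I) (hI0 : I ⊆ Set.Ici 0) (ν : Measure ℝ) :
    ∀ᵐ t ∂(winData I ν), 0 ≤ t := by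
  unfold winData
  split_ifs
  · exact (ae_restrict_iff' hI).2 (Eventually.of_forall fun t ht => hI0 ht)
  · simp

namespace SmoothFamily

variable {p : ℕ} {F : ℝ → Param p → ℝ} {Θ : Set (Param p)} {C : ℝ}

/-- Carathéodory: continuity in the parameter and measurability in the data give joint
measurability. The retraction makes the continuity global, and `winData` is finite for every
measure, so dominated convergence applies without exceptional data. -/
theorem measurable_integral_clamp (h : SmoothFamily F Θ C) {θs : Param p} {ρ : ℝ}
    (hρ : 0 < ρ) (hball : Metric.closedBall θs ρ ⊆ Θ) {I : Set ℝ} (hI : MeasurableSet I)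
    (hI0 : I ⊆ Set.Ici 0) :
    Measurable fun x : Param p × Measure ℝ => ∫ t, F t (clamp θs ρ x.1) ∂(winData I x.2) := by
  have hc : ∀ θ, clamp θs ρ θ ∈ Θ := fun θ => hball (clamp_mem θs hρ θ)
  refine measurable_uncurry_of_continuous_of_measurable
    (u := fun (θ : Param p) ν => ∫ t, F t (clamp θs ρ θ) ∂(winData I ν)) (fun ν => ?_)
    (fun θ => (measurable_integral_measure (h.meas _ (hc θ))).comp (measurable_winData hI))
  refine continuous_of_dominated (bound := fun _ => C)
    (fun θ => (h.meas _ (hc θ)).aestronglyMeasurable)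
    (fun θ => (ae_winData hI hI0 ν).mono fun t ht => h.bound t ht _ (hc θ)) (integrable_const C)
    ((ae_winData hI hI0 ν).mono fun t ht => ?_)
  exact (h.smooth t ht).continuousOn.comp_continuous (continuous_clamp θs hρ) hc

theorem measurable_integral_gradFam_clamp (h : SmoothFamily F Θ C) (hΘ : IsOpen Θ)
    {θs : Param p} {ρ : ℝ} (hρ : 0 < ρ) (hball : Metric.closedBall θs ρ ⊆ Θ) {I : Set ℝ}
    (hI : MeasurableSet I) :
    Measurable fun x : Param p × Measure ℝ =>
      ∫ t, gradFam F t (clamp θs ρ x.1) ∂(winData I x.2) := by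
  have hc : ∀ θ, clamp θs ρ θ ∈ Θ := fun θ => hball (clamp_mem θs hρ θ)
  refine measurable_uncurry_of_continuous_of_measurable
    (u := fun (θ : Param p) ν => ∫ t, gradFam F t (clamp θs ρ θ) ∂(winData I ν)) (fun ν => ?_)
    (fun θ => ?_)
  · refine continuous_of_dominated (bound := fun _ => C)
      (fun θ => (h.measurable_gradFam hΘ (hc θ)).aestronglyMeasurable)
      (fun θ => Eventually.of_forall fun t => h.norm_gradFam_le (hc θ) t) (integrable_const C)
      (Eventually.of_forall fun t => ?_)
    exact (h.continuousOn_gradFam hΘ t).comp_continuous (continuous_clamp θs hρ) hc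
  · refine measurable_euclidean_iff.2 fun j => ?_
    have h1 : ∀ ν : Measure ℝ, (∫ t, gradFam F t (clamp θs ρ θ) ∂(winData I ν)) j =
        ∫ t, gradFam F t (clamp θs ρ θ) j ∂(winData I ν) := fun ν =>
      ((EuclideanSpace.proj (𝕜 := ℝ) j).integral_comp_comm
        (h.integrable_gradFam hΘ (hc θ))).symm
    simp_rw [h1]
    exact (measurable_integral_measure
      (measurable_euclidean_iff.1 (h.measurable_gradFam hΘ (hc θ)) j)).comp (measurable_winData hI)

end SmoothFamily

/-! ### Deterministic recursions with step sizes `n ^ (-α)`. -/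

section Sequences

/-- Solution of `x 0 = 0`, `x (n + 1) = a (n + 1) * x n + f n`. -/
noncomputable def linRec (a f : ℕ → ℝ) : ℕ → ℝ
  | 0 => 0
  | n + 1 => a (n + 1) * linRec a f n + f n

theorem linRec_le {a f h : ℕ → ℝ} {M : ℝ} (ha : ∀ n, 0 ≤ a n) (hf : ∀ n, f n ≤ M * h n) (n : ℕ) :
    linRec a f n ≤ M * linRec a h n := by
  induction n with
  | zero => simp [linRec]
  | succ n ih =>
    simp only [linRec]
    nlinarith [mul_le_mul_of_nonneg_left ih (ha (n + 1)), hf n]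

theorem linRec_nonneg {a f : ℕ → ℝ} (ha : ∀ n, 0 ≤ a n) (hf : ∀ n, 0 ≤ f n) (n : ℕ) :
    0 ≤ linRec a f n := by
  induction n with
  | zero => simp [linRec]
  | succ n ih => exact add_nonneg (mul_nonneg (ha _) ih) (hf n)

/-- If all large levels are invariant from `n₀` on, a level above the first `n₀ + 1` values bounds
the whole sequence. -/
theorem exists_bound_of_eventually_step {x : ℕ → ℝ} {M₀ : ℝ} {n₀ : ℕ}
    (h : ∀ n, n₀ ≤ n → ∀ M, M₀ ≤ M → x n ≤ M → x (n + 1) ≤ M) : ∃ X, 0 < X ∧ ∀ n, x n ≤ X := by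
  set X : ℝ := |M₀| + ∑ k ∈ Finset.range (n₀ + 1), |x k| + 1 with hX
  have hs : 0 ≤ ∑ k ∈ Finset.range (n₀ + 1), |x k| := Finset.sum_nonneg fun k _ => abs_nonneg _
  have hlow : ∀ n, n ≤ n₀ → x n ≤ X := fun n hn => by
    have := Finset.single_le_sum (f := fun k => |x k|) (fun k _ => abs_nonneg (x k))
      (Finset.mem_range.2 (Nat.lt_succ_of_le hn))
    have := le_abs_self (x n)
    have := abs_nonneg M₀
    linarith
  refine ⟨X, by positivity, fun n => ?_⟩
  induction n with
  | zero => exact hlow 0 (Nat.zero_le _)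
  | succ n ih =>
    rcases le_or_gt n₀ n with hn | hn
    · exact h n hn X (by have := le_abs_self M₀; linarith) ih
    · exact hlow (n + 1) hn

theorem stepSize_le_one {α : ℝ} (hα : 0 ≤ α) {n : ℕ} (hn : 1 ≤ n) : (n : ℝ) ^ (-α) ≤ 1 :=
  Real.rpow_le_one_of_one_le_of_nonpos (by exact_mod_cast hn) (by linarith)

theorem tendsto_stepSize {α : ℝ} (hα : 0 < α) :
    Tendsto (fun n : ℕ => (n : ℝ) ^ (-α)) atTop (𝓝 0) :=
  (tendsto_rpow_neg_atTop hα).comp tendsto_natCast_atTop_atTop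

/-- This is where `α < 1` matters: `(1 + 1/n) ^ β ≤ exp (β / n)`, and `β / n` is eventually below `c
* (n + 1) ^ (-α)`, so the contraction outweighs the growth of any power. -/
theorem eventually_one_sub_stepSize_mul_rpow_le {c α β : ℝ} (hc : 0 < c) (hα1 : α < 1)
    (hβ : 0 < β) :
    ∀ᶠ n : ℕ in atTop, (1 - c * ((n + 1 : ℕ) : ℝ) ^ (-α)) * ((n + 1 : ℕ) : ℝ) ^ β
      ≤ (n : ℝ) ^ β := by
  have h1 : Tendsto (fun n : ℕ => ((n + 1 : ℕ) : ℝ) ^ (1 - α)) atTop atTop :=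
    (tendsto_rpow_atTop (by linarith)).comp
      (tendsto_natCast_atTop_atTop.comp (tendsto_add_atTop_nat 1))
  filter_upwards [h1.eventually_ge_atTop (2 * β / c), eventually_ge_atTop 1] with n hn hn1
  have hn0 : (0 : ℝ) < n := by exact_mod_cast hn1
  have hn1' : (0 : ℝ) < ((n + 1 : ℕ) : ℝ) := by positivity
  have e1 : ((n + 1 : ℕ) : ℝ) ^ β = (n : ℝ) ^ β * (1 + 1 / (n : ℝ)) ^ β := by
    rw [← Real.mul_rpow hn0.le (by positivity)]
    congr 1
    push_cast
    field_simp
  have e2 : (1 + 1 / (n : ℝ)) ^ β ≤ Real.exp (c * ((n + 1 : ℕ) : ℝ) ^ (-α)) := by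
    have hx : 0 < 1 + 1 / (n : ℝ) := by positivity
    rw [Real.rpow_def_of_pos hx]
    refine Real.exp_le_exp.2 ?_
    have h2 := Real.log_le_sub_one_of_pos hx
    have h3 : (1 / (n : ℝ)) * β ≤ 2 * β / ((n + 1 : ℕ) : ℝ) := by
      rw [one_div_mul_eq_div, div_le_div_iff₀ hn0 hn1']
      push_cast
      have : (1 : ℝ) ≤ n := by exact_mod_cast hn1
      nlinarith
    have h4 : 2 * β / ((n + 1 : ℕ) : ℝ) ≤ c * ((n + 1 : ℕ) : ℝ) ^ (-α) := by
      rw [div_le_iff₀ hn1']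
      have h5 : ((n + 1 : ℕ) : ℝ) ^ (1 - α) = ((n + 1 : ℕ) : ℝ) ^ (-α) * ((n + 1 : ℕ) : ℝ) := by
        rw [← Real.rpow_add_one hn1'.ne']
        congr 1
        ring
      rw [h5, div_le_iff₀ hc] at hn
      linarith
    have h6 : Real.log (1 + 1 / (n : ℝ)) * β ≤ (1 / (n : ℝ)) * β :=
      mul_le_mul_of_nonneg_right (by linarith) hβ.le
    linarith
  have e3 : 1 - c * ((n + 1 : ℕ) : ℝ) ^ (-α) ≤ Real.exp (-(c * ((n + 1 : ℕ) : ℝ) ^ (-α))) := by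
    have := Real.add_one_le_exp (-(c * ((n + 1 : ℕ) : ℝ) ^ (-α)))
    linarith
  rw [e1]
  calc _ ≤ Real.exp (-(c * ((n + 1 : ℕ) : ℝ) ^ (-α))) *
        ((n : ℝ) ^ β * Real.exp (c * ((n + 1 : ℕ) : ℝ) ^ (-α))) := by
        gcongr
    _ = (n : ℝ) ^ β := by
        rw [mul_left_comm, ← Real.exp_add, neg_add_cancel, Real.exp_zero, mul_one]

/-- The contraction factor of one step of stochastic gradient ascent. -/
noncomputable def sgdFactor (c L α : ℝ) (n : ℕ) : ℝ :=
  1 - c / 4 * (n : ℝ) ^ (-α) + 6 * L ^ 2 * ((n : ℝ) ^ (-α)) ^ 2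

theorem sgdFactor_nonneg {c L α : ℝ} (hc : 0 < c) (hc1 : c ≤ 1) (hα : 0 < α) (n : ℕ) :
    0 ≤ sgdFactor c L α n := by
  unfold sgdFactor
  have h1 : (n : ℝ) ^ (-α) ≤ 1 := by
    rcases Nat.eq_zero_or_pos n with rfl | hn
    -- By convention `0 ^ (-α) = 0` for `α ≠ 0`.
    · rw [Nat.cast_zero, Real.zero_rpow (by linarith)]
      norm_num
    · exact stepSize_le_one hα.le hn
  have h0 : 0 ≤ (n : ℝ) ^ (-α) := by positivity
  have : 0 ≤ 6 * L ^ 2 * ((n : ℝ) ^ (-α)) ^ 2 := by positivity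
  nlinarith

theorem eventually_sgdFactor_le {c L α : ℝ} (hc : 0 < c) (hα : 0 < α) :
    ∀ᶠ n : ℕ in atTop, sgdFactor c L α (n + 1) ≤ 1 - c / 8 * ((n + 1 : ℕ) : ℝ) ^ (-α) := by
  have h := ((tendsto_stepSize hα).comp (tendsto_add_atTop_nat 1)).const_mul (6 * L ^ 2)
  rw [mul_zero] at h
  filter_upwards [h.eventually_le_const (show 0 < c / 8 by positivity)] with n hn
  simp only [Function.comp_def] at hn
  have h0 : 0 ≤ ((n + 1 : ℕ) : ℝ) ^ (-α) := by positivity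
  unfold sgdFactor
  nlinarith

/-- Eventually `x (n+1) ≤ (1 - c η / 8) * x n + η`, for which every level `M ≥ 8 / c` is invariant.
-/
theorem exists_bound_linRec_sgdFactor {c L α : ℝ} (hc : 0 < c) (hc1 : c ≤ 1)
    (hα : 0 < α) : ∃ X, 0 < X ∧ ∀ n,
      linRec (sgdFactor c L α) (fun n => ((n + 1 : ℕ) : ℝ) ^ (-α)) n ≤ X := by
  obtain ⟨n₀, hn₀⟩ := eventually_atTop.1
    ((eventually_sgdFactor_le (L := L) hc hα).and (eventually_ge_atTop 0))
  have hpos : ∀ n, n₀ ≤ n → ∀ M, 8 / c ≤ M →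
      linRec (sgdFactor c L α) (fun n => ((n + 1 : ℕ) : ℝ) ^ (-α)) n ≤ M →
      linRec (sgdFactor c L α) (fun n => ((n + 1 : ℕ) : ℝ) ^ (-α)) (n + 1) ≤ M := by
    intro n hn M hM hx
    simp only [linRec]
    have h1 := (hn₀ n hn).1
    have h0 : 0 ≤ ((n + 1 : ℕ) : ℝ) ^ (-α) := by positivity
    have hM0 : 0 ≤ M := le_trans (by positivity) hM
    have hcM : 1 ≤ c / 8 * M := by
      rw [div_le_iff₀ hc] at hM
      linarith
    have ha := sgdFactor_nonneg (L := L) hc hc1 hα (n + 1)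
    have := mul_le_mul_of_nonneg_left hx ha
    have := mul_le_mul_of_nonneg_right h1 hM0
    nlinarith
  exact exists_bound_of_eventually_step hpos

/-- The product of the contraction factors. -/
noncomputable def sgdProd (c L α : ℝ) : ℕ → ℝ
  | 0 => 1
  | n + 1 => sgdFactor c L α (n + 1) * sgdProd c L α n

theorem sgdProd_nonneg {c L α : ℝ} (hc : 0 < c) (hc1 : c ≤ 1) (hα : 0 < α) (n : ℕ) :
    0 ≤ sgdProd c L α n := by
  induction n with
  | zero => exact zero_le_one
  | succ n ih => exact mul_nonneg (sgdFactor_nonneg hc hc1 hα _) ih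

/-- Multiplied by `n ^ (2 * α)`, the product is eventually non-increasing. Its square root is the
rate `n ^ (-α)` at which the initial error is forgotten. -/
theorem exists_bound_sgdProd {c L α : ℝ} (hc : 0 < c) (hc1 : c ≤ 1) (hα : 0 < α) (hα1 : α < 1) :
    ∃ X, 0 < X ∧ ∀ n, sgdProd c L α n ≤ X ∧
      sgdProd c L α n * ((n : ℝ) ^ α) ^ 2 ≤ X := by
  obtain ⟨n₀, hn₀⟩ := eventually_atTop.1 ((eventually_sgdFactor_le (L := L) hc hα).and
    (eventually_one_sub_stepSize_mul_rpow_le (c := c / 8) (α := α) (β := 2 * α) (by positivity)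
      hα1 (by positivity)))
  have hsq : ∀ n : ℕ, ((n : ℝ) ^ α) ^ 2 = (n : ℝ) ^ (2 * α) := fun n => by
    rw [mul_comm, Real.rpow_mul (Nat.cast_nonneg n)]
    norm_cast
  obtain ⟨X, hX0, hX⟩ := exists_bound_of_eventually_step
    (x := fun n => sgdProd c L α n * ((n : ℝ) ^ α) ^ 2) (M₀ := 0) (n₀ := n₀) (by
      intro n hn M _ hx
      refine le_trans ?_ hx
      obtain ⟨h1, h2⟩ := hn₀ n hn
      rw [hsq, hsq]
      simp only [sgdProd]
      have hp := sgdProd_nonneg (L := L) hc hc1 hα n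
      calc _ = sgdProd c L α n * (sgdFactor c L α (n + 1) * ((n + 1 : ℕ) : ℝ) ^ (2 * α)) := by ring
        _ ≤ sgdProd c L α n * (n : ℝ) ^ (2 * α) := by
          refine mul_le_mul_of_nonneg_left (le_trans ?_ h2) hp
          gcongr)
  refine ⟨X + 1, by linarith, fun n => ⟨?_, (hX n).trans (by linarith)⟩⟩
  rcases Nat.eq_zero_or_pos n with rfl | hn
  · simp only [sgdProd]
    linarith
  · have h1 : (1 : ℝ) ≤ ((n : ℝ) ^ α) ^ 2 :=
      one_le_pow₀ (Real.one_le_rpow (by exact_mod_cast hn) hα.le)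
    have := hX n
    have := mul_le_mul_of_nonneg_left h1 (sgdProd_nonneg (L := L) hc hc1 hα n)
    linarith

end Sequences

/-! ### Pathwise analysis of stochastic gradient ascent. -/

section Descent

variable {E : Type*} [NormedAddCommGroup E] [InnerProductSpace ℝ E]

/-- One step of stochastic gradient ascent, after subtraction of the filtered noise `U`. -/
theorem sgd_step {c L η : ℝ} (hc : 0 < c) (hc1 : c ≤ 1) (hη : 0 ≤ η)
    (hη1 : η ≤ 1) {Y U g r : E} (h1 : inner ℝ g (Y + U) ≤ -c * ‖Y + U‖ ^ 2)
    (h2 : ‖g‖ ≤ L * ‖Y + U‖) :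
    ‖Y + η • (g + r + c • U)‖ ^ 2 ≤ (1 - c / 4 * η + 6 * L ^ 2 * η ^ 2) * ‖Y‖ ^ 2
      + (30 + L ^ 2 / c + 16 / c + 6 * L ^ 2) * (η * (‖U‖ ^ 2 + ‖r‖ ^ 2)) := by
  set y := ‖Y‖
  set u := ‖U‖
  set ρ := ‖r‖
  set d := ‖Y + U‖
  have hy : 0 ≤ y := norm_nonneg _
  have hu : 0 ≤ u := norm_nonneg _
  have hρ : 0 ≤ ρ := norm_nonneg _
  have hd : 0 ≤ d := norm_nonneg _
  have hdy : d ≤ y + u := norm_add_le _ _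
  have hyd : y ≤ d + u := by
    have : Y = (Y + U) - U := by abel
    calc y = ‖(Y + U) - U‖ := by rw [← this]
      _ ≤ d + u := norm_sub_le _ _
  have hg0 := norm_nonneg g
  have hc2 : c * (L ^ 2 / c) = L ^ 2 := by field_simp
  have hc3 : c * (1 / c) = 1 := by field_simp
  -- Monotonicity is available at `Y + U` and not at `Y`. The difference `⟪g, U⟫` is absorbed by
  -- Young's inequality into half of the gain `c * d ^ 2`.
  have e1 : inner ℝ Y g ≤ -(c / 4) * y ^ 2 + (c / 2 + L ^ 2 / (2 * c)) * u ^ 2 := by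
    have a1 : inner ℝ Y g = inner ℝ g (Y + U) - inner ℝ g U := by
      rw [inner_add_right, real_inner_comm]
      ring
    have a2 : -inner ℝ g U ≤ L * d * u := by
      have b1 := abs_real_inner_le_norm g U
      have b2 := neg_abs_le (inner ℝ g U)
      have b3 : ‖g‖ * ‖U‖ ≤ L * d * u := mul_le_mul_of_nonneg_right h2 hu
      linarith
    have a3 : L * d * u ≤ c / 2 * d ^ 2 + L ^ 2 / (2 * c) * u ^ 2 := by
      have : L ^ 2 / (2 * c) = (L / c) ^ 2 * (c / 2) := by field_simp
      rw [this]
      have e : L * d * u = c * d * ((L / c) * u) := by field_simp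
      rw [e]
      linarith [mul_nonneg hc.le (sq_nonneg (d - (L / c) * u))]
    have a4 : y ^ 2 ≤ 2 * d ^ 2 + 2 * u ^ 2 := by
      linarith [sq_nonneg (d - u), pow_le_pow_left₀ hy hyd 2]
    have a5 := mul_le_mul_of_nonneg_left a4 hc.le
    linarith
  have e2 : inner ℝ Y (r + c • U) ≤ c / 16 * y ^ 2 + 8 / c * (ρ ^ 2 + c ^ 2 * u ^ 2) := by
    have a1 : inner ℝ Y (r + c • U) ≤ y * (ρ + c * u) := by
      refine (real_inner_le_norm _ _).trans (mul_le_mul_of_nonneg_left ?_ hy)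
      refine (norm_add_le _ _).trans ?_
      rw [norm_smul, Real.norm_of_nonneg hc.le]
    have a2 : y * (ρ + c * u) ≤ c / 16 * y ^ 2 + 4 / c * (ρ + c * u) ^ 2 := by
      have : 4 / c * (ρ + c * u) ^ 2 = c / 16 * (8 / c * (ρ + c * u)) ^ 2 := by field_simp; ring
      rw [this]
      have e : y * (ρ + c * u) = c / 8 * y * (8 / c * (ρ + c * u)) := by field_simp
      rw [e]
      linarith [mul_nonneg hc.le (sq_nonneg (y - 8 / c * (ρ + c * u)))]
    have a3 : 4 / c * (ρ + c * u) ^ 2 ≤ 8 / c * (ρ ^ 2 + c ^ 2 * u ^ 2) := by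
      have : 8 / c * (ρ ^ 2 + c ^ 2 * u ^ 2) = 4 / c * (2 * (ρ ^ 2 + c ^ 2 * u ^ 2)) := by ring
      rw [this]
      refine mul_le_mul_of_nonneg_left ?_ (by positivity)
      linarith [sq_nonneg (ρ - c * u)]
    linarith
  have e3 : ‖g + r + c • U‖ ^ 2 ≤ 6 * L ^ 2 * (y ^ 2 + u ^ 2) + 3 * ρ ^ 2 + 3 * c ^ 2 * u ^ 2 := by
    have a1 : ‖g + r + c • U‖ ≤ ‖g‖ + ρ + c * u := by
      refine (norm_add₃_le).trans ?_
      rw [norm_smul, Real.norm_of_nonneg hc.le]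
    have a2 : ‖g‖ ^ 2 ≤ L ^ 2 * (2 * (y ^ 2 + u ^ 2)) := by
      calc ‖g‖ ^ 2 ≤ (L * d) ^ 2 := pow_le_pow_left₀ hg0 h2 2
        _ = L ^ 2 * d ^ 2 := by ring
        _ ≤ _ := by
          refine mul_le_mul_of_nonneg_left ?_ (sq_nonneg L)
          linarith [sq_nonneg (y - u), pow_le_pow_left₀ hd hdy 2]
    have a3 : ‖g + r + c • U‖ ^ 2 ≤ (‖g‖ + ρ + c * u) ^ 2 := pow_le_pow_left₀ (norm_nonneg _) a1 2
    linarith [sq_nonneg (‖g‖ - ρ), sq_nonneg (‖g‖ - c * u), sq_nonneg (ρ - c * u)]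
  have e4 : ‖Y + η • (g + r + c • U)‖ ^ 2 = y ^ 2 + 2 * η * (inner ℝ Y g + inner ℝ Y (r + c • U))
      + η ^ 2 * ‖g + r + c • U‖ ^ 2 := by
    rw [norm_add_sq_real, norm_smul, inner_smul_right, add_assoc g, inner_add_right,
      Real.norm_of_nonneg hη]
    ring
  have e5 : η ^ 2 ≤ η := by nlinarith
  have e6 : η ^ 2 * ‖g + r + c • U‖ ^ 2 ≤ 6 * L ^ 2 * η ^ 2 * y ^ 2 +
      η * (6 * L ^ 2 * u ^ 2 + 3 * ρ ^ 2 + 3 * c ^ 2 * u ^ 2) := by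
    have a1 := mul_le_mul_of_nonneg_left e3 (sq_nonneg η)
    have a2 : 0 ≤ 6 * L ^ 2 * u ^ 2 + 3 * ρ ^ 2 + 3 * c ^ 2 * u ^ 2 := by positivity
    have a3 := mul_le_mul_of_nonneg_right e5 a2
    linarith
  -- Here `-3c/16 = -c/4 + c/16`; doubled, it leaves `3c/8`, more than the `c/4` that is claimed.
  have e7 : 2 * η * (inner ℝ Y g + inner ℝ Y (r + c • U)) ≤ 2 * η * (-(3 * c / 16) * y ^ 2 +
      (c / 2 + L ^ 2 / (2 * c)) * u ^ 2 + 8 / c * (ρ ^ 2 + c ^ 2 * u ^ 2)) := by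
    refine mul_le_mul_of_nonneg_left ?_ (by positivity)
    linarith
  have e8 : c + L ^ 2 / c + 16 * c + 6 * L ^ 2 + 3 * c ^ 2 ≤
      30 + L ^ 2 / c + 16 / c + 6 * L ^ 2 := by
    have : 16 ≤ 16 / c := by rw [le_div_iff₀ hc]; linarith
    have : c ^ 2 ≤ 1 := pow_le_one₀ hc.le hc1
    linarith
  have e9 : 16 / c + 3 ≤ 30 + L ^ 2 / c + 16 / c + 6 * L ^ 2 := by
    have : 0 ≤ L ^ 2 / c := by positivity
    linarith [sq_nonneg L]
  have e10 : 2 * η * (-(3 * c / 16) * y ^ 2 +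
      (c / 2 + L ^ 2 / (2 * c)) * u ^ 2 + 8 / c * (ρ ^ 2 + c ^ 2 * u ^ 2)) +
      η * (6 * L ^ 2 * u ^ 2 + 3 * ρ ^ 2 + 3 * c ^ 2 * u ^ 2) =
      -(3 * c / 8) * η * y ^ 2 + η * ((c + L ^ 2 / c + 16 * c + 6 * L ^ 2 + 3 * c ^ 2) * u ^ 2
        + (16 / c + 3) * ρ ^ 2) := by
    field_simp
    ring
  have e11 := mul_le_mul_of_nonneg_left (add_le_add
    (mul_le_mul_of_nonneg_right e8 (sq_nonneg u)) (mul_le_mul_of_nonneg_right e9 (sq_nonneg ρ))) hη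
  have e12 : 0 ≤ c * η * y ^ 2 := by positivity
  rw [e4]
  linarith

/-- Pathwise error bound for stochastic gradient ascent with decreasing step sizes, in terms of
the filtered noise `U`. -/
theorem exists_sgd_bound {c L α : ℝ} (hc : 0 < c) (hc1 : c ≤ 1) (hα : 0 < α)
    (hα1 : α < 1) : ∃ B : ℝ, 0 < B ∧
      (∀ n, linRec (sgdFactor c L α) (fun n => ((n + 1 : ℕ) : ℝ) ^ (-α)) n ≤ B) ∧
      ∀ (Δ U ξ r g : ℕ → E) (ρ rr u₀ : ℝ),
        (∀ n, Δ (n + 1) = Δ n + ((n + 1 : ℕ) : ℝ) ^ (-α) • (g n + ξ n + r n)) →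
        U 0 = 0 →
        (∀ n, U (n + 1) = (1 - c * ((n + 1 : ℕ) : ℝ) ^ (-α)) • U n
          + ((n + 1 : ℕ) : ℝ) ^ (-α) • ξ n) →
        (∀ n, ‖Δ n‖ < ρ → inner ℝ (g n) (Δ n) ≤ -c * ‖Δ n‖ ^ 2 ∧ ‖g n‖ ≤ L * ‖Δ n‖) →
        (∀ n, ‖r n‖ ≤ rr) → (∀ n, ‖U n‖ ≤ u₀) → B * (‖Δ 0‖ + u₀ + rr) < ρ →
        ∀ n, ‖Δ n‖ < ρ ∧ (1 ≤ n → ‖Δ n‖ ≤ B * ((n : ℝ) ^ (-α) * ‖Δ 0‖ +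
          Real.sqrt (linRec (sgdFactor c L α)
            (fun k => ((k + 1 : ℕ) : ℝ) ^ (-α) * (‖U k‖ ^ 2 + rr ^ 2)) n)) + ‖U n‖) := by
  obtain ⟨X, hX0, hX⟩ := exists_bound_linRec_sgdFactor (L := L) hc hc1 hα
  obtain ⟨X', hX'0, hX'⟩ := exists_bound_sgdProd (L := L) hc hc1 hα hα1
  set B₁ : ℝ := 30 + L ^ 2 / c + 16 / c + 6 * L ^ 2 with hB₁
  have hB₁0 : 0 < B₁ := by positivity
  -- A single constant with `M ≥ 1`, so that `M ≤ M ^ 2` and every linear constant is dominated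
  -- inside a square.
  set M : ℝ := X' + B₁ * X + B₁ + X + 1 with hM
  have hM1 : 1 ≤ M := by
    have : 0 < B₁ * X := by positivity
    linarith
  have hMM : M ≤ M ^ 2 := by nlinarith
  -- The additional one pays for adding `U n` back to `Δ n - U n`.
  refine ⟨M + 1, by linarith, fun n => (hX n).trans
    (by have : 0 < B₁ * X := by positivity
        linarith), ?_⟩
  intro Δ U ξ r g ρ rr u₀ hΔ hU0 hU hg hr hu hsmall
  have hrr : 0 ≤ rr := (norm_nonneg _).trans (hr 0)
  have hu₀ : 0 ≤ u₀ := (norm_nonneg _).trans (hu 0)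
  set a := sgdFactor c L α with ha_def
  have ha : ∀ n, 0 ≤ a n := sgdFactor_nonneg hc hc1 hα
  set Z := linRec a (fun k => ((k + 1 : ℕ) : ℝ) ^ (-α) * (‖U k‖ ^ 2 + rr ^ 2)) with hZ
  have hZ0 : ∀ n, 0 ≤ Z n := linRec_nonneg ha fun n => by positivity
  have hZle : ∀ n, Z n ≤ (u₀ ^ 2 + rr ^ 2) * X := fun n => by
    refine (linRec_le (h := fun n => ((n + 1 : ℕ) : ℝ) ^ (-α)) (M := u₀ ^ 2 + rr ^ 2) ha
      (fun k => ?_) n).trans (mul_le_mul_of_nonneg_left (hX n) (by positivity))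
    rw [mul_comm]
    refine mul_le_mul_of_nonneg_right ?_ (by positivity)
    have := pow_le_pow_left₀ (norm_nonneg _) (hu k) 2
    linarith
  -- The quadratic estimate at `n` confines `Δ n` to the ball, outside of which nothing is assumed
  -- about `g`. The induction in `main` alternates between estimate and confinement.
  have hball : ∀ n, ‖Δ n - U n‖ ^ 2 ≤ sgdProd c L α n * ‖Δ 0‖ ^ 2 + B₁ * Z n → ‖Δ n‖ < ρ := by
    intro n hn
    have h1 : ‖Δ n - U n‖ ^ 2 ≤ (M * (‖Δ 0‖ + u₀ + rr)) ^ 2 := by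
      have b1 : sgdProd c L α n * ‖Δ 0‖ ^ 2 ≤ M ^ 2 * ‖Δ 0‖ ^ 2 := by
        refine mul_le_mul_of_nonneg_right (((hX' n).1).trans (le_trans ?_ hMM)) (by positivity)
        have : 0 < B₁ * X := by positivity
        linarith
      have b2 : B₁ * Z n ≤ M ^ 2 * (u₀ ^ 2 + rr ^ 2) := by
        calc B₁ * Z n ≤ B₁ * ((u₀ ^ 2 + rr ^ 2) * X) := mul_le_mul_of_nonneg_left (hZle n) hB₁0.le
          _ = (B₁ * X) * (u₀ ^ 2 + rr ^ 2) := by ring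
          _ ≤ _ := mul_le_mul_of_nonneg_right (le_trans (by linarith) hMM) (by positivity)
      have b3 : ‖Δ 0‖ ^ 2 + (u₀ ^ 2 + rr ^ 2) ≤ (‖Δ 0‖ + u₀ + rr) ^ 2 := by
        have := norm_nonneg (Δ 0)
        linarith [mul_nonneg this hu₀, mul_nonneg this hrr, mul_nonneg hu₀ hrr]
      have b4 := mul_le_mul_of_nonneg_left b3 (sq_nonneg M)
      rw [mul_pow]
      linarith
    have h2 := abs_le_of_sq_le_sq h1 (by positivity)
    have h3 : ‖Δ n‖ ≤ ‖Δ n - U n‖ + ‖U n‖ := by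
      simpa using norm_add_le (Δ n - U n) (U n)
    have h4 := le_abs_self (‖Δ n - U n‖)
    have h6 := norm_nonneg (Δ 0)
    linarith [hu n]
  have main : ∀ n, ‖Δ n - U n‖ ^ 2 ≤ sgdProd c L α n * ‖Δ 0‖ ^ 2 + B₁ * Z n := by
    intro n
    induction n with
    | zero => simp [sgdProd, hU0, hZ, linRec]
    | succ n ih =>
      obtain ⟨g1, g2⟩ := hg n (hball n ih)
      set η : ℝ := ((n + 1 : ℕ) : ℝ) ^ (-α) with hη
      have hη0 : 0 ≤ η := by positivity
      have hη1 : η ≤ 1 := stepSize_le_one hα.le (Nat.le_add_left 1 n)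
      -- Both recursions contain `η • ξ n`, which cancels; the decay of the filter reappears as `c •
      -- U n`.
      have hY : Δ (n + 1) - U (n + 1) = (Δ n - U n) + η • (g n + r n + c • U n) := by
        rw [hΔ, hU, ← hη]
        module
      have hYU : Δ n - U n + U n = Δ n := by abel
      have hst := sgd_step (Y := Δ n - U n) (U := U n) (r := r n) hc hc1 hη0 hη1
        (by rwa [hYU]) (by rwa [hYU])
      rw [← hY] at hst
      have hr2 : ‖r n‖ ^ 2 ≤ rr ^ 2 := pow_le_pow_left₀ (norm_nonneg _) (hr n) 2
      have haη : 1 - c / 4 * η + 6 * L ^ 2 * η ^ 2 = a (n + 1) := rfl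
      rw [haη] at hst
      have hZs : Z (n + 1) = a (n + 1) * Z n + η * (‖U n‖ ^ 2 + rr ^ 2) := rfl
      have hps : sgdProd c L α (n + 1) = a (n + 1) * sgdProd c L α n := rfl
      have h1 := mul_le_mul_of_nonneg_left ih (ha (n + 1))
      have h2 : B₁ * (η * (‖U n‖ ^ 2 + ‖r n‖ ^ 2)) ≤ B₁ * (η * (‖U n‖ ^ 2 + rr ^ 2)) := by gcongr
      rw [hZs, hps]
      linarith
  intro n
  refine ⟨hball n (main n), fun hn => ?_⟩
  have hnpos : (0 : ℝ) < n := by exact_mod_cast hn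
  have h1 : ‖Δ n - U n‖ ^ 2 ≤ (M * ((n : ℝ) ^ (-α) * ‖Δ 0‖ + Real.sqrt (Z n))) ^ 2 := by
    have b1 : sgdProd c L α n ≤ M ^ 2 * ((n : ℝ) ^ (-α)) ^ 2 := by
      have h := (hX' n).2
      have hpos : 0 < ((n : ℝ) ^ α) ^ 2 := by positivity
      have he : ((n : ℝ) ^ (-α)) ^ 2 = (((n : ℝ) ^ α) ^ 2)⁻¹ := by
        rw [Real.rpow_neg hnpos.le, inv_pow]
      rw [he, ← div_eq_mul_inv, le_div_iff₀ hpos]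
      have : 0 < B₁ * X := by positivity
      linarith
    have b2 : B₁ * Z n ≤ M ^ 2 * Z n := by
      refine mul_le_mul_of_nonneg_right (le_trans ?_ hMM) (hZ0 n)
      have : 0 < B₁ * X := by positivity
      linarith
    have b3 : ((n : ℝ) ^ (-α) * ‖Δ 0‖) ^ 2 + Z n ≤
        ((n : ℝ) ^ (-α) * ‖Δ 0‖ + Real.sqrt (Z n)) ^ 2 := by
      have e1 := Real.sq_sqrt (hZ0 n)
      have e2 : 0 ≤ (n : ℝ) ^ (-α) * ‖Δ 0‖ := by positivity
      linarith [mul_nonneg e2 (Real.sqrt_nonneg (Z n))]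
    have b4 := mul_le_mul_of_nonneg_right b1 (sq_nonneg ‖Δ 0‖)
    have b5 := mul_le_mul_of_nonneg_left b3 (sq_nonneg M)
    rw [mul_pow M]
    have := main n
    linarith
  have h2 := abs_le_of_sq_le_sq h1 (by positivity)
  have h3 : ‖Δ n‖ ≤ ‖Δ n - U n‖ + ‖U n‖ := by
    simpa using norm_add_le (Δ n - U n) (U n)
  have h5 : 0 ≤ (n : ℝ) ^ (-α) * ‖Δ 0‖ + Real.sqrt (Z n) := by positivity
  have h6 := le_abs_self (‖Δ n - U n‖)
  linarith

end Descent

/-! ### Exponential moments and Chernoff bounds. -/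

section Chernoff

variable {Ω : Type*} [MeasurableSpace Ω] {P : Measure Ω} {ι : Type*}
  {N : ι → Ω → Measure ℝ} {r : ι → ℝ → ℝ}

theorem exp_sub_one_le {x : ℝ} (hx : |x| ≤ 1) : Real.exp x - 1 ≤ x + x ^ 2 := by
  have := (abs_le.1 (Real.abs_exp_sub_one_sub_id_le hx)).2
  linarith

/-- Exponential moments of sums of integrals against independent Poisson processes. -/
theorem lintegral_exp_sum_integral_le (hN : ∀ i, IsPoissonProcess P (N i) (r i))
    (hind : iIndepFun N P) {B : Set ℝ} (hB : MeasurableSet B) (hB0 : B ⊆ Set.Ici 0)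
    (hBb : Bornology.IsBounded B) (hr : ∀ i, IntegrableOn (r i) B)
    (hr0 : ∀ i, ∀ t ∈ B, 0 ≤ r i t) {R : ℝ} (hrR : ∀ i, ∀ t ∈ B, r i t ≤ R) (s : Finset ι)
    {f : ι → ℝ → ℝ} (hf : ∀ i, Measurable (f i)) {b : ℝ} (hb : 0 ≤ b) (hb1 : b ≤ 1)
    (hfb : ∀ i, ∀ t ∈ B, |f i t| ≤ b) :
    ∫⁻ ω, ENNReal.ofReal (Real.exp (∑ i ∈ s, ∫ t in B, f i t ∂(N i ω))) ∂P ≤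
      ENNReal.ofReal (Real.exp (∑ i ∈ s, (∫ t in B, f i t * r i t)
        + s.card * (b ^ 2 * R * volume.real B))) := by
  have h1 : ∀ ω, ENNReal.ofReal (Real.exp (∑ i ∈ s, ∫ t in B, f i t ∂(N i ω))) =
      ∏ i ∈ s, ENNReal.ofReal (Real.exp (∫ t in B, f i t ∂(N i ω))) := fun ω => by
    rw [Real.exp_sum, ENNReal.ofReal_prod_of_nonneg (fun _ _ => (Real.exp_pos _).le)]
  have hg : ∀ i, Measurable fun ν : Measure ℝ =>
      ENNReal.ofReal (Real.exp (∫ t in B, f i t ∂ν)) := fun i => by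
    have := (measurable_integral_measure (hf i)).comp (measurable_restrict_measure hB)
    simp only [Function.comp_def] at this
    fun_prop
  have h2 := lintegral_prod_eq_prod_lintegral_of_indepFun s _ (hind.comp _ hg)
    (fun i => (hg i).comp (hN i).measurable)
  simp only [Function.comp_def] at h2
  simp_rw [h1]
  rw [h2, ← nsmul_eq_mul, ← Finset.sum_const, ← Finset.sum_add_distrib, Real.exp_sum,
    ENNReal.ofReal_prod_of_nonneg (fun _ _ => (Real.exp_pos _).le)]
  refine Finset.prod_le_prod' fun i _ => ?_
  refine ((hN i).lintegral_exp_integral_le hB hB0 hBb (hr i) (hr0 i) (hf i) hb (hfb i)).trans ?_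
  refine ENNReal.ofReal_le_ofReal (Real.exp_le_exp.2 ?_)
  have hvol : volume B ≠ ⊤ := hBb.measure_lt_top.ne
  have hfr : IntegrableOn (fun t => f i t * r i t) B :=
    Integrable.bdd_mul (c := b) (hr i) (hf i).aestronglyMeasurable
      ((ae_restrict_iff' hB).2 (Eventually.of_forall fun t ht => by simpa using hfb i t ht))
  have hc : IntegrableOn (fun _ : ℝ => b ^ 2 * R) B := integrableOn_const hvol
  have e1 : ∫ t in B, (f i t * r i t + b ^ 2 * R) = (∫ t in B, f i t * r i t)
      + b ^ 2 * R * volume.real B := by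
    rw [integral_add hfr hc, setIntegral_const, smul_eq_mul]
    ring
  rw [← e1]
  refine setIntegral_mono_on ?_ (hfr.add hc) hB fun t ht => ?_
  · refine Integrable.bdd_mul (c := Real.exp b + 1) (hr i)
      (by have := hf i; fun_prop) ((ae_restrict_iff' hB).2 (Eventually.of_forall fun t ht => ?_))
    refine (norm_sub_le _ _).trans ?_
    rw [Real.norm_eq_abs, abs_of_pos (Real.exp_pos _), norm_one]
    gcongr
    exact (le_abs_self _).trans (hfb i t ht)
  · have hft := hfb i t ht
    have a1 := exp_sub_one_le (hft.trans hb1)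
    have a2 : f i t ^ 2 ≤ b ^ 2 := sq_le_sq' (abs_le.1 hft).1 (abs_le.1 hft).2
    have a3 := mul_le_mul_of_nonneg_right a1 (hr0 i t ht)
    have a4 := mul_le_mul a2 (hrR i t ht) (hr0 i t ht) (sq_nonneg b)
    linarith

/-- Conditioning on `X` by Fubini for the product law: a bound that is uniform in a frozen value `x`
holds with the random `X` inserted. In this way the noise of a window may be evaluated at a
parameter computed from the past. -/
theorem lintegral_mul_le_of_indepFun {𝒳 𝒴 : Type*} [MeasurableSpace 𝒳] [MeasurableSpace 𝒴]
    [IsProbabilityMeasure P] {X : Ω → 𝒳} {Y : Ω → 𝒴} (hX : Measurable X) (hY : Measurable Y)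
    (hXY : IndepFun X Y P) {h : 𝒳 → ENNReal} (hh : Measurable h) {G : 𝒳 × 𝒴 → ENNReal}
    (hG : Measurable G) {M : ENNReal} (hM : ∀ x, ∫⁻ ω, G (x, Y ω) ∂P ≤ M) :
    ∫⁻ ω, h (X ω) * G (X ω, Y ω) ∂P ≤ M * ∫⁻ ω, h (X ω) ∂P := by
  have h1 := (indepFun_iff_map_prod_eq_prod_map_map hX.aemeasurable hY.aemeasurable).1 hXY
  have hF : Measurable fun x : 𝒳 × 𝒴 => h x.1 * G x := (hh.comp measurable_fst).mul hG
  have e1 : ∫⁻ ω, h (X ω) * G (X ω, Y ω) ∂P =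
      ∫⁻ x, h x.1 * G x ∂(P.map fun ω => (X ω, Y ω)) :=
    (lintegral_map hF (hX.prodMk hY)).symm
  have := Measure.isProbabilityMeasure_map hX.aemeasurable (μ := P)
  have := Measure.isProbabilityMeasure_map hY.aemeasurable (μ := P)
  rw [e1, h1, lintegral_prod _ hF.aemeasurable]
  calc ∫⁻ x, ∫⁻ y, h x * G (x, y) ∂(P.map Y) ∂(P.map X)
      ≤ ∫⁻ x, M * h x ∂(P.map X) := by
        refine lintegral_mono fun x => ?_
        have hGx : Measurable fun y => G (x, y) := hG.comp measurable_prodMk_left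
        rw [lintegral_const_mul _ hGx, lintegral_map hGx hY, mul_comm]
        exact mul_le_mul_left (hM x) _
    _ = M * ∫⁻ ω, h (X ω) ∂P := by
        rw [lintegral_const_mul _ hh, lintegral_map hh hX]

theorem measure_ge_le_exp {X : Ω → ℝ} (x : ℝ) {y : ℝ}
    (hX : ∫⁻ ω, ENNReal.ofReal (Real.exp (X ω)) ∂P ≤ ENNReal.ofReal (Real.exp y))
    (hm : AEMeasurable X P) :
    P {ω | x ≤ X ω} ≤ ENNReal.ofReal (Real.exp (y - x)) := by
  have h1 := mul_meas_ge_le_lintegral₀ (μ := P) (f := fun ω => ENNReal.ofReal (Real.exp (X ω)))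
    (by fun_prop) (ENNReal.ofReal (Real.exp x))
  have hset : {ω | x ≤ X ω} ⊆
      {ω | ENNReal.ofReal (Real.exp x) ≤ ENNReal.ofReal (Real.exp (X ω))} := fun ω hω =>
    ENNReal.ofReal_le_ofReal (Real.exp_le_exp.2 hω)
  have h2 : ENNReal.ofReal (Real.exp x) * P {ω | x ≤ X ω} ≤ ENNReal.ofReal (Real.exp y) :=
    (mul_le_mul_right (measure_mono hset) _).trans (h1.trans hX)
  rw [Real.exp_sub, ENNReal.ofReal_div_of_pos (Real.exp_pos _),
    ENNReal.le_div_iff_mul_le (Or.inl (by simp [Real.exp_pos])) (Or.inl ENNReal.ofReal_ne_top),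
    mul_comm]
  exact h2

end Chernoff

/-! ### Sums of stretched exponentials. -/

section Tail

/-- Compare with `n ^ (-α * k)` through `exp x ≥ x ^ k / k!`, for a `k` with `α * k > 1`. -/
theorem summable_exp_neg_rpow {α : ℝ} (hα : 0 < α) :
    Summable fun n : ℕ => Real.exp (-((n + 1 : ℕ) : ℝ) ^ α) := by
  obtain ⟨k, hk⟩ := exists_nat_gt (2 / α)
  have hk2 : 1 < α * k := by
    rw [div_lt_iff₀ hα] at hk
    linarith
  have hs : Summable fun n : ℕ => (k.factorial : ℝ) * (1 / ((n + 1 : ℕ) : ℝ) ^ (α * k)) :=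
    ((summable_nat_add_iff 1).2 (Real.summable_one_div_nat_rpow.2 hk2)).mul_left _
  refine Summable.of_nonneg_of_le (fun n => (Real.exp_pos _).le) (fun n => ?_) hs
  have hx : (0 : ℝ) < ((n + 1 : ℕ) : ℝ) ^ α := by positivity
  have h1 := Real.pow_div_factorial_le_exp (((n + 1 : ℕ) : ℝ) ^ α) hx.le k
  rw [Real.rpow_mul (by positivity), Real.rpow_natCast, Real.exp_neg, mul_one_div]
  rw [inv_le_comm₀ (Real.exp_pos _) (by positivity), inv_div]
  exact h1

/-- Stretched exponential tails are jointly negligible for large rates. -/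
theorem exists_tsum_exp_le {α s : ℝ} (hα : 0 < α) (hs : 0 < s) {ε : ENNReal} (hε : 0 < ε) :
    ∃ a₀ : ℝ, 0 < a₀ ∧ ∀ a, a₀ ≤ a →
      ∑' n : ℕ, ENNReal.ofReal (Real.exp (-(s * a * ((n + 1 : ℕ) : ℝ) ^ α))) ≤ ε := by
  set T : ℝ := ∑' n : ℕ, Real.exp (-((n + 1 : ℕ) : ℝ) ^ α)
  have hlim : Tendsto (fun a : ℝ => ENNReal.ofReal (Real.exp (-(s * a - 1)) * T)) atTop (𝓝 0) := by
    have h1 : Tendsto (fun a : ℝ => s * a - 1) atTop atTop :=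
      tendsto_atTop_add_const_right _ _ (tendsto_id.const_mul_atTop hs)
    have h2 := ((Real.tendsto_exp_neg_atTop_nhds_zero.comp h1).mul_const T)
    rw [zero_mul] at h2
    simpa using ENNReal.tendsto_ofReal h2
  obtain ⟨a₁, ha₁⟩ := eventually_atTop.1 (hlim.eventually_le_const hε)
  refine ⟨max (max a₁ (1 / s)) 1, by positivity, fun a ha => ?_⟩
  have ha1 : a₁ ≤ a := (le_max_left _ _).trans ((le_max_left _ _).trans ha)
  have hsa : 1 ≤ s * a := by
    have := (le_max_right _ _).trans ((le_max_left _ _).trans ha)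
    rw [div_le_iff₀ hs] at this
    linarith
  refine le_trans ?_ (ha₁ a ha1)
  -- This is `(s * a - 1) * (x - 1) ≥ 0` with `x = (n + 1) ^ α ≥ 1`; the factor that depends on `a`
  -- splits off and tends to zero.
  have hle : ∀ n : ℕ, Real.exp (-(s * a * ((n + 1 : ℕ) : ℝ) ^ α)) ≤
      Real.exp (-(s * a - 1)) * Real.exp (-((n + 1 : ℕ) : ℝ) ^ α) := fun n => by
    rw [← Real.exp_add]
    refine Real.exp_le_exp.2 ?_
    have : (1 : ℝ) ≤ ((n + 1 : ℕ) : ℝ) ^ α :=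
      Real.one_le_rpow (by exact_mod_cast Nat.le_add_left 1 n) hα.le
    nlinarith
  calc _ ≤ ∑' n : ℕ, ENNReal.ofReal
        (Real.exp (-(s * a - 1)) * Real.exp (-((n + 1 : ℕ) : ℝ) ^ α)) :=
        ENNReal.tsum_le_tsum fun n => ENNReal.ofReal_le_ofReal (hle n)
    _ = _ := by
        rw [← ENNReal.ofReal_tsum_of_nonneg (fun n => by positivity)
          ((summable_exp_neg_rpow hα).mul_left _), tsum_mul_left]

end Tail

/-! ### Exponential moments, variance and supremum of the filtered noise. -/

section FilteredNoise

/-- Exponential moments of the filtered noise `u`, given conditional exponential moments of the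
noise `ξ`. The parameter `a` is the size of the sample in each window. -/
theorem exists_filtered_noise_mgf {c α κ₀ V₀ : ℝ} (hc : 0 < c) (hc1 : c ≤ 1) (hα : 0 < α)
    (hα1 : α < 1) (hκ₀ : 0 < κ₀) (hV₀ : 0 < V₀) :
    ∃ κ V : ℝ, 0 < κ ∧ 0 < V ∧ ∀ {Ω : Type*} [MeasurableSpace Ω] (P : Measure Ω)
      [IsProbabilityMeasure P] (u ξ : ℕ → Ω → ℝ) (a : ℝ), 0 < a →
      (∀ ω, u 0 ω = 0) →
      (∀ n ω, u (n + 1) ω = (1 - c * ((n + 1 : ℕ) : ℝ) ^ (-α)) * u n ω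
          + ((n + 1 : ℕ) : ℝ) ^ (-α) * ξ n ω) →
      (∀ n l l', |l| ≤ κ₀ * a → ∫⁻ ω, ENNReal.ofReal (Real.exp (l' * u n ω + l * ξ n ω)) ∂P ≤
        ENNReal.ofReal (Real.exp (V₀ * l ^ 2 / a)) *
          ∫⁻ ω, ENNReal.ofReal (Real.exp (l' * u n ω)) ∂P) →
      ∀ n : ℕ, 1 ≤ n → ∀ l, |l| ≤ κ * a * (n : ℝ) ^ α →
        ∫⁻ ω, ENNReal.ofReal (Real.exp (l * u n ω)) ∂P ≤
          ENNReal.ofReal (Real.exp (V * l ^ 2 * (n : ℝ) ^ (-α) / a)) := by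
  obtain ⟨n₀, hn₀⟩ := eventually_atTop.1
    ((eventually_one_sub_stepSize_mul_rpow_le (c := c) (α := α) (β := α) hc hα1 hα))
  set m₀ : ℕ := n₀ + 1 with hm₀
  have hm₀pos : (0 : ℝ) < m₀ := by positivity
  have hm₀α : (1 : ℝ) ≤ (m₀ : ℝ) ^ α :=
    Real.one_le_rpow (by exact_mod_cast Nat.le_add_left 1 n₀) hα.le
  -- Up to `m₀` a crude bound linear in `n` is used: `κ` keeps `l` within `κ₀ * a`, and the first
  -- summand of `V` covers the accumulated variance. The second summand gives `V₀ ≤ c * V`, which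
  -- closes the induction beyond `m₀`.
  refine ⟨κ₀ / (m₀ : ℝ) ^ α, m₀ * V₀ * (m₀ : ℝ) ^ α + V₀ / c, by positivity, by positivity, ?_⟩
  set κ := κ₀ / (m₀ : ℝ) ^ α with hκ
  set V := m₀ * V₀ * (m₀ : ℝ) ^ α + V₀ / c with hV
  have hκκ : κ ≤ κ₀ := div_le_self hκ₀.le hm₀α
  have hκ0 : 0 < κ := by positivity
  have hV0 : 0 < V := by positivity
  intro Ω _ P _ u ξ a ha hu0 hu hcond
  -- The noise enters multiplied by `(n + 1) ^ (-α)`, so the admissible range of `l` grows like `n ^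
  -- α`.
  have hstep : ∀ n l, |l| ≤ κ₀ * a * ((n + 1 : ℕ) : ℝ) ^ α →
      ∫⁻ ω, ENNReal.ofReal (Real.exp (l * u (n + 1) ω)) ∂P ≤
      ENNReal.ofReal (Real.exp (V₀ * (l * ((n + 1 : ℕ) : ℝ) ^ (-α)) ^ 2 / a)) *
        ∫⁻ ω, ENNReal.ofReal (Real.exp (l * (1 - c * ((n + 1 : ℕ) : ℝ) ^ (-α)) * u n ω)) ∂P := by
    intro n l hl
    have h1 := hcond n (l * ((n + 1 : ℕ) : ℝ) ^ (-α))
      (l * (1 - c * ((n + 1 : ℕ) : ℝ) ^ (-α))) (by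
        rw [abs_mul, abs_of_nonneg (by positivity : 0 ≤ ((n + 1 : ℕ) : ℝ) ^ (-α)),
          Real.rpow_neg (by positivity), ← div_eq_mul_inv, div_le_iff₀ (by positivity)]
        exact hl)
    refine le_trans (le_of_eq ?_) h1
    refine lintegral_congr fun ω => ?_
    rw [hu]
    congr 2
    ring
  have hcη : ∀ n : ℕ, 0 ≤ 1 - c * ((n + 1 : ℕ) : ℝ) ^ (-α) ∧
      1 - c * ((n + 1 : ℕ) : ℝ) ^ (-α) ≤ 1 := fun n => by
    have h1 := stepSize_le_one hα.le (Nat.le_add_left 1 n)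
    have h0 : 0 ≤ ((n + 1 : ℕ) : ℝ) ^ (-α) := by positivity
    constructor <;> nlinarith
  have hcrude : ∀ n l, |l| ≤ κ₀ * a → ∫⁻ ω, ENNReal.ofReal (Real.exp (l * u n ω)) ∂P ≤
      ENNReal.ofReal (Real.exp (n * (V₀ * l ^ 2 / a))) := by
    intro n
    induction n with
    | zero =>
      intro l _
      simp [hu0]
    | succ n ih =>
      intro l hl
      have hη1 := stepSize_le_one hα.le (Nat.le_add_left 1 n)
      have hη0 : 0 ≤ ((n + 1 : ℕ) : ℝ) ^ (-α) := by positivity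
      obtain ⟨hx0, hx1⟩ := hcη n
      have hone : (1 : ℝ) ≤ ((n + 1 : ℕ) : ℝ) ^ α :=
        Real.one_le_rpow (by exact_mod_cast Nat.le_add_left 1 n) hα.le
      refine (hstep n l (hl.trans (le_mul_of_one_le_right (by positivity) hone))).trans ?_
      refine (mul_le_mul_right (ih _ ?_) _).trans ?_
      · rw [abs_mul, abs_of_nonneg hx0]
        exact (mul_le_of_le_one_right (abs_nonneg _) hx1).trans hl
      · rw [← ENNReal.ofReal_mul (Real.exp_pos _).le, ← Real.exp_add]
        refine ENNReal.ofReal_le_ofReal (Real.exp_le_exp.2 ?_)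
        have b1 : V₀ * (l * ((n + 1 : ℕ) : ℝ) ^ (-α)) ^ 2 / a ≤ V₀ * l ^ 2 / a := by
          rw [mul_pow]
          gcongr
          exact mul_le_of_le_one_right (sq_nonneg l) (pow_le_one₀ hη0 hη1)
        have b2 : (n : ℝ) * (V₀ * (l * (1 - c * ((n + 1 : ℕ) : ℝ) ^ (-α))) ^ 2 / a) ≤
            n * (V₀ * l ^ 2 / a) := by
          rw [mul_pow]
          gcongr
          exact mul_le_of_le_one_right (sq_nonneg l) (pow_le_one₀ hx0 hx1)
        push_cast at *
        linarith
  have hsmall : ∀ n : ℕ, 1 ≤ n → n ≤ m₀ → ∀ l, |l| ≤ κ * a * (n : ℝ) ^ α →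
      ∫⁻ ω, ENNReal.ofReal (Real.exp (l * u n ω)) ∂P ≤
        ENNReal.ofReal (Real.exp (V * l ^ 2 * (n : ℝ) ^ (-α) / a)) := by
    intro n hn hnm l hl
    have hnpos : (0 : ℝ) < n := by exact_mod_cast hn
    have hnm' : (n : ℝ) ≤ m₀ := by exact_mod_cast hnm
    have hnα : (n : ℝ) ^ α ≤ (m₀ : ℝ) ^ α := Real.rpow_le_rpow hnpos.le hnm' hα.le
    refine (hcrude n l (hl.trans ?_)).trans (ENNReal.ofReal_le_ofReal (Real.exp_le_exp.2 ?_))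
    · calc κ * a * (n : ℝ) ^ α ≤ κ * a * (m₀ : ℝ) ^ α := by gcongr
        _ = κ₀ * a := by
          rw [hκ]
          field_simp
    · have h1 : (n : ℝ) * V₀ ≤ V * (n : ℝ) ^ (-α) := by
        rw [Real.rpow_neg hnpos.le, ← div_eq_mul_inv, le_div_iff₀ (by positivity)]
        calc (n : ℝ) * V₀ * (n : ℝ) ^ α ≤ m₀ * V₀ * (m₀ : ℝ) ^ α := by gcongr
          _ ≤ V := by
            have : 0 < V₀ / c := by positivity
            linarith
      have h2 := mul_le_mul_of_nonneg_right h1 (by positivity : 0 ≤ l ^ 2 / a)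
      calc (n : ℝ) * (V₀ * l ^ 2 / a) = (n : ℝ) * V₀ * (l ^ 2 / a) := by ring
        _ ≤ _ := h2
        _ = _ := by ring
  intro n hn
  rcases le_or_gt n m₀ with hnm | hnm
  · exact hsmall n hn hnm
  · obtain ⟨d, rfl⟩ := Nat.exists_eq_add_of_le hnm.le
    clear hnm hn
    induction d with
    | zero => exact hsmall m₀ (by omega) le_rfl
    | succ d ih =>
      intro l hl
      set n := m₀ + d with hn
      have hnn : m₀ + (d + 1) = n + 1 := by omega
      rw [hnn] at hl ⊢
      have hnpos : (0 : ℝ) < n := by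
        have : 0 < n := by omega
        exact_mod_cast this
      set x := ((n + 1 : ℕ) : ℝ) ^ α with hx
      have hxpos : 0 < x := by positivity
      have hηx : ((n + 1 : ℕ) : ℝ) ^ (-α) = x⁻¹ := Real.rpow_neg (by positivity) α
      obtain ⟨hx0, hx1⟩ := hcη n
      have key := hn₀ n (by omega)
      refine (hstep n l (hl.trans ?_)).trans ?_
      · gcongr
      · refine (mul_le_mul_right (ih _ ?_) _).trans ?_
        · rw [abs_mul, abs_of_nonneg hx0]
          calc |l| * (1 - c * ((n + 1 : ℕ) : ℝ) ^ (-α))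
              ≤ κ * a * x * (1 - c * ((n + 1 : ℕ) : ℝ) ^ (-α)) := by gcongr
            _ = κ * a * ((1 - c * ((n + 1 : ℕ) : ℝ) ^ (-α)) * x) := by ring
            _ ≤ _ := by gcongr
        · rw [← ENNReal.ofReal_mul (Real.exp_pos _).le, ← Real.exp_add]
          refine ENNReal.ofReal_le_ofReal (Real.exp_le_exp.2 ?_)
          set η := ((n + 1 : ℕ) : ℝ) ^ (-α) with hη
          have hη0 : 0 ≤ η := by positivity
          have k1 : (1 - c * η) * (n : ℝ) ^ (-α) ≤ η := by
            rw [Real.rpow_neg hnpos.le, ← div_eq_mul_inv, div_le_iff₀ (by positivity), hηx,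
              inv_mul_eq_div, le_div_iff₀ hxpos, ← hηx]
            exact key
          have k2 : V₀ ≤ c * V := by
            have : c * (V₀ / c) = V₀ := by field_simp
            have h0 : 0 ≤ c * (m₀ * V₀ * (m₀ : ℝ) ^ α) := by positivity
            rw [hV, mul_add, this]
            linarith
          -- One contraction factor turns `n ^ (-α)` into at most `η`, by `k1`; the other loses `c *
          -- V * η ^ 2`, which pays for the new variance `V₀ * η ^ 2`.
          have k3 : V₀ * η ^ 2 + V * ((1 - c * η) * ((1 - c * η) * (n : ℝ) ^ (-α))) ≤ V * η := by
            have a1 := mul_le_mul_of_nonneg_left k1 hx0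
            have a2 := mul_le_mul_of_nonneg_left a1 hV0.le
            have a3 := mul_le_mul_of_nonneg_right k2 (sq_nonneg η)
            linarith
          have k4 := mul_le_mul_of_nonneg_right k3 (by positivity : 0 ≤ l ^ 2 / a)
          calc _ = (V₀ * η ^ 2 + V * ((1 - c * η) * ((1 - c * η) * (n : ℝ) ^ (-α))))
                * (l ^ 2 / a) := by ring
            _ ≤ _ := k4
            _ = _ := by ring

end FilteredNoise

/-- The process `u` is the noise `ξ` passed through the linear filter with contraction factors
`1 - c n ^ (-α)`, and `ξ` has conditional exponential moments as for a sample of size `a`. -/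
structure IsFilteredNoise {Ω : Type*} [MeasurableSpace Ω] (P : Measure Ω) (c α κ₀ V₀ a : ℝ)
    (u ξ : ℕ → Ω → ℝ) : Prop where
  measurable : ∀ n, Measurable (u n)
  zero : ∀ ω, u 0 ω = 0
  succ : ∀ n ω, u (n + 1) ω = (1 - c * ((n + 1 : ℕ) : ℝ) ^ (-α)) * u n ω
    + ((n + 1 : ℕ) : ℝ) ^ (-α) * ξ n ω
  mgf_le : ∀ n l l', |l| ≤ κ₀ * a →
    ∫⁻ ω, ENNReal.ofReal (Real.exp (l' * u n ω + l * ξ n ω)) ∂P ≤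
      ENNReal.ofReal (Real.exp (V₀ * l ^ 2 / a)) *
        ∫⁻ ω, ENNReal.ofReal (Real.exp (l' * u n ω)) ∂P

/-- A consequence of `2 cosh x ≥ 2 + x ^ 2`; the proof truncates the series for `exp` at an order
depending on the range of `x`. It bounds a second moment by two exponential moments. -/
theorem sq_le_exp_add_exp_neg (x : ℝ) : x ^ 2 ≤ Real.exp x + Real.exp (-x) := by
  have key : ∀ y : ℝ, 0 ≤ y → y ^ 2 ≤ Real.exp y + Real.exp (-y) := fun y hy => by
    have h1 := Real.quadratic_le_exp_of_nonneg hy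
    have h2 := Real.one_sub_le_exp_neg y
    have h3 := Real.pow_div_factorial_le_exp y hy 3
    rcases le_or_gt y 2 with hy2 | hy2
    · nlinarith
    · rcases le_or_gt y 6 with hy6 | hy6
      · have h4 := Real.sum_le_exp_of_nonneg hy 5
        simp [Finset.sum_range_succ, Nat.factorial] at h4
        have : 0 < Real.exp (-y) := Real.exp_pos _
        have hy3 : 2 * y ^ 2 ≤ y ^ 3 := by nlinarith [sq_nonneg y]
        have hy4 : 2 * y ^ 3 ≤ y ^ 4 := by nlinarith [pow_pos (lt_trans two_pos hy2) 3]
        nlinarith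
      · have : 0 < Real.exp (-y) := Real.exp_pos _
        have hy3 : 6 * y ^ 2 ≤ y ^ 3 := by nlinarith [sq_nonneg y]
        simp [Nat.factorial] at h3
        linarith
  rcases le_total 0 x with hx | hx
  · exact key x hx
  · have := key (-x) (by linarith)
    rw [neg_neg, neg_sq] at this
    linarith

/-- Two choices of `l`: of order `√a` for a variance of order `1 / a` uniform in time, and of order
`a * n ^ α` for tails that are summable over `n` and so bound the supremum over all windows. -/
theorem exists_filtered_noise_bound {c α κ₀ V₀ : ℝ} (hc : 0 < c) (hc1 : c ≤ 1) (hα : 0 < α)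
    (hα1 : α < 1) (hκ₀ : 0 < κ₀) (hV₀ : 0 < V₀) :
    (∃ D : ℝ, 0 < D ∧ ∀ {Ω : Type*} [MeasurableSpace Ω] (P : Measure Ω)
      [IsProbabilityMeasure P] (u ξ : ℕ → Ω → ℝ) (a : ℝ), 1 ≤ a →
      IsFilteredNoise P c α κ₀ V₀ a u ξ →
      ∀ n, ∫⁻ ω, ENNReal.ofReal (u n ω ^ 2) ∂P ≤ ENNReal.ofReal (D / a)) ∧
    ∀ x : ℝ, 0 < x → ∀ ε : ENNReal, 0 < ε → ∃ a₀ : ℝ, 0 < a₀ ∧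
      ∀ {Ω : Type*} [MeasurableSpace Ω] (P : Measure Ω)
      [IsProbabilityMeasure P] (u ξ : ℕ → Ω → ℝ) (a : ℝ), a₀ ≤ a →
      IsFilteredNoise P c α κ₀ V₀ a u ξ → P {ω | ∃ n, x < |u n ω|} ≤ ε := by
  constructor
  · obtain ⟨κ, V, hκ, hV, hmain⟩ := exists_filtered_noise_mgf hc hc1 hα hα1 hκ₀ hV₀
    refine ⟨2 * Real.exp (V * κ ^ 2) / κ ^ 2, by positivity, ?_⟩
    intro Ω _ P _ u ξ a ha h n
    have ha0 : 0 < a := by linarith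
    rcases Nat.eq_zero_or_pos n with rfl | hn
    · simp [h.zero]
    · have hm := hmain P u ξ a ha0 h.zero h.succ h.mgf_le n hn
      have hnα : (1 : ℝ) ≤ (n : ℝ) ^ α := Real.one_le_rpow (by exact_mod_cast hn) hα.le
      set l := κ * Real.sqrt a with hl
      have hl2 : l ^ 2 = κ ^ 2 * a := by rw [hl, mul_pow, Real.sq_sqrt ha0.le]
      have hl0 : 0 ≤ l := by positivity
      have hll : l ≤ κ * a * (n : ℝ) ^ α := by
        have h1 : Real.sqrt a ≤ a := by
          rw [Real.sqrt_le_left ha0.le]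
          nlinarith
        calc l ≤ κ * a := mul_le_mul_of_nonneg_left h1 hκ.le
          _ ≤ _ := le_mul_of_one_le_right (by positivity) hnα
      have hexp : V * l ^ 2 * (n : ℝ) ^ (-α) / a ≤ V * κ ^ 2 := by
        rw [hl2]
        have : V * (κ ^ 2 * a) * (n : ℝ) ^ (-α) / a = V * κ ^ 2 * (n : ℝ) ^ (-α) := by field_simp
        rw [this]
        exact mul_le_of_le_one_right (by positivity) (stepSize_le_one hα.le hn)
      have e1 := (hm l (by rwa [abs_of_nonneg hl0])).trans
        (ENNReal.ofReal_le_ofReal (Real.exp_le_exp.2 hexp))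
      have hexp' : V * (-l) ^ 2 * (n : ℝ) ^ (-α) / a ≤ V * κ ^ 2 := by rwa [neg_sq]
      have e2 := (hm (-l) (by rwa [abs_neg, abs_of_nonneg hl0])).trans
        (ENNReal.ofReal_le_ofReal (Real.exp_le_exp.2 hexp'))
      have hum := h.measurable n
      calc ∫⁻ ω, ENNReal.ofReal (u n ω ^ 2) ∂P
          ≤ ∫⁻ ω, ENNReal.ofReal (1 / (κ ^ 2 * a)) * (ENNReal.ofReal (Real.exp (l * u n ω)) +
              ENNReal.ofReal (Real.exp (-l * u n ω))) ∂P := by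
            refine lintegral_mono fun ω => ?_
            rw [← ENNReal.ofReal_add (Real.exp_pos _).le (Real.exp_pos _).le,
              ← ENNReal.ofReal_mul (by positivity)]
            refine ENNReal.ofReal_le_ofReal ?_
            rw [one_div, ← div_eq_inv_mul, le_div_iff₀ (by positivity), ← hl2, neg_mul, mul_comm,
              ← mul_pow]
            exact sq_le_exp_add_exp_neg _
        _ = ENNReal.ofReal (1 / (κ ^ 2 * a)) * (∫⁻ ω, ENNReal.ofReal (Real.exp (l * u n ω)) ∂P +
              ∫⁻ ω, ENNReal.ofReal (Real.exp (-l * u n ω)) ∂P) := by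
            rw [lintegral_const_mul _ (by fun_prop), lintegral_add_left (by fun_prop)]
        _ ≤ ENNReal.ofReal (1 / (κ ^ 2 * a)) * (ENNReal.ofReal (Real.exp (V * κ ^ 2)) +
              ENNReal.ofReal (Real.exp (V * κ ^ 2))) := by gcongr
        _ = _ := by
            rw [← ENNReal.ofReal_add (Real.exp_pos _).le (Real.exp_pos _).le,
              ← ENNReal.ofReal_mul (by positivity)]
            congr 1
            field_simp
            ring
  · intro x hx ε hε
    obtain ⟨κ, V, hκ, hV, hmain⟩ := exists_filtered_noise_mgf hc hc1 hα hα1 hκ₀ hV₀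
    -- With `κ' ≤ x / (2 * V)` the quadratic term is at most half of the linear term `l * x`.
    set κ' := min κ (x / (2 * V)) with hκ'
    have hκ'0 : 0 < κ' := lt_min hκ (by positivity)
    have hκ'V : V * κ' ≤ x / 2 := by
      have := min_le_right κ (x / (2 * V))
      calc V * κ' ≤ V * (x / (2 * V)) := by gcongr
        _ = x / 2 := by field_simp
    obtain ⟨a₀, ha₀, hA⟩ := exists_tsum_exp_le (α := α) (s := κ' * x / 2) hα (by positivity)
      (ENNReal.half_pos hε.ne')
    refine ⟨a₀, ha₀, ?_⟩
    intro Ω _ P _ u ξ a haa h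
    have ha : 0 < a := ha₀.trans_le haa
    have htail : ∀ n : ℕ, P {ω | x < |u (n + 1) ω|} ≤
        2 * ENNReal.ofReal (Real.exp (-(κ' * x / 2 * a * ((n + 1 : ℕ) : ℝ) ^ α))) := by
      intro n
      set y := ((n + 1 : ℕ) : ℝ) ^ α with hy
      have hy0 : 0 < y := by positivity
      have hm := hmain P u ξ a ha h.zero h.succ h.mgf_le (n + 1) (Nat.le_add_left 1 n)
      set l := κ' * a * y with hl
      have hl0 : 0 < l := by positivity
      have hll : l ≤ κ * a * y := by
        have := min_le_left κ (x / (2 * V))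
        exact mul_le_mul_of_nonneg_right (mul_le_mul_of_nonneg_right this ha.le) hy0.le
      have hexp : V * l ^ 2 * ((n + 1 : ℕ) : ℝ) ^ (-α) / a - l * x ≤ -(κ' * x / 2 * a * y) := by
        have e : V * l ^ 2 * ((n + 1 : ℕ) : ℝ) ^ (-α) / a = (V * κ') * (κ' * a * y) := by
          rw [Real.rpow_neg (by positivity), ← hy, hl]
          field_simp
        have := mul_le_mul_of_nonneg_right hκ'V (by positivity : 0 ≤ κ' * a * y)
        rw [e, hl]
        linarith
      have hum := h.measurable (n + 1)
      have e1 := measure_ge_le_exp (P := P) (l * x) (hm l (by rwa [abs_of_pos hl0]))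
        (by fun_prop)
      have e2 := measure_ge_le_exp (P := P) (l * x) (hm (-l) (by rwa [abs_neg, abs_of_pos hl0]))
        (by fun_prop)
      rw [neg_sq] at e2
      have hsub : {ω | x < |u (n + 1) ω|} ⊆ {ω | l * x ≤ l * u (n + 1) ω} ∪
          {ω | l * x ≤ -l * u (n + 1) ω} := by
        intro ω hω
        rcases lt_abs.1 (show x < |u (n + 1) ω| from hω) with h1 | h1
        · left
          exact mul_le_mul_of_nonneg_left h1.le hl0.le
        · right
          show l * x ≤ -l * u (n + 1) ω
          rw [neg_mul_comm]
          exact mul_le_mul_of_nonneg_left h1.le hl0.le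
      refine (measure_mono hsub).trans ((measure_union_le _ _).trans ?_)
      rw [two_mul]
      exact add_le_add (e1.trans (ENNReal.ofReal_le_ofReal (Real.exp_le_exp.2 hexp)))
        (e2.trans (ENNReal.ofReal_le_ofReal (Real.exp_le_exp.2 hexp)))
    have hsub : {ω | ∃ n, x < |u n ω|} ⊆ ⋃ n : ℕ, {ω | x < |u (n + 1) ω|} := by
      rintro ω ⟨n, hn⟩
      rcases n with _ | n
      · rw [h.zero, abs_zero] at hn
        exact absurd hn (not_lt.2 hx.le)
      · exact Set.mem_iUnion.2 ⟨n, hn⟩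
    refine (measure_mono hsub).trans ((measure_iUnion_le _).trans ?_)
    refine (ENNReal.tsum_le_tsum htail).trans ?_
    rw [ENNReal.tsum_mul_left]
    refine (mul_le_mul_right (hA a haa) _).trans ?_
    rw [ENNReal.mul_div_cancel (by norm_num) (by norm_num)]

/-! ### Calculus of gradients, and the time windows. -/

section Gradient

variable {E : Type*} [NormedAddCommGroup E] [InnerProductSpace ℝ E] [CompleteSpace E]

theorem hasGradientAt_sum {ι : Type*} (s : Finset ι) {f : ι → E → ℝ} {g : ι → E} {x : E}
    (h : ∀ i ∈ s, HasGradientAt (f i) (g i) x) :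
    HasGradientAt (fun y => ∑ i ∈ s, f i y) (∑ i ∈ s, g i) x := by
  rw [hasGradientAt_iff_hasFDerivAt, map_sum]
  exact HasFDerivAt.fun_sum fun i hi => (h i hi).hasFDerivAt

theorem hasGradientAt_sub {f f' : E → ℝ} {g g' : E} {x : E} (h : HasGradientAt f g x)
    (h' : HasGradientAt f' g' x) : HasGradientAt (fun y => f y - f' y) (g - g') x := by
  rw [hasGradientAt_iff_hasFDerivAt, map_sub]
  exact h.hasFDerivAt.sub h'.hasFDerivAt

theorem hasGradientAt_const_mul {f : E → ℝ} {g : E} {x : E} (a : ℝ) (h : HasGradientAt f g x) :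
    HasGradientAt (fun y => a * f y) (a • g) x := by
  rw [hasGradientAt_iff_hasFDerivAt, map_smul]
  exact h.hasFDerivAt.const_mul a

end Gradient

section Window

theorem measurableSet_window (dT : ℝ) (n : ℕ) : MeasurableSet (window dT n) := measurableSet_Ioc

theorem window_subset {dT : ℝ} (hdT : 0 < dT) (n : ℕ) : window dT (n + 1) ⊆ Set.Ici 0 := by
  intro t ht
  have h1 : (((n + 1 : ℕ) : ℝ) - 1) * dT < t := ht.1
  have : 0 ≤ (((n + 1 : ℕ) : ℝ) - 1) * dT := by
    push_cast
    rw [add_sub_cancel_right]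
    positivity
  exact this.trans h1.le

theorem isBounded_window (dT : ℝ) (n : ℕ) : Bornology.IsBounded (window dT n) :=
  Metric.isBounded_Ioc _ _

theorem volume_real_window {dT : ℝ} (hdT : 0 < dT) (n : ℕ) :
    volume.real (window dT n) = dT := by
  rw [window, Real.volume_real_Ioc, max_eq_left] <;> linarith

theorem disjoint_past_window (dT : ℝ) (n : ℕ) :
    Disjoint (Set.Ioc 0 (n * dT)) (window dT (n + 1)) := by
  refine Set.disjoint_left.2 fun t h1 h2 => ?_
  have h3 : (((n + 1 : ℕ) : ℝ) - 1) * dT < t := h2.1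
  push_cast at h3
  rw [add_sub_cancel_right] at h3
  exact absurd h1.2 (not_le.2 h3)

theorem window_subset_past {dT : ℝ} (hdT : 0 < dT) (n : ℕ) :
    window dT (n + 1) ⊆ Set.Ioc 0 (((n + 1 : ℕ) : ℝ) * dT) := by
  intro t ht
  have h1 : (((n + 1 : ℕ) : ℝ) - 1) * dT < t := ht.1
  have : 0 ≤ (((n + 1 : ℕ) : ℝ) - 1) * dT := by
    push_cast
    rw [add_sub_cancel_right]
    positivity
  exact ⟨this.trans_lt h1, ht.2⟩

end Window

/-! ### The likelihood of one window, its gradient and its size. -/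

section BlockLikelihood

variable {K p m : ℕ}

/-- The edges that start or end at node `i`. -/
def incident (A : Finset (Fin m × Fin m)) (i : Fin m) : Finset (Fin m × Fin m) :=
  A.filter fun e => e.1 = i ∨ e.2 = i

/-- The log-likelihood given the labels `z` of the event times `ν` in the set `I`. -/
noncomputable def blockLik (lam : BlockIntensity K p) (A : Finset (Fin m × Fin m))
    (ν : Fin m × Fin m → Measure ℝ) (I : Set ℝ) (θ : Param p) (z : Fin m → Fin K) : ℝ :=
  ∑ e ∈ A, ((∫ t, Real.log (lam (z e.1) (z e.2) t θ) ∂(ν e))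
    - ∫ t in I, lam (z e.1) (z e.2) t θ)

/-- The gradient of `blockLik` in the parameter. -/
noncomputable def blockGrad (lam : BlockIntensity K p) (A : Finset (Fin m × Fin m))
    (ν : Fin m × Fin m → Measure ℝ) (I : Set ℝ) (θ : Param p) (z : Fin m → Fin K) : Param p :=
  ∑ e ∈ A, ((∫ t, gradFam (fun s ϑ => Real.log (lam (z e.1) (z e.2) s ϑ)) t θ ∂(ν e))
    - ∫ t in I, gradFam (lam (z e.1) (z e.2)) t θ)

/-- The number of events plus the observed time, summed over the edges. -/
noncomputable def blockMass (A : Finset (Fin m × Fin m)) (ν : Fin m × Fin m → Measure ℝ)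
    (I : Set ℝ) : ℝ :=
  ∑ e ∈ A, ((ν e).real Set.univ + volume.real I)

theorem blockMass_nonneg (A : Finset (Fin m × Fin m)) (ν : Fin m × Fin m → Measure ℝ)
    (I : Set ℝ) : 0 ≤ blockMass A ν I :=
  Finset.sum_nonneg fun _ _ => add_nonneg measureReal_nonneg measureReal_nonneg

/-- Edges away from `i` cancel, so the evidence of one node is governed by its degree and not by
`|A|`. -/
theorem blockLik_sub_eq_incident (lam : BlockIntensity K p) (A : Finset (Fin m × Fin m))
    (ν : Fin m × Fin m → Measure ℝ) (I : Set ℝ) (θ : Param p) {z z' : Fin m → Fin K} {i : Fin m}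
    (h : ∀ j, j ≠ i → z j = z' j) :
    blockLik lam A ν I θ z - blockLik lam A ν I θ z' =
      blockLik lam (incident A i) ν I θ z - blockLik lam (incident A i) ν I θ z' := by
  unfold blockLik incident
  rw [← Finset.sum_sub_distrib, ← Finset.sum_sub_distrib, Finset.sum_filter_of_ne]
  intro e _ hne
  by_contra hcon
  push Not at hcon
  rw [h _ hcon.1, h _ hcon.2, sub_self] at hne
  exact hne rfl

variable {lam : BlockIntensity K p} {Θ : Set (Param p)} {C : ℝ} {A : Finset (Fin m × Fin m)}
  {ν : Fin m × Fin m → Measure ℝ} {I : Set ℝ}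

theorem isFiniteMeasure_restrict_of_isBounded (hIb : Bornology.IsBounded I) :
    IsFiniteMeasure (volume.restrict I) :=
  ⟨by simpa using hIb.measure_lt_top⟩

theorem ae_restrict_nonneg (hI : MeasurableSet I) (hI0 : I ⊆ Set.Ici 0) (μ : Measure ℝ) :
    ∀ᵐ t ∂(μ.restrict I), 0 ≤ t :=
  (ae_restrict_iff' hI).2 (Eventually.of_forall fun _ ht => hI0 ht)

theorem Bounded.hasGradientAt_blockLik (h : Bounded lam Θ C) (hΘ : IsOpen Θ)
    (hν : ∀ e ∈ A, IsFiniteMeasure (ν e)) (hν0 : ∀ e ∈ A, ∀ᵐ t ∂(ν e), 0 ≤ t)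
    (hI : MeasurableSet I) (hI0 : I ⊆ Set.Ici 0) (hIb : Bornology.IsBounded I)
    {θ : Param p} (hθ : θ ∈ Θ) (z : Fin m → Fin K) :
    HasGradientAt (fun ϑ => blockLik lam A ν I ϑ z) (blockGrad lam A ν I θ z) θ := by
  refine hasGradientAt_sum A fun e he => hasGradientAt_sub ?_ ?_
  · have := hν e he
    exact (h.smoothFamily_log _ _).hasGradientAt_integral' hΘ (hν0 e he) hθ
  · have := isFiniteMeasure_restrict_of_isBounded hIb
    exact (h.smoothFamily _ _).hasGradientAt_integral' hΘ (ae_restrict_nonneg hI hI0 _) hθ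

theorem Bounded.norm_blockGrad_le (h : Bounded lam Θ C)
    (hν : ∀ e ∈ A, IsFiniteMeasure (ν e)) (hIb : Bornology.IsBounded I)
    {θ : Param p} (hθ : θ ∈ Θ) (z : Fin m → Fin K) :
    ‖blockGrad lam A ν I θ z‖ ≤ C * blockMass A ν I := by
  unfold blockGrad blockMass
  rw [Finset.mul_sum]
  refine norm_sum_le_of_le _ fun e he => (norm_sub_le _ _).trans ?_
  have := hν e he
  have := isFiniteMeasure_restrict_of_isBounded hIb
  rw [mul_add]
  refine add_le_add ((h.smoothFamily_log _ _).norm_integral_gradFam_le hθ) ?_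
  simpa [Measure.real] using
    (h.smoothFamily (z e.1) (z e.2)).norm_integral_gradFam_le (ν := volume.restrict I) hθ

theorem Bounded.abs_blockLik_le (h : Bounded lam Θ C)
    (hν : ∀ e ∈ A, IsFiniteMeasure (ν e)) (hν0 : ∀ e ∈ A, ∀ᵐ t ∂(ν e), 0 ≤ t)
    (hI : MeasurableSet I) (hI0 : I ⊆ Set.Ici 0) (hIb : Bornology.IsBounded I)
    {θ : Param p} (hθ : θ ∈ Θ) (z : Fin m → Fin K) :
    |blockLik lam A ν I θ z| ≤ C * blockMass A ν I := by
  unfold blockLik blockMass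
  rw [Finset.mul_sum]
  refine (Finset.abs_sum_le_sum_abs _ _).trans (Finset.sum_le_sum fun e he => ?_)
  refine (norm_sub_le (E := ℝ) _ _).trans ?_
  have := hν e he
  have := isFiniteMeasure_restrict_of_isBounded hIb
  rw [mul_add]
  refine add_le_add ((h.smoothFamily_log _ _).abs_integral_le (hν0 e he) hθ) ?_
  simpa [Measure.real] using
    (h.smoothFamily (z e.1) (z e.2)).abs_integral_le (ν := volume.restrict I)
      (ae_restrict_nonneg hI hI0 _) hθ

theorem SmoothFamily.abs_integral_sub_le {F : ℝ → Param p → ℝ} (h : SmoothFamily F Θ C)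
    (hΘ : IsOpen Θ) {s : Set (Param p)} (hs : Convex ℝ s) (hsΘ : s ⊆ Θ) {μ : Measure ℝ}
    [IsFiniteMeasure μ] (hμ : ∀ᵐ t ∂μ, 0 ≤ t) {θ θ' : Param p} (hθ : θ ∈ s) (hθ' : θ' ∈ s) :
    |∫ t, F t θ ∂μ - ∫ t, F t θ' ∂μ| ≤ C * ‖θ - θ'‖ * μ.real Set.univ := by
  rw [← integral_sub (h.integrable hμ (hsΘ hθ)) (h.integrable hμ (hsΘ hθ'))]
  exact norm_integral_le_of_norm_le_const (f := fun t => F t θ - F t θ')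
    (hμ.mono fun t ht => h.abs_sub_le hΘ hs hsΘ ht hθ hθ')

theorem Bounded.abs_blockLik_sub_le (h : Bounded lam Θ C) (hΘ : IsOpen Θ)
    (hν : ∀ e ∈ A, IsFiniteMeasure (ν e)) (hν0 : ∀ e ∈ A, ∀ᵐ t ∂(ν e), 0 ≤ t)
    (hI : MeasurableSet I) (hI0 : I ⊆ Set.Ici 0) (hIb : Bornology.IsBounded I)
    {s : Set (Param p)} (hs : Convex ℝ s) (hsΘ : s ⊆ Θ)
    {θ θ' : Param p} (hθ : θ ∈ s) (hθ' : θ' ∈ s) (z : Fin m → Fin K) :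
    |blockLik lam A ν I θ z - blockLik lam A ν I θ' z| ≤
      C * ‖θ - θ'‖ * blockMass A ν I := by
  unfold blockLik blockMass
  rw [Finset.mul_sum, ← Finset.sum_sub_distrib]
  refine (Finset.abs_sum_le_sum_abs _ _).trans (Finset.sum_le_sum fun e he => ?_)
  rw [sub_sub_sub_comm]
  refine (norm_sub_le (E := ℝ) _ _).trans ?_
  have := hν e he
  have := isFiniteMeasure_restrict_of_isBounded hIb
  rw [mul_add]
  refine add_le_add ((h.smoothFamily_log _ _).abs_integral_sub_le hΘ hs hsΘ (hν0 e he) hθ hθ') ?_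
  simpa [Measure.real] using
    (h.smoothFamily (z e.1) (z e.2)).abs_integral_sub_le hΘ hs hsΘ (μ := volume.restrict I)
      (ae_restrict_nonneg hI hI0 _) hθ hθ'

/-- A neighbour accounts for at most one edge in each direction. -/
theorem card_incident_le (A : Finset (Fin m × Fin m)) (i : Fin m) :
    (incident A i).card ≤ 2 * nodeDegree A i := by
  classical
  set D := Finset.univ.filter fun j => (i, j) ∈ A ∨ (j, i) ∈ A with hD
  have hsub : incident A i ⊆ D.image (fun j => (i, j)) ∪ D.image (fun j => (j, i)) := by
    rintro ⟨a, b⟩ he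
    obtain ⟨hA, h1⟩ := Finset.mem_filter.1 he
    rw [Finset.mem_union, Finset.mem_image, Finset.mem_image]
    rcases h1 with h1 | h1
    · simp only at h1
      subst h1
      exact Or.inl ⟨b, by simp [hD, hA], rfl⟩
    · simp only at h1
      subst h1
      exact Or.inr ⟨a, by simp [hD, hA], rfl⟩
  calc (incident A i).card ≤ _ := Finset.card_le_card hsub
    _ ≤ _ := Finset.card_union_le _ _
    _ ≤ D.card + D.card := add_le_add Finset.card_image_le Finset.card_image_le
    _ = 2 * nodeDegree A i := by
      rw [two_mul]
      rfl

/-- Choosing one edge per neighbour is injective. Together with the degree condition this makes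
`|A|` at least of order `m ^ rd`. -/
theorem nodeDegree_le_card (A : Finset (Fin m × Fin m)) (i : Fin m) :
    nodeDegree A i ≤ A.card := by
  classical
  unfold nodeDegree
  refine Finset.card_le_card_of_injOn (fun j => if (i, j) ∈ A then (i, j) else (j, i)) ?_ ?_
  · intro j hj
    have h1 : (i, j) ∈ A ∨ (j, i) ∈ A := by simpa using hj
    simp only
    split_ifs with h
    · exact h
    · exact h1.resolve_left h
  · intro j hj j' hj' heq
    simp only at heq
    split_ifs at heq with h1 h2 h2 <;> simp only [Prod.mk.injEq] at heq
    · exact heq.2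
    · rw [heq.2, heq.1]
    · rw [heq.1, heq.2]
    · exact heq.1

theorem card_le_sq (A : Finset (Fin m × Fin m)) : A.card ≤ m ^ 2 := by
  have := Finset.card_le_univ A
  rw [Fintype.card_prod, Fintype.card_fin] at this
  linarith [sq m]

end BlockLikelihood

/-! ### The algorithm with retracted parameters. -/

section ClampedRun

variable {K p m : ℕ}

/-- The window log-likelihood with the parameter retracted onto a closed ball. -/
noncomputable def clampLik (lam : BlockIntensity K p) (dT : ℝ) (A : Finset (Fin m × Fin m))
    (θs : Param p) (ρ : ℝ) (D : Fin m × Fin m → Measure ℝ) (n : ℕ) (θ : Param p)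
    (z : Fin m → Fin K) : ℝ :=
  blockLik lam A (fun e => winData (window dT n) (D e)) (window dT n) (clamp θs ρ θ) z

/-- The gradient of the window log-likelihood at the parameter retracted onto a closed ball. -/
noncomputable def clampGrad (lam : BlockIntensity K p) (dT : ℝ) (A : Finset (Fin m × Fin m))
    (θs : Param p) (ρ : ℝ) (D : Fin m × Fin m → Measure ℝ) (n : ℕ) (θ : Param p)
    (z : Fin m → Fin K) : Param p :=
  blockGrad lam A (fun e => winData (window dT n) (D e)) (window dT n) (clamp θs ρ θ) z

/-- One step of the algorithm with prescribed log-likelihood `L` and gradient `G`. -/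
noncomputable def gradStep (L : Param p → (Fin m → Fin K) → ℝ)
    (G : Param p → (Fin m → Fin K) → Param p) (a η : ℝ) (s : State K p m) : State K p m where
  θ := s.θ + η • ((1 / a) • ∑ z : Fin m → Fin K, (∏ i, newQ L s i (z i)) • G s.θ z)
  q := newQ L s
  S := fun i k => s.S i k * evidence L s i k
  π := fun k => (1 / (m : ℝ)) * ∑ i, newQ L s i k

/-- The algorithm with the likelihood evaluated at retracted parameters. -/
noncomputable def clampRun (lam : BlockIntensity K p) (dT : ℝ) (A : Finset (Fin m × Fin m))
    (θs : Param p) (ρ : ℝ) (D : Fin m × Fin m → Measure ℝ) (η : ℕ → ℝ)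
    (θ₀ : Param p) (q₀ : Fin m → Fin K → ℝ) (π₀ : Fin K → ℝ) : ℕ → State K p m
  | 0 => { θ := θ₀, q := q₀, S := fun _ _ => 1 / (K : ℝ), π := π₀ }
  | n + 1 => gradStep (clampLik lam dT A θs ρ D (n + 1)) (clampGrad lam dT A θs ρ D (n + 1))
      (A.card : ℝ) (η (n + 1)) (clampRun lam dT A θs ρ D η θ₀ q₀ π₀ n)

theorem evidence_congr {L L' : Param p → (Fin m → Fin K) → ℝ} {s : State K p m}
    (h : L s.θ = L' s.θ) : evidence L s = evidence L' s := by
  unfold evidence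
  rw [h]

theorem newQ_congr {L L' : Param p → (Fin m → Fin K) → ℝ} {s : State K p m}
    (h : L s.θ = L' s.θ) : newQ L s = newQ L' s := by
  unfold newQ
  rw [evidence_congr h]

variable {lam : BlockIntensity K p} {Θ : Set (Param p)} {C : ℝ} {A : Finset (Fin m × Fin m)}
  {dT ρ : ℝ} {θs : Param p} {D : Fin m × Fin m → Measure ℝ}

theorem Bounded.hasGradientAt_mfExp_windowLogLik (h : Bounded lam Θ C) (hΘ : IsOpen Θ)
    (hdT : 0 < dT) (n : ℕ) (hD : ∀ e ∈ A, D e (window dT (n + 1)) < ⊤) {θ : Param p} (hθ : θ ∈ Θ)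
    (q : Fin m → Fin K → ℝ) :
    HasGradientAt (fun ϑ => mfExp q (windowLogLik lam dT A D (n + 1) ϑ))
      (∑ z : Fin m → Fin K, (∏ i, q i (z i)) • blockGrad lam A
        (fun e => (D e).restrict (window dT (n + 1))) (window dT (n + 1)) θ z) θ := by
  refine hasGradientAt_sum _ fun z _ => hasGradientAt_const_mul _ ?_
  exact h.hasGradientAt_blockLik hΘ (fun e he => ⟨by simpa using hD e he⟩)
    (fun e _ => ae_restrict_nonneg (measurableSet_window _ _) (window_subset hdT n) _)
    (measurableSet_window _ _) (window_subset hdT n) (isBounded_window _ _) hθ z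

/-- Inside the ball the retraction is the identity, and on finite data so is the truncation. The
confinement hypothesis speaks of `clampRun` only and can be verified without knowing anything about
`run`. -/
theorem Bounded.run_eq_clampRun (h : Bounded lam Θ C) (hΘ : IsOpen Θ)
    (hdT : 0 < dT) (hρ : 0 < ρ) (hball : Metric.closedBall θs ρ ⊆ Θ)
    (hD : ∀ e ∈ A, ∀ n : ℕ, D e (window dT (n + 1)) < ⊤) (η : ℕ → ℝ)
    (θ₀ : Param p) (q₀ : Fin m → Fin K → ℝ) (π₀ : Fin K → ℝ)
    (hin : ∀ n, ‖(clampRun lam dT A θs ρ D η θ₀ q₀ π₀ n).θ - θs‖ < ρ) (n : ℕ) :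
    run lam dT A D η θ₀ q₀ π₀ n = clampRun lam dT A θs ρ D η θ₀ q₀ π₀ n := by
  induction n with
  | zero => rfl
  | succ n ih =>
    rw [run, ih, clampRun]
    set s := clampRun lam dT A θs ρ D η θ₀ q₀ π₀ n with hs
    have hsρ : ‖s.θ - θs‖ ≤ ρ := (hin n).le
    have hsΘ : s.θ ∈ Θ := hball (mem_closedBall_iff_norm.2 hsρ)
    have hL : windowLogLik lam dT A D (n + 1) s.θ = clampLik lam dT A θs ρ D (n + 1) s.θ := by
      ext z
      unfold clampLik
      rw [clamp_eq hρ hsρ]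
      refine Finset.sum_congr rfl fun e he => ?_
      simp only [winData_eq (hD e he n)]
    have hG : ∀ z, blockGrad lam A (fun e => (D e).restrict (window dT (n + 1)))
        (window dT (n + 1)) s.θ z = clampGrad lam dT A θs ρ D (n + 1) s.θ z := by
      intro z
      unfold clampGrad
      rw [clamp_eq hρ hsρ]
      refine Finset.sum_congr rfl fun e he => ?_
      simp only [winData_eq (hD e he n)]
    unfold step gradStep
    rw [evidence_congr hL, newQ_congr hL,
      (h.hasGradientAt_mfExp_windowLogLik hΘ hdT n (fun e he => hD e he n) hsΘ _).gradient]
    simp_rw [hG]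

end ClampedRun

/-! ### Measurability of the random states. -/

section Measurability

variable {K p m : ℕ} {Ω : Type*} [MeasurableSpace Ω]

/-- Measurability of all components of a random state. -/
structure MeasurableState (s : Ω → State K p m) : Prop where
  θ : Measurable fun ω => (s ω).θ
  q : ∀ i k, Measurable fun ω => (s ω).q i k
  S : ∀ i k, Measurable fun ω => (s ω).S i k
  π : ∀ k, Measurable fun ω => (s ω).π k

/-- The joint measurability lemmas truncate the measure themselves, so data that are already
truncated pass through them unchanged. -/
theorem winData_winData {I : Set ℝ} (hI : MeasurableSet I) (ν : Measure ℝ) :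
    winData I (winData I ν) = winData I ν := by
  by_cases h : ν I < ⊤
  · rw [winData_eq h, winData_restrict hI subset_rfl, winData_eq h]
  · have : winData I ν = 0 := if_neg h
    rw [this, winData_eq (by simp)]
    simp

variable {lam : BlockIntensity K p} {Θ : Set (Param p)} {C : ℝ} {A : Finset (Fin m × Fin m)}
  {dT ρ : ℝ} {θs : Param p} {N : Fin m × Fin m → Ω → Measure ℝ}

theorem Bounded.measurable_clampLik (h : Bounded lam Θ C)
    (hdT : 0 < dT) (hρ : 0 < ρ) (hball : Metric.closedBall θs ρ ⊆ Θ) (n : ℕ)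
    (hN : ∀ e ∈ A, Measurable fun ω => winData (window dT (n + 1)) (N e ω))
    {X : Ω → Param p} (hX : Measurable X) (z : Fin m → Fin K) :
    Measurable fun ω => clampLik lam dT A θs ρ (fun e => N e ω) (n + 1) (X ω) z := by
  unfold clampLik blockLik
  refine Finset.measurable_sum _ fun e he => Measurable.sub ?_ ?_
  · have h1 := ((h.smoothFamily_log (z e.1) (z e.2)).measurable_integral_clamp hρ hball
      (measurableSet_window dT (n + 1)) (window_subset hdT n)).comp (hX.prodMk (hN e he))
    simpa [Function.comp_def, winData_winData (measurableSet_window dT (n + 1))] using h1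
  · have h1 := ((h.smoothFamily (z e.1) (z e.2)).measurable_integral_clamp hρ hball
      (measurableSet_window dT (n + 1)) (window_subset hdT n)).comp
      (hX.prodMk (measurable_const (a := volume)))
    simpa [Function.comp_def, winData_eq (isBounded_window dT (n + 1)).measure_lt_top] using h1

theorem Bounded.measurable_clampGrad (h : Bounded lam Θ C) (hΘ : IsOpen Θ)
    (hρ : 0 < ρ) (hball : Metric.closedBall θs ρ ⊆ Θ) (n : ℕ)
    (hN : ∀ e ∈ A, Measurable fun ω => winData (window dT (n + 1)) (N e ω))
    {X : Ω → Param p} (hX : Measurable X) (z : Fin m → Fin K) :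
    Measurable fun ω => clampGrad lam dT A θs ρ (fun e => N e ω) (n + 1) (X ω) z := by
  unfold clampGrad blockGrad
  refine Finset.measurable_sum _ fun e he => Measurable.sub ?_ ?_
  · have h1 := ((h.smoothFamily_log (z e.1) (z e.2)).measurable_integral_gradFam_clamp hΘ hρ hball
      (measurableSet_window dT (n + 1))).comp (hX.prodMk (hN e he))
    simpa [Function.comp_def, winData_winData (measurableSet_window dT (n + 1))] using h1
  · have h1 := ((h.smoothFamily (z e.1) (z e.2)).measurable_integral_gradFam_clamp hΘ hρ hball
      (measurableSet_window dT (n + 1))).comp (hX.prodMk (measurable_const (a := volume)))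
    simpa [Function.comp_def, winData_eq (isBounded_window dT (n + 1)).measure_lt_top] using h1

theorem MeasurableState.evidence {s : Ω → State K p m} (hs : MeasurableState s)
    {L : Ω → Param p → (Fin m → Fin K) → ℝ} (hL : ∀ z, Measurable fun ω => L ω (s ω).θ z)
    (i : Fin m) (k : Fin K) : Measurable fun ω => evidence (L ω) (s ω) i k := by
  unfold StreamNet.evidence mfExpAt
  exact Real.measurable_exp.comp (Finset.measurable_sum _ fun z _ =>
    (Finset.measurable_prod _ fun j _ => hs.q j (z j)).mul (hL z))

theorem MeasurableState.newQ {s : Ω → State K p m} (hs : MeasurableState s)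
    {L : Ω → Param p → (Fin m → Fin K) → ℝ} (hL : ∀ z, Measurable fun ω => L ω (s ω).θ z)
    (i : Fin m) (k : Fin K) : Measurable fun ω => newQ (L ω) (s ω) i k := by
  have h1 := hs.evidence hL
  have h2 := hs.S
  have h3 := hs.π
  unfold StreamNet.newQ
  fun_prop

theorem MeasurableState.gradStep {s : Ω → State K p m} (hs : MeasurableState s)
    {L : Ω → Param p → (Fin m → Fin K) → ℝ} (hL : ∀ z, Measurable fun ω => L ω (s ω).θ z)
    {G : Ω → Param p → (Fin m → Fin K) → Param p}
    (hG : ∀ z, Measurable fun ω => G ω (s ω).θ z) (a η : ℝ) :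
    MeasurableState fun ω => gradStep (L ω) (G ω) a η (s ω) := by
  have h1 := hs.evidence hL
  have h2 := hs.newQ hL
  have h3 := hs.S
  have h4 := hs.θ
  refine ⟨?_, h2, fun i k => (h3 i k).mul (h1 i k), fun k => ?_⟩
  · have h5 : Measurable fun ω => ∑ z : Fin m → Fin K,
        (∏ i, StreamNet.newQ (L ω) (s ω) i (z i)) • G ω (s ω).θ z :=
      Finset.measurable_sum _ fun z _ =>
        (Finset.measurable_prod _ fun i _ => h2 i (z i)).smul (hG z)
    exact h4.add ((h5.const_smul (1 / a)).const_smul η)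
  · exact (Finset.measurable_sum _ fun i _ => h2 i k).const_mul _

end Measurability

/-! ### The filtration of the past windows and the gradient noise. -/

/-- A Poisson network with fixed number of nodes, together with a closed ball of parameters inside
the domain on which the intensities are regular. -/
structure Network {K p m : ℕ} {Ω : Type*} [MeasurableSpace Ω] (lam : BlockIntensity K p)
    (Θ : Set (Param p)) (θs : Param p) (C dT ρ : ℝ) (A : Finset (Fin m × Fin m))
    (zs : Fin m → Fin K) (P : Measure Ω) (N : Fin m × Fin m → Ω → Measure ℝ) : Prop where
  isOpen : IsOpen Θ
  bdd : Bounded lam Θ C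
  C_pos : 0 < C
  dT_pos : 0 < dT
  ρ_pos : 0 < ρ
  ball : Metric.closedBall θs ρ ⊆ Θ
  poisson : ∀ e ∈ A, IsPoissonProcess P (N e) (fun t => lam (zs e.1) (zs e.2) t θs)
  indep : iIndepFun (fun e : {e // e ∈ A} => N e.1) P

/-- The centred gradient of the log-likelihood given the true labels, per edge, at the retracted
parameter. -/
noncomputable def gradNoise {K p m : ℕ} (lam : BlockIntensity K p) (dT : ℝ)
    (A : Finset (Fin m × Fin m)) (zs : Fin m → Fin K) (θs : Param p) (ρ : ℝ)
    (D : Fin m × Fin m → Measure ℝ) (n : ℕ) (θ : Param p) : Param p :=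
  (1 / (A.card : ℝ)) • ∑ e ∈ A,
    ((∫ t, gradFam (fun s ϑ => Real.log (lam (zs e.1) (zs e.2) s ϑ)) t (clamp θs ρ θ)
        ∂(winData (window dT n) (D e))) -
      ∫ t in window dT n, lam (zs e.1) (zs e.2) t θs •
        gradFam (fun s ϑ => Real.log (lam (zs e.1) (zs e.2) s ϑ)) t (clamp θs ρ θ))

/-- The linear filter `U (n + 1) = (1 - c η (n + 1)) U n + η (n + 1) ξ n`. -/
noncomputable def linFilter {p : ℕ} (c α : ℝ) (ξ : ℕ → Param p) : ℕ → Param p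
  | 0 => 0
  | n + 1 => (1 - c * ((n + 1 : ℕ) : ℝ) ^ (-α)) • linFilter c α ξ n
      + ((n + 1 : ℕ) : ℝ) ^ (-α) • ξ n

theorem measurable_proj {p : ℕ} (j : Fin p) : Measurable fun x : Param p => x j :=
  measurable_euclidean_iff.1 measurable_id j

/-- The measurable space on `Ω` is a named argument so that the σ-algebra of the past can take its
place. -/
theorem measurable_pair {p : ℕ} {Ω : Type*} [mΩ : MeasurableSpace Ω] {f : Ω → Param p}
    {g : Ω → ℝ} (hf : Measurable f) (hg : Measurable g) : Measurable fun ω => (f ω, g ω) :=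
  hf.prodMk hg

theorem measurable_smul_add_smul {p : ℕ} {Ω : Type*} [mΩ : MeasurableSpace Ω]
    {f g : Ω → Param p} (hf : Measurable f) (hg : Measurable g) (a b : ℝ) :
    Measurable fun ω => a • f ω + b • g ω :=
  (hf.const_smul a).add (hg.const_smul b)

theorem MeasurableState.mono {K p m : ℕ} {Ω : Type*} {m₁ m₂ : MeasurableSpace Ω} (hm : m₁ ≤ m₂)
    {s : Ω → State K p m} (hs : @MeasurableState K p m Ω m₁ s) :
    @MeasurableState K p m Ω m₂ s := by
  obtain ⟨h1, h2, h3, h4⟩ := hs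
  exact @MeasurableState.mk K p m Ω m₂ s (h1.mono hm le_rfl) (fun i k => (h2 i k).mono hm le_rfl)
    (fun i k => (h3 i k).mono hm le_rfl) (fun k => (h4 k).mono hm le_rfl)

theorem MeasurableState.clampRun_succ {K p m : ℕ} {Ω : Type*} [mΩ : MeasurableSpace Ω]
    {lam : BlockIntensity K p} {Θ : Set (Param p)} {C dT ρ : ℝ} {A : Finset (Fin m × Fin m)}
    {θs : Param p} {N : Fin m × Fin m → Ω → Measure ℝ} (h : Bounded lam Θ C) (hΘ : IsOpen Θ)
    (hdT : 0 < dT) (hρ : 0 < ρ) (hball : Metric.closedBall θs ρ ⊆ Θ) {n : ℕ}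
    (hN : ∀ e ∈ A, Measurable fun ω => winData (window dT (n + 1)) (N e ω)) {η : ℕ → ℝ}
    {θ₀ : Param p} {q₀ : Fin m → Fin K → ℝ} {π₀ : Fin K → ℝ}
    (hs : MeasurableState fun ω => clampRun lam dT A θs ρ (fun e => N e ω) η θ₀ q₀ π₀ n) :
    MeasurableState fun ω => clampRun lam dT A θs ρ (fun e => N e ω) η θ₀ q₀ π₀ (n + 1) :=
  hs.gradStep (fun z => h.measurable_clampLik hdT hρ hball n hN hs.θ z)
    (fun z => h.measurable_clampGrad hΘ hρ hball n hN hs.θ z) _ _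

namespace Network

/-- The events up to the end of the `n`-th window. -/
noncomputable abbrev past {m : ℕ} {Ω : Type*} (dT : ℝ) (A : Finset (Fin m × Fin m)) (N : Fin m × Fin m → Ω → Measure ℝ) (n : ℕ) :
    MeasurableSpace Ω :=
  ⨆ e : {e // e ∈ A}, MeasurableSpace.comap
    (fun ω => (N e.1 ω).restrict (Set.Ioc 0 (n * dT))) inferInstance

theorem measurable_past_restrict {m : ℕ} {Ω : Type*} {dT : ℝ} {A : Finset (Fin m × Fin m)}
    {N : Fin m × Fin m → Ω → Measure ℝ} (n : ℕ) {e : Fin m × Fin m} (he : e ∈ A) :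
    Measurable[past dT A N n] fun ω => (N e ω).restrict (Set.Ioc 0 (n * dT)) := by
  have h1 : MeasurableSpace.comap (fun ω => (N e ω).restrict (Set.Ioc 0 (n * dT))) inferInstance
      ≤ past dT A N n :=
    le_iSup (fun e : {e // e ∈ A} => MeasurableSpace.comap
      (fun ω => (N e.1 ω).restrict (Set.Ioc 0 (n * dT))) inferInstance) ⟨e, he⟩
  exact (comap_measurable _).mono h1 le_rfl

variable {K p m : ℕ} {Ω : Type*} [MeasurableSpace Ω] {lam : BlockIntensity K p}
  {Θ : Set (Param p)} {θs : Param p} {C dT ρ : ℝ} {A : Finset (Fin m × Fin m)}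
  {zs : Fin m → Fin K} {P : Measure Ω} {N : Fin m × Fin m → Ω → Measure ℝ}

theorem clamp_mem (h : Network lam Θ θs C dT ρ A zs P N) (θ : Param p) : clamp θs ρ θ ∈ Θ :=
  h.ball (StreamNet.clamp_mem θs h.ρ_pos θ)

theorem θs_mem (h : Network lam Θ θs C dT ρ A zs P N) : θs ∈ Θ :=
  h.ball (Metric.mem_closedBall_self h.ρ_pos.le)

theorem rate_nonneg (h : Network lam Θ θs C dT ρ A zs P N) {B : Set ℝ} (hB0 : B ⊆ Set.Ici 0)
    (k l : Fin K) : ∀ t ∈ B, 0 ≤ lam k l t θs := fun t ht =>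
  (h.bdd.pos k l t (hB0 ht) θs h.θs_mem).le

theorem rate_le (h : Network lam Θ θs C dT ρ A zs P N) {B : Set ℝ} (hB0 : B ⊆ Set.Ici 0)
    (k l : Fin K) : ∀ t ∈ B, lam k l t θs ≤ C := fun t ht =>
  h.bdd.bound k l t (hB0 ht) θs h.θs_mem

theorem integrableOn_rate (h : Network lam Θ θs C dT ρ A zs P N) {B : Set ℝ}
    (hB : MeasurableSet B) (hB0 : B ⊆ Set.Ici 0) (hBb : Bornology.IsBounded B) (k l : Fin K) :
    IntegrableOn (fun t => lam k l t θs) B := by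
  have := isFiniteMeasure_restrict_of_isBounded hBb
  exact (h.bdd.smoothFamily k l).integrable (ae_restrict_nonneg hB hB0 _) h.θs_mem

theorem past_le (h : Network lam Θ θs C dT ρ A zs P N) (n : ℕ) :
    past dT A N n ≤ ‹MeasurableSpace Ω› :=
  iSup_le fun e => Measurable.comap_le
    ((measurable_restrict_measure measurableSet_Ioc).comp (h.poisson e.1 e.2).measurable)

theorem past_mono (h : Network lam Θ θs C dT ρ A zs P N) (n : ℕ) :
    past dT A N n ≤ past dT A N (n + 1) := by
  refine iSup_le fun e => Measurable.comap_le ?_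
  have h1 := measurable_past_restrict (dT := dT) (N := N) (n + 1) e.2
  have h2 : (fun ω => (N e.1 ω).restrict (Set.Ioc 0 (n * dT))) = fun ω =>
      ((N e.1 ω).restrict (Set.Ioc 0 (((n + 1 : ℕ) : ℝ) * dT))).restrict
        (Set.Ioc 0 (n * dT)) := by
    ext1 ω
    rw [Measure.restrict_restrict measurableSet_Ioc, Set.inter_eq_self_of_subset_left]
    refine Set.Ioc_subset_Ioc_right ?_
    have := h.dT_pos
    push_cast
    nlinarith
  rw [h2]
  exact (measurable_restrict_measure measurableSet_Ioc).comp h1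

theorem measurable_past_winData (h : Network lam Θ θs C dT ρ A zs P N) (n : ℕ)
    {e : Fin m × Fin m} (he : e ∈ A) :
    Measurable[past dT A N (n + 1)] fun ω => winData (window dT (n + 1)) (N e ω) := by
  have h1 := measurable_past_restrict (dT := dT) (N := N) (n + 1) he
  have h2 := (measurable_winData (measurableSet_window dT (n + 1))).comp h1
  simpa only [Function.comp_def, winData_restrict (measurableSet_window dT (n + 1))
    (window_subset_past h.dT_pos n)] using h2

/-- Adaptedness: the state after `n` windows depends only on events up to `n * dT`, hence is
independent of the next window. -/
theorem measurableState_clampRun (h : Network lam Θ θs C dT ρ A zs P N) (η : ℕ → ℝ)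
    (θ₀ : Param p) (q₀ : Fin m → Fin K → ℝ) (π₀ : Fin K → ℝ) (n : ℕ) :
    @MeasurableState K p m Ω (past dT A N n)
      (fun ω => clampRun lam dT A θs ρ (fun e => N e ω) η θ₀ q₀ π₀ n) := by
  induction n with
  | zero =>
    refine @MeasurableState.mk K p m Ω (past dT A N 0) _ ?_ ?_ ?_ ?_ <;> intros <;>
      exact @measurable_const _ _ _ (past dT A N 0) _
  | succ n ih =>
    exact MeasurableState.clampRun_succ (mΩ := past dT A N (n + 1)) h.bdd h.isOpen h.dT_pos
      h.ρ_pos h.ball (fun e he => h.measurable_past_winData n he)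
      (MeasurableState.mono (h.past_mono n) ih)

theorem continuous_weighted_gradFam (h : Network lam Θ θs C dT ρ A zs P N) (n : ℕ)
    (k l : Fin K) :
    Continuous fun θ => ∫ t in window dT (n + 1), lam k l t θs •
        gradFam (fun s ϑ => Real.log (lam k l s ϑ)) t (clamp θs ρ θ) := by
  have hr := h.integrableOn_rate (measurableSet_window dT (n + 1)) (window_subset h.dT_pos n)
    (isBounded_window _ _) k l
  have hF := h.bdd.smoothFamily_log k l
  refine continuous_of_dominated (bound := fun t => ‖lam k l t θs‖ * C) (fun θ => ?_)
    (fun θ => Eventually.of_forall fun t => ?_) (hr.norm.mul_const C)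
    (Eventually.of_forall fun t => ?_)
  · exact hr.aestronglyMeasurable.smul
      (hF.measurable_gradFam h.isOpen (h.clamp_mem θ)).aestronglyMeasurable
  · rw [norm_smul]
    exact mul_le_mul_of_nonneg_left (hF.norm_gradFam_le (h.clamp_mem θ) t) (norm_nonneg _)
  · exact ((hF.continuousOn_gradFam h.isOpen t).comp_continuous (continuous_clamp θs h.ρ_pos)
      h.clamp_mem).const_smul (lam k l t θs)

/-- Measurability of the noise as a function of the parameter and of the data. -/
theorem measurable_gradNoise (h : Network lam Θ θs C dT ρ A zs P N) (n : ℕ)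
    {Ω' : Type*} [mΩ' : MeasurableSpace Ω'] {X : Ω' → Param p} (hX : Measurable X)
    {D : Fin m × Fin m → Ω' → Measure ℝ}
    (hD : ∀ e ∈ A, Measurable fun x => winData (window dT (n + 1)) (D e x)) :
    Measurable fun x => gradNoise lam dT A zs θs ρ (fun e => D e x) (n + 1) (X x) := by
  unfold gradNoise
  refine Measurable.fun_const_smul ?_ (1 / (A.card : ℝ))
  refine Finset.measurable_sum _ fun e he => Measurable.sub ?_ ?_
  · have h1 := ((h.bdd.smoothFamily_log (zs e.1) (zs e.2)).measurable_integral_gradFam_clamp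
      h.isOpen h.ρ_pos h.ball
      (measurableSet_window dT (n + 1))).comp (hX.prodMk (hD e he))
    simpa [Function.comp_def, winData_winData (measurableSet_window dT (n + 1))] using h1
  · exact (h.continuous_weighted_gradFam n _ _).measurable.comp hX

/-- For a frozen parameter, `l` times the noise is a compensated Poisson integral with integrand at
most `|l| * C / |A| ≤ 1`. The compensator cancels the linear term of the exponent, and the quadratic
term remains. -/
theorem lintegral_exp_gradNoise_le [IsProbabilityMeasure P]
    (h : Network lam Θ θs C dT ρ A zs P N) (hA : 0 < A.card) (n : ℕ)
    (θ : Param p) (j : Fin p) {l : ℝ} (hl : |l| ≤ 1 / C * A.card) :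
    ∫⁻ ω, ENNReal.ofReal (Real.exp
      (l * gradNoise lam dT A zs θs ρ (fun e => N e ω) (n + 1) θ j)) ∂P ≤
      ENNReal.ofReal (Real.exp (C ^ 3 * dT * l ^ 2 / A.card)) := by
  set B := window dT (n + 1) with hB_def
  have hB : MeasurableSet B := measurableSet_window dT (n + 1)
  have hB0 : B ⊆ Set.Ici 0 := window_subset h.dT_pos n
  have hBb : Bornology.IsBounded B := isBounded_window _ _
  set a : ℝ := (A.card : ℝ) with ha_def
  have ha : 0 < a := Nat.cast_pos.2 hA
  set θ' := clamp θs ρ θ with hθ'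
  have hθΘ : θ' ∈ Θ := h.clamp_mem θ
  have hC := h.C_pos
  let G : Fin m × Fin m → ℝ → Param p := fun e t =>
    gradFam (fun s ϑ => Real.log (lam (zs e.1) (zs e.2) s ϑ)) t θ'
  have hGm : ∀ e, Measurable (G e) := fun e =>
    (h.bdd.smoothFamily_log (zs e.1) (zs e.2)).measurable_gradFam h.isOpen hθΘ
  have hGb : ∀ e t, ‖G e t‖ ≤ C := fun e t =>
    (h.bdd.smoothFamily_log (zs e.1) (zs e.2)).norm_gradFam_le hθΘ t
  have hGj : ∀ e t, |G e t j| ≤ C := fun e t =>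
    (PiLp.norm_apply_le (G e t) j).trans (hGb e t)
  let f : {e // e ∈ A} → ℝ → ℝ := fun e t => l / a * G e.1 t j
  let r : {e // e ∈ A} → ℝ → ℝ := fun e t => lam (zs e.1.1) (zs e.1.2) t θs
  set b := |l| / a * C with hb_def
  have hb0 : 0 ≤ b := by positivity
  have hb1 : b ≤ 1 := by
    rw [hb_def, div_mul_eq_mul_div, div_le_one ha]
    calc |l| * C ≤ 1 / C * a * C := by gcongr
      _ = a := by field_simp
  have key := lintegral_exp_sum_integral_le (P := P) (N := fun e : {e // e ∈ A} => N e.1) (r := r)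
    (fun e => h.poisson e.1 e.2) h.indep hB hB0 hBb
    (fun e => h.integrableOn_rate hB hB0 hBb _ _) (fun e => h.rate_nonneg hB0 _ _)
    (fun e => h.rate_le hB0 _ _) A.attach (f := f)
    (fun e => (measurable_euclidean_iff.1 (hGm e.1) j).const_mul _) hb0 hb1
    (fun e t _ => by
      simp only [f, b]
      rw [abs_mul, abs_div, abs_of_pos ha]
      exact mul_le_mul_of_nonneg_left (hGj e.1 t) (by positivity))
  have hfin : ∀ᵐ ω ∂P, ∀ e : {e // e ∈ A}, N e.1 ω B < ⊤ :=
    ae_all_iff.2 fun e => (h.poisson e.1 e.2).ae_lt_top hB hB0 hBb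
  set v := ∑ e ∈ A.attach, ∫ t in B, f e t * r e t with hv
  have hGI : ∀ e (μ : Measure ℝ) [IsFiniteMeasure μ], Integrable (G e) μ := fun e μ _ =>
    (h.bdd.smoothFamily_log (zs e.1) (zs e.2)).integrable_gradFam h.isOpen hθΘ
  have hae : ∀ᵐ ω ∂P, l * gradNoise lam dT A zs θs ρ (fun e => N e ω) (n + 1) θ j =
      (∑ e ∈ A.attach, ∫ t in B, f e t ∂(N e.1 ω)) - v := by
    filter_upwards [hfin] with ω hω
    have e1 : ∀ e : {e // e ∈ A}, (∫ t, G e.1 t ∂(winData B (N e.1 ω))) j =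
        ∫ t in B, G e.1 t j ∂(N e.1 ω) := fun e => by
      rw [← winData_eq (hω e)]
      exact ((EuclideanSpace.proj (𝕜 := ℝ) j).integral_comp_comm (hGI e.1 _)).symm
    have e2 : ∀ e : {e // e ∈ A}, (∫ t in B, r e t • G e.1 t) j =
        ∫ t in B, r e t * G e.1 t j := fun e => by
      have hint : Integrable (fun t => r e t • G e.1 t) (volume.restrict B) :=
        Integrable.smul_bdd (C := C) (h.integrableOn_rate hB hB0 hBb _ _)
          (hGm e.1).aestronglyMeasurable (Eventually.of_forall fun t => hGb e.1 t)
      exact ((EuclideanSpace.proj (𝕜 := ℝ) j).integral_comp_comm hint).symm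
    rw [gradNoise, ← Finset.sum_attach, hv, ← Finset.sum_sub_distrib, PiLp.smul_apply,
      WithLp.ofLp_sum, Finset.sum_apply, smul_eq_mul, ← mul_assoc, Finset.mul_sum]
    refine Finset.sum_congr rfl fun e _ => ?_
    rw [PiLp.sub_apply]
    have e3 : ∫ t in B, f e t ∂(N e.1 ω) = l / a * ∫ t in B, G e.1 t j ∂(N e.1 ω) :=
      integral_const_mul _ _
    have e4 : ∫ t in B, f e t * r e t = l / a * ∫ t in B, r e t * G e.1 t j := by
      rw [← integral_const_mul]
      refine integral_congr_ae (Eventually.of_forall fun t => ?_)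
      simp only [f]
      ring
    rw [e3, e4, ← e1 e, ← e2 e, ← mul_sub, mul_one_div]
  rw [lintegral_congr_ae (hae.mono fun ω hω => by rw [hω])]
  have hsplit : ∀ ω, ENNReal.ofReal
      (Real.exp ((∑ e ∈ A.attach, ∫ t in B, f e t ∂(N e.1 ω)) - v)) =
      ENNReal.ofReal (Real.exp (-v)) *
        ENNReal.ofReal (Real.exp (∑ e ∈ A.attach, ∫ t in B, f e t ∂(N e.1 ω))) := fun ω => by
    rw [← ENNReal.ofReal_mul (Real.exp_pos _).le, ← Real.exp_add]
    congr 2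
    ring
  simp_rw [hsplit]
  rw [lintegral_const_mul' _ _ ENNReal.ofReal_ne_top]
  refine (mul_le_mul_right key _).trans ?_
  rw [← ENNReal.ofReal_mul (Real.exp_pos _).le, ← Real.exp_add]
  refine ENNReal.ofReal_le_ofReal (Real.exp_le_exp.2 (le_of_eq ?_))
  rw [Finset.card_attach, volume_real_window h.dT_pos, ← ha_def, hb_def, mul_pow, div_pow,
    sq_abs]
  field_simp
  ring

/-- The noise of a window has conditionally on the past subgaussian moments. -/
theorem lintegral_exp_add_gradNoise_le [IsProbabilityMeasure P]
    (h : Network lam Θ θs C dT ρ A zs P N) (hA : 0 < A.card) (n : ℕ) {X : Ω → Param p}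
    (hX : Measurable[past dT A N n] X) {u : Ω → ℝ} (hu : Measurable[past dT A N n] u)
    (j : Fin p) (l l' : ℝ) (hl : |l| ≤ 1 / C * A.card) :
    ∫⁻ ω, ENNReal.ofReal (Real.exp
      (l' * u ω + l * gradNoise lam dT A zs θs ρ (fun e => N e ω) (n + 1) (X ω) j)) ∂P ≤
      ENNReal.ofReal (Real.exp (C ^ 3 * dT * l ^ 2 / A.card)) *
        ∫⁻ ω, ENNReal.ofReal (Real.exp (l' * u ω)) ∂P := by
  set Y : Ω → {e // e ∈ A} → Measure ℝ := fun ω e => (N e.1 ω).restrict (window dT (n + 1))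
    with hY
  have hYm : Measurable Y := measurable_pi_lambda _ fun e =>
    (measurable_restrict_measure (measurableSet_window _ _)).comp (h.poisson e.1 e.2).measurable
  have hind : IndepFun (fun ω => (X ω, u ω)) Y P := by
    have h1 := indep_iSup_comap_of_iIndepFun (P := P) h.indep
      (fun e => (h.poisson e.1 e.2).measurable)
      (measurable_restrict_measure (measurableSet_Ioc (a := (0 : ℝ)) (b := n * dT)))
      (measurable_restrict_measure (measurableSet_window dT (n + 1)))
      (fun e => (h.poisson e.1 e.2).indepFun_restrict measurableSet_Ioc (measurableSet_window _ _)
        (fun t ht => ht.1.le) (window_subset h.dT_pos n) (Metric.isBounded_Ioc _ _)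
        (isBounded_window _ _) (disjoint_past_window dT n))
    rw [IndepFun_iff_Indep]
    refine indep_of_indep_of_le_left (indep_of_indep_of_le_right h1 ?_) ?_
    · rw [← measurable_iff_comap_le]
      refine @measurable_pi_lambda _ _ _ (_) _ _ fun e => ?_
      rw [measurable_iff_comap_le]
      exact le_iSup (fun e : {e // e ∈ A} => MeasurableSpace.comap
        (fun ω => (N e.1 ω).restrict (window dT (n + 1))) inferInstance) e
    · rw [← measurable_iff_comap_le]
      exact measurable_pair (mΩ := past dT A N n) hX hu
  classical
  -- `gradNoise` expects data on all pairs of nodes but reads only those in `A`; extension by zero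
  -- makes it a function of the independent data `Y`.
  let ext : ({e // e ∈ A} → Measure ℝ) → Fin m × Fin m → Measure ℝ := fun y e =>
    if he : e ∈ A then y ⟨e, he⟩ else 0
  have hext : ∀ ω θ, gradNoise lam dT A zs θs ρ (fun e => N e ω) (n + 1) θ =
      gradNoise lam dT A zs θs ρ (ext (Y ω)) (n + 1) θ := by
    intro ω θ
    unfold gradNoise
    congr 1
    refine Finset.sum_congr rfl fun e he => ?_
    simp only [ext, he, dif_pos, hY]
    rw [winData_restrict (measurableSet_window _ _) subset_rfl]
  have hGm : Measurable fun x : (Param p × ℝ) × ({e // e ∈ A} → Measure ℝ) =>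
      gradNoise lam dT A zs θs ρ (ext x.2) (n + 1) x.1.1 := by
    refine h.measurable_gradNoise n (D := fun e x => ext x.2 e)
      (measurable_fst.comp measurable_fst) fun e he => ?_
    simp only [ext, he, dif_pos]
    exact (measurable_winData (measurableSet_window _ _)).comp
      ((measurable_pi_apply _).comp measurable_snd)
  have key := lintegral_mul_le_of_indepFun (P := P)
    ((hX.mono (h.past_le n) le_rfl).prodMk (hu.mono (h.past_le n) le_rfl)) hYm hind
    (h := fun x => ENNReal.ofReal (Real.exp (l' * x.2))) (measurable_snd.const_mul l').exp.ennreal_ofReal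
    (G := fun x => ENNReal.ofReal (Real.exp
      (l * gradNoise lam dT A zs θs ρ (ext x.2) (n + 1) x.1.1 j)))
    (((measurable_proj j).comp hGm).const_mul l).exp.ennreal_ofReal
    (M := ENNReal.ofReal (Real.exp (C ^ 3 * dT * l ^ 2 / A.card)))
    (fun x => by
      refine (lintegral_congr fun ω => ?_).trans_le (h.lintegral_exp_gradNoise_le hA n x.1 j hl)
      rw [hext ω x.1])
  refine le_trans (le_of_eq ?_) key
  refine lintegral_congr fun ω => ?_
  rw [Real.exp_add, ENNReal.ofReal_mul (Real.exp_pos _).le, hext ω (X ω)]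

theorem measurable_clampRun_θ (h : Network lam Θ θs C dT ρ A zs P N) (η : ℕ → ℝ)
    (θ₀ : Param p) (q₀ : Fin m → Fin K → ℝ) (π₀ : Fin K → ℝ) (n : ℕ) :
    Measurable[past dT A N n]
      fun ω => (clampRun lam dT A θs ρ (fun e => N e ω) η θ₀ q₀ π₀ n).θ :=
  @MeasurableState.θ K p m Ω (past dT A N n) _ (h.measurableState_clampRun η θ₀ q₀ π₀ n)

theorem measurable_linFilter (h : Network lam Θ θs C dT ρ A zs P N) {ξ : ℕ → Ω → Param p}
    (hξ : ∀ n, Measurable[past dT A N (n + 1)] (ξ n)) (c α : ℝ) (n : ℕ) :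
    Measurable[past dT A N n] fun ω => linFilter c α (fun n => ξ n ω) n := by
  induction n with
  | zero => exact @measurable_const _ _ _ (past dT A N 0) _
  | succ n ih =>
    exact measurable_smul_add_smul (mΩ := past dT A N (n + 1))
      (ih.mono (h.past_mono n) le_rfl) (hξ n) _ _

theorem isFilteredNoise [IsProbabilityMeasure P] (h : Network lam Θ θs C dT ρ A zs P N)
    (hA : 0 < A.card) {X : ℕ → Ω → Param p} (hX : ∀ n, Measurable[past dT A N n] (X n))
    (c α : ℝ) (j : Fin p) :
    IsFilteredNoise P c α (1 / C) (C ^ 3 * dT) A.card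
      (fun n ω => linFilter c α
        (fun n => gradNoise lam dT A zs θs ρ (fun e => N e ω) (n + 1) (X n ω)) n j)
      (fun n ω => gradNoise lam dT A zs θs ρ (fun e => N e ω) (n + 1) (X n ω) j) := by
  have hU : ∀ n, Measurable[past dT A N n] fun ω => linFilter c α
      (fun n => gradNoise lam dT A zs θs ρ (fun e => N e ω) (n + 1) (X n ω)) n j := fun n =>
    (measurable_proj j).comp (h.measurable_linFilter (fun n =>
      h.measurable_gradNoise (mΩ' := past dT A N (n + 1)) n ((hX n).mono (h.past_mono n) le_rfl)
        (fun e he => h.measurable_past_winData n he)) c α n)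
  exact ⟨fun n => (hU n).mono (h.past_le n) le_rfl, fun ω => rfl, fun n ω => rfl,
    fun n l l' hl => h.lintegral_exp_add_gradNoise_le hA n (hX n) (hU n) j l l' hl⟩

end Network

/-! ### Population likelihood and drift of the parameter. -/

section PopulationFormulas

variable {K p m : ℕ}

/-- The mean of the log-likelihood of the `n`-th window as an explicit integral. -/
noncomputable def popLik (lam : BlockIntensity K p) (dT : ℝ) (A : Finset (Fin m × Fin m))
    (zs : Fin m → Fin K) (θs : Param p) (n : ℕ) (θ : Param p) (z : Fin m → Fin K) : ℝ :=
  ∑ e ∈ A, ((∫ t in window dT n, lam (zs e.1) (zs e.2) t θs *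
      Real.log (lam (z e.1) (z e.2) t θ)) - ∫ t in window dT n, lam (z e.1) (z e.2) t θ)

/-- The gradient, per edge, of the mean log-likelihood given the true labels. -/
noncomputable def popGrad (lam : BlockIntensity K p) (dT : ℝ) (A : Finset (Fin m × Fin m))
    (zs : Fin m → Fin K) (θs : Param p) (n : ℕ) (θ : Param p) : Param p :=
  (1 / (A.card : ℝ)) • ∑ e ∈ A, ((∫ t in window dT n, lam (zs e.1) (zs e.2) t θs •
      gradFam (fun s ϑ => Real.log (lam (zs e.1) (zs e.2) s ϑ)) t θ)
    - ∫ t in window dT n, gradFam (lam (zs e.1) (zs e.2)) t θ)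

/-- Through this identity the population gradient at the true labels vanishes at `θs` and is
controlled elsewhere by the difference of the intensities. -/
theorem Bounded.gradFam_log {lam : BlockIntensity K p} {Θ : Set (Param p)} {C : ℝ}
    (h : Bounded lam Θ C) (hΘ : IsOpen Θ) (k l : Fin K) {t : ℝ} (ht : 0 ≤ t) {θ : Param p}
    (hθ : θ ∈ Θ) :
    lam k l t θ • gradFam (fun s ϑ => Real.log (lam k l s ϑ)) t θ = gradFam (lam k l) t θ := by
  have h1 := (h.smoothFamily_log k l).hasGradientAt hΘ ht hθ
  have h2 := (h.smoothFamily k l).hasGradientAt hΘ ht hθ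
  have hpos := h.pos k l t ht θ hθ
  have h3 := h2.hasFDerivAt.log hpos.ne'
  rw [← map_smul] at h3
  rw [h1.unique (hasGradientAt_iff_hasFDerivAt.2 h3), smul_smul, mul_inv_cancel₀ hpos.ne', one_smul]

end PopulationFormulas

namespace Network

variable {K p m : ℕ} {Ω : Type*} [MeasurableSpace Ω] {lam : BlockIntensity K p}
  {Θ : Set (Param p)} {θs : Param p} {C dT ρ : ℝ} {A : Finset (Fin m × Fin m)}
  {zs : Fin m → Fin K} {P : Measure Ω} {N : Fin m × Fin m → Ω → Measure ℝ}

theorem meanLogLik_eq [IsProbabilityMeasure P] (h : Network lam Θ θs C dT ρ A zs P N) (n : ℕ)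
    {θ : Param p} (hθ : θ ∈ Θ) (z : Fin m → Fin K) :
    meanLogLik lam dT A P N (n + 1) θ z =
      1 / (A.card : ℝ) * popLik lam dT A zs θs (n + 1) θ z := by
  unfold meanLogLik windowLogLik popLik
  rw [integral_const_mul]
  congr 1
  have hB := measurableSet_window dT (n + 1)
  have hB0 := window_subset h.dT_pos n
  have hBb := isBounded_window dT (n + 1)
  have key : ∀ e ∈ A, _ := fun e he => (h.poisson e he).integral_integral hB hB0 hBb
    (h.integrableOn_rate hB hB0 hBb _ _) (h.rate_nonneg hB0 _ _)
    ((h.bdd.smoothFamily_log (z e.1) (z e.2)).meas θ hθ)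
    (b := C) (fun t ht => h.bdd.bound_log _ _ t (hB0 ht) θ hθ)
  refine (integral_finsetSum A fun e he => (key e he).1.sub (integrable_const
    (∫ t in window dT (n + 1), lam (z e.1) (z e.2) t θ))).trans ?_
  refine Finset.sum_congr rfl fun e he => ?_
  refine (integral_sub (key e he).1 (integrable_const _)).trans ?_
  rw [(key e he).2, integral_const, probReal_univ, one_smul]
  congr 1
  exact integral_congr_ae (Eventually.of_forall fun t => mul_comm _ _)

theorem hasGradientAt_meanLogLik [IsProbabilityMeasure P]
    (h : Network lam Θ θs C dT ρ A zs P N) (n : ℕ) {θ : Param p} (hθ : θ ∈ Θ) :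
    HasGradientAt (fun ϑ => meanLogLik lam dT A P N (n + 1) ϑ zs)
      (popGrad lam dT A zs θs (n + 1) θ) θ := by
  have hB := measurableSet_window dT (n + 1)
  have hB0 := window_subset h.dT_pos n
  have hBb := isBounded_window dT (n + 1)
  have := isFiniteMeasure_restrict_of_isBounded hBb
  have h1 : HasGradientAt (fun ϑ => 1 / (A.card : ℝ) * popLik lam dT A zs θs (n + 1) ϑ zs)
      (popGrad lam dT A zs θs (n + 1) θ) θ := by
    refine hasGradientAt_const_mul _ (hasGradientAt_sum A fun e _ => hasGradientAt_sub ?_ ?_)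
    · exact (h.bdd.smoothFamily_log _ _).hasGradientAt_integral h.isOpen
        (ae_restrict_nonneg hB hB0 _) (h.integrableOn_rate hB hB0 hBb _ _) hθ
    · exact (h.bdd.smoothFamily _ _).hasGradientAt_integral' h.isOpen
        (ae_restrict_nonneg hB hB0 _) hθ
  rw [hasGradientAt_iff_hasFDerivAt] at h1 ⊢
  refine h1.congr_of_eventuallyEq ?_
  filter_upwards [h.isOpen.mem_nhds hθ] with ϑ hϑ using h.meanLogLik_eq n hϑ zs

theorem Qbar_pointLaw (θ : Param p) :
    Qbar lam dT A P N θ (pointLaw zs) = meanLogLik lam dT A P N 1 θ zs := by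
  simp only [Qbar, Qfun, mfExp_pointLaw, meanLogLik]

/-- The mean log-likelihoods of the windows agree on an open set, hence so do their gradients. Thus
the monotonicity condition, stated for the first window, serves all of them. -/
theorem popGrad_eq [IsProbabilityMeasure P] (h : Network lam Θ θs C dT ρ A zs P N)
    {q₀ : Fin m → Fin K → ℝ} {c C' δ rd : ℝ}
    (hreg : Regular lam dT Θ θs A zs P N q₀ c C' δ rd) (n : ℕ) {θ : Param p} (hθ : θ ∈ Θ) :
    popGrad lam dT A zs θs (n + 1) θ = popGrad lam dT A zs θs 1 θ := by
  have h1 := h.hasGradientAt_meanLogLik n hθ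
  have h2 := h.hasGradientAt_meanLogLik 0 hθ
  refine h1.unique ?_
  rw [hasGradientAt_iff_hasFDerivAt] at h2 ⊢
  refine h2.congr_of_eventuallyEq ?_
  filter_upwards [h.isOpen.mem_nhds hθ] with ϑ hϑ using
    hreg.stationary (n + 1) (Nat.le_add_left 1 n) ϑ hϑ zs

/-- Apply the gradient condition to the point mass at the true labels: its total variation distance
is zero, which forces the maximizer to be `θs`. -/
theorem inner_popGrad_le [IsProbabilityMeasure P] (h : Network lam Θ θs C dT ρ A zs P N)
    {q₀ : Fin m → Fin K → ℝ} {c C' δ rd : ℝ} (hδ : 0 < δ)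
    (hreg : Regular lam dT Θ θs A zs P N q₀ c C' δ rd) (n : ℕ) {θ : Param p} (hθ : θ ∈ Θ)
    (hθδ : θ ∈ Metric.ball θs δ) :
    inner ℝ (popGrad lam dT A zs θs (n + 1) θ) (θ - θs) ≤ -c * ‖θ - θs‖ ^ 2 := by
  obtain ⟨θq, -, -, hdist, hgrad⟩ := hreg.maximizer (pointLaw zs) (isMeanField_pointLaw zs)
    (by rwa [tvDirac_pointLaw])
  rw [tvDirac_pointLaw, mul_zero] at hdist
  have hq : θq = θs := sub_eq_zero.1 (norm_le_zero_iff.1 hdist)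
  subst hq
  have h1 := (hgrad θ ⟨hθ, hθδ⟩).1
  simp only [Qbar_pointLaw] at h1
  rwa [(h.hasGradientAt_meanLogLik 0 hθ).gradient, ← h.popGrad_eq hreg n hθ] at h1

/-- By `Bounded.gradFam_log` the integrand is `(λ(θs) - λ(θ)) ∇ log λ(θ)`, and the intensities are
Lipschitz on the ball. -/
theorem norm_popGrad_le (h : Network lam Θ θs C dT ρ A zs P N) (n : ℕ) {θ : Param p}
    (hθ : θ ∈ Metric.closedBall θs ρ) :
    ‖popGrad lam dT A zs θs (n + 1) θ‖ ≤ C ^ 2 * dT * ‖θ - θs‖ := by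
  have hθΘ := h.ball hθ
  have hC := h.C_pos
  have hdT := h.dT_pos
  have hB := measurableSet_window dT (n + 1)
  have hB0 := window_subset h.dT_pos n
  have hBb := isBounded_window dT (n + 1)
  have := isFiniteMeasure_restrict_of_isBounded hBb
  have hterm : ∀ e ∈ A, ‖(∫ t in window dT (n + 1), lam (zs e.1) (zs e.2) t θs •
      gradFam (fun s ϑ => Real.log (lam (zs e.1) (zs e.2) s ϑ)) t θ)
    - ∫ t in window dT (n + 1), gradFam (lam (zs e.1) (zs e.2)) t θ‖ ≤
      C ^ 2 * dT * ‖θ - θs‖ := by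
    intro e _
    have hF := h.bdd.smoothFamily_log (zs e.1) (zs e.2)
    have hint : IntegrableOn (fun t => lam (zs e.1) (zs e.2) t θs •
        gradFam (fun s ϑ => Real.log (lam (zs e.1) (zs e.2) s ϑ)) t θ) (window dT (n + 1)) :=
      Integrable.smul_bdd (C := C) (h.integrableOn_rate hB hB0 hBb _ _)
        (hF.measurable_gradFam h.isOpen hθΘ).aestronglyMeasurable
        (Eventually.of_forall fun t => hF.norm_gradFam_le hθΘ t)
    rw [← integral_sub hint
      ((h.bdd.smoothFamily (zs e.1) (zs e.2)).integrable_gradFam h.isOpen hθΘ)]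
    have hb : ∀ᵐ t ∂(volume.restrict (window dT (n + 1))),
        ‖lam (zs e.1) (zs e.2) t θs •
          gradFam (fun s ϑ => Real.log (lam (zs e.1) (zs e.2) s ϑ)) t θ -
          gradFam (lam (zs e.1) (zs e.2)) t θ‖ ≤ C * ‖θ - θs‖ * C := by
      filter_upwards [ae_restrict_nonneg hB hB0 volume] with t ht
      rw [← h.bdd.gradFam_log h.isOpen _ _ ht hθΘ, ← sub_smul, norm_smul, norm_sub_rev θ θs]
      exact mul_le_mul ((h.bdd.smoothFamily (zs e.1) (zs e.2)).abs_sub_le h.isOpen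
        (convex_closedBall θs ρ) h.ball ht (Metric.mem_closedBall_self h.ρ_pos.le) hθ)
        (hF.norm_gradFam_le hθΘ t) (norm_nonneg _) (by positivity)
    refine (norm_integral_le_of_norm_le_const hb).trans (le_of_eq ?_)
    rw [measureReal_restrict_apply_univ, volume_real_window hdT]
    ring
  unfold popGrad
  rw [norm_smul]
  rcases Nat.eq_zero_or_pos A.card with h0 | h0
  · simp only [h0, Nat.cast_zero, div_zero, norm_zero, zero_mul]
    positivity
  have ha : (0 : ℝ) < A.card := Nat.cast_pos.2 h0
  have h1 := norm_sum_le_of_le A hterm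
  rw [Finset.sum_const, nsmul_eq_mul] at h1
  rw [Real.norm_of_nonneg (by positivity), one_div, inv_mul_le_iff₀ ha]
  exact h1

/-- The part of the step of the parameter that is due to the uncertainty of the labels. -/
noncomputable def labelError (lam : BlockIntensity K p) (dT : ℝ) (A : Finset (Fin m × Fin m))
    (zs : Fin m → Fin K) (θs : Param p) (ρ : ℝ) (D : Fin m × Fin m → Measure ℝ) (n : ℕ)
    (q : Fin m → Fin K → ℝ) (θ : Param p) : Param p :=
  (1 / (A.card : ℝ)) • (∑ z : Fin m → Fin K, (∏ i, q i (z i)) •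
    clampGrad lam dT A θs ρ D n θ z - clampGrad lam dT A θs ρ D n θ zs)

theorem clampGrad_true_labels (D : Fin m × Fin m → Measure ℝ) (n : ℕ) (θ : Param p) :
    (1 / (A.card : ℝ)) • clampGrad lam dT A θs ρ D n θ zs =
      popGrad lam dT A zs θs n (clamp θs ρ θ) + gradNoise lam dT A zs θs ρ D n θ := by
  unfold popGrad gradNoise clampGrad blockGrad
  rw [← smul_add, ← Finset.sum_add_distrib]
  congr 1
  refine Finset.sum_congr rfl fun e _ => ?_
  abel

/-- Drift, noise and label error, in the form that `exists_sgd_bound` takes. -/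
theorem clampRun_succ_θ (D : Fin m × Fin m → Measure ℝ) (η : ℕ → ℝ) (θ₀ : Param p)
    (q₀ : Fin m → Fin K → ℝ) (π₀ : Fin K → ℝ) (n : ℕ) :
    (clampRun lam dT A θs ρ D η θ₀ q₀ π₀ (n + 1)).θ - θs =
      ((clampRun lam dT A θs ρ D η θ₀ q₀ π₀ n).θ - θs) + η (n + 1) •
        (popGrad lam dT A zs θs (n + 1)
            (clamp θs ρ (clampRun lam dT A θs ρ D η θ₀ q₀ π₀ n).θ) +
          gradNoise lam dT A zs θs ρ D (n + 1) (clampRun lam dT A θs ρ D η θ₀ q₀ π₀ n).θ +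
          labelError lam dT A zs θs ρ D (n + 1) (clampRun lam dT A θs ρ D η θ₀ q₀ π₀ (n + 1)).q
            (clampRun lam dT A θs ρ D η θ₀ q₀ π₀ n).θ) := by
  rw [← clampGrad_true_labels, labelError, ← smul_add, add_sub_cancel]
  simp only [clampRun, gradStep]
  abel

theorem norm_labelError_le (h : Network lam Θ θs C dT ρ A zs P N)
    (D : Fin m × Fin m → Measure ℝ) (n : ℕ) {q : Fin m → Fin K → ℝ} (hq : IsMeanField q)
    (θ : Param p) :
    ‖labelError lam dT A zs θs ρ D n q θ‖ ≤ (1 / (A.card : ℝ)) *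
      (2 * (C * blockMass A (fun e => winData (window dT n) (D e)) (window dT n)) *
        offMass q zs) := by
  unfold labelError
  rw [norm_smul, Real.norm_of_nonneg (by positivity)]
  refine mul_le_mul_of_nonneg_left (hq.norm_sum_smul_sub_le zs fun z => ?_) (by positivity)
  exact h.bdd.norm_blockGrad_le (fun e _ => inferInstance) (isBounded_window _ _)
    (h.clamp_mem θ) z

end Network

/-! ### Concentration of the label laws. -/

section Gain

variable {K p m : ℕ}

/-- The expected gain in log-likelihood from moving node `i` from class `l` to class `k`. -/
noncomputable def gainLik (lam : BlockIntensity K p) (A : Finset (Fin m × Fin m))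
    (ν : Fin m × Fin m → Measure ℝ) (I : Set ℝ) (θ : Param p) (q : Fin m → Fin K → ℝ)
    (i : Fin m) (k l : Fin K) : ℝ :=
  mfExp q fun z => blockLik lam (incident A i) ν I θ (Function.update z i k) -
    blockLik lam (incident A i) ν I θ (Function.update z i l)

/-- The label laws at which the gains are evaluated: the initial laws in the first window, and
the point mass at the true labels afterwards. -/
noncomputable def refLaw (q₀ : Fin m → Fin K → ℝ) (zs : Fin m → Fin K) : ℕ → Fin m → Fin K → ℝ
  | 0 => q₀
  | _ + 1 => pointLaw zs

theorem isMeanField_refLaw {q₀ : Fin m → Fin K → ℝ} (hq₀ : IsMeanField q₀)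
    (zs : Fin m → Fin K) : ∀ n, IsMeanField (refLaw q₀ zs n)
  | 0 => hq₀
  | _ + 1 => isMeanField_pointLaw zs

/-- An upper bound for the accumulated evidence for class `k` against the true class. -/
noncomputable def excess (lam : BlockIntensity K p) (dT : ℝ) (A : Finset (Fin m × Fin m))
    (zs : Fin m → Fin K) (θs : Param p) (q₀ : Fin m → Fin K → ℝ) (κ : ℝ)
    (D : Fin m × Fin m → Measure ℝ) (n : ℕ) (i : Fin m) (k : Fin K) : ℝ :=
  ∑ r ∈ Finset.range n,
    (gainLik lam A (fun e => winData (window dT (r + 1)) (D e)) (window dT (r + 1)) θs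
      (refLaw q₀ zs r) i k (zs i) +
    κ * blockMass (incident A i) (fun e => winData (window dT (r + 1)) (D e))
      (window dT (r + 1)))

theorem incident_subset (A : Finset (Fin m × Fin m)) (i : Fin m) : incident A i ⊆ A :=
  Finset.filter_subset _ _

theorem evidence_eq_mul_exp_gainLik (lam : BlockIntensity K p) (dT : ℝ)
    (A : Finset (Fin m × Fin m)) (θs : Param p) (ρ : ℝ) (D : Fin m × Fin m → Measure ℝ) (n : ℕ)
    {s : State K p m} (hs : IsMeanField s.q) (i : Fin m) (k l : Fin K) :
    evidence (clampLik lam dT A θs ρ D n) s i k = evidence (clampLik lam dT A θs ρ D n) s i l *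
      Real.exp (gainLik lam A (fun e => winData (window dT n) (D e)) (window dT n)
        (clamp θs ρ s.θ) s.q i k l) := by
  unfold evidence
  rw [← Real.exp_add, hs.mfExpAt_eq, hs.mfExpAt_eq]
  congr 1
  rw [← sub_eq_iff_eq_add', ← mfExp_sub, gainLik]
  congr 1
  ext z
  exact blockLik_sub_eq_incident _ _ _ _ _ fun j hj => by simp [hj]

end Gain

namespace Network

variable {K p m : ℕ} {Ω : Type*} [MeasurableSpace Ω] {lam : BlockIntensity K p}
  {Θ : Set (Param p)} {θs : Param p} {C dT ρ : ℝ} {A : Finset (Fin m × Fin m)}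
  {zs : Fin m → Fin K} {P : Measure Ω} {N : Fin m × Fin m → Ω → Measure ℝ}

theorem gainLik_le_of_θ (h : Network lam Θ θs C dT ρ A zs P N) (D : Fin m × Fin m → Measure ℝ)
    (n : ℕ) {q : Fin m → Fin K → ℝ} (hq : IsMeanField q) {θ : Param p}
    (hθ : θ ∈ Metric.closedBall θs ρ) (i : Fin m) (k l : Fin K) :
    gainLik lam A (fun e => winData (window dT (n + 1)) (D e)) (window dT (n + 1)) θ q i k l ≤
      gainLik lam A (fun e => winData (window dT (n + 1)) (D e)) (window dT (n + 1)) θs q i k l +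
      2 * C * ρ * blockMass (incident A i) (fun e => winData (window dT (n + 1)) (D e))
        (window dT (n + 1)) := by
  have hC := h.C_pos
  set M := blockMass (incident A i) (fun e => winData (window dT (n + 1)) (D e))
        (window dT (n + 1)) with hM
  have hM0 : 0 ≤ M := blockMass_nonneg _ _ _
  have hz : ∀ z, |blockLik lam (incident A i) (fun e => winData (window dT (n + 1)) (D e))
      (window dT (n + 1)) θ z - blockLik lam (incident A i)
      (fun e => winData (window dT (n + 1)) (D e)) (window dT (n + 1)) θs z| ≤ C * ρ * M := by
    intro z
    refine (h.bdd.abs_blockLik_sub_le h.isOpen (fun e _ => inferInstance)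
      (fun e _ => ae_winData (measurableSet_window _ _) (window_subset h.dT_pos n) _)
      (measurableSet_window _ _) (window_subset h.dT_pos n) (isBounded_window _ _)
      (convex_closedBall θs ρ) h.ball hθ (Metric.mem_closedBall_self h.ρ_pos.le) z).trans ?_
    exact mul_le_mul_of_nonneg_right (mul_le_mul_of_nonneg_left
      (mem_closedBall_iff_norm.1 hθ) hC.le) hM0
  unfold gainLik
  rw [← hq.mfExp_const (2 * C * ρ * M), ← mfExp_add]
  refine hq.mfExp_mono fun z => ?_
  have h1 := abs_le.1 (hz (Function.update z i k))
  have h2 := abs_le.1 (hz (Function.update z i l))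
  linarith [h1.2, h2.1]

/-- The gain is at most `2 * C` times the mass for each `z`, and passing to the point mass costs
twice that bound times `offMass`. -/
theorem gainLik_le_pointLaw (h : Network lam Θ θs C dT ρ A zs P N)
    (D : Fin m × Fin m → Measure ℝ)
    (n : ℕ) {q : Fin m → Fin K → ℝ} (hq : IsMeanField q) {θ : Param p} (hθ : θ ∈ Θ)
    (i : Fin m) (k l : Fin K) :
    gainLik lam A (fun e => winData (window dT (n + 1)) (D e)) (window dT (n + 1)) θ q i k l ≤
      gainLik lam A (fun e => winData (window dT (n + 1)) (D e)) (window dT (n + 1)) θ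
        (pointLaw zs) i k l +
      4 * C * offMass q zs * blockMass (incident A i)
        (fun e => winData (window dT (n + 1)) (D e)) (window dT (n + 1)) := by
  have hz : ∀ z, |blockLik lam (incident A i) (fun e => winData (window dT (n + 1)) (D e))
      (window dT (n + 1)) θ z| ≤ C * blockMass (incident A i)
        (fun e => winData (window dT (n + 1)) (D e)) (window dT (n + 1)) := fun z =>
    h.bdd.abs_blockLik_le (fun e _ => inferInstance)
      (fun e _ => ae_winData (measurableSet_window _ _) (window_subset h.dT_pos n) _)
      (measurableSet_window _ _) (window_subset h.dT_pos n) (isBounded_window _ _) hθ z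
  unfold gainLik
  rw [mfExp_pointLaw]
  have h1 := (abs_le.1 (hq.abs_mfExp_sub_le zs (b := 2 * (C * blockMass (incident A i)
        (fun e => winData (window dT (n + 1)) (D e)) (window dT (n + 1))))
    (f := fun z => blockLik lam (incident A i) (fun e => winData (window dT (n + 1)) (D e))
      (window dT (n + 1)) θ (Function.update z i k) -
    blockLik lam (incident A i) (fun e => winData (window dT (n + 1)) (D e))
      (window dT (n + 1)) θ (Function.update z i l)) fun z => ?_)).2
  · linarith
  · refine (abs_sub _ _).trans ?_
    linarith [hz (Function.update z i k), hz (Function.update z i l)]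

/-- If the accumulated evidence favours the true labels in every window, the label laws of the
algorithm concentrate at the true labels exponentially fast. -/
theorem clampRun_concentrates (h : Network lam Θ θs C dT ρ A zs P N) (hK : 0 < K) (hm : 0 < m)
    (D : Fin m × Fin m → Measure ℝ) (η : ℕ → ℝ) (θ₀ : Param p) {q₀ : Fin m → Fin K → ℝ}
    (hq₀ : IsMeanField q₀) {π₀ : Fin K → ℝ} (hπ₀ : ∀ k, 0 < π₀ k) (hπ₁ : ∑ k, π₀ k = 1)
    {κ τ γ d R : ℝ} (hτ : τ ≤ 1 / 2) (hκ0 : 2 * C * ρ ≤ κ) (hκ : 2 * C * ρ + 4 * C * τ ≤ κ)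
    (hγ : 0 ≤ γ) (hd : 0 ≤ d) (hR₀ : ∀ k, 1 ≤ R * π₀ k) (hRm : 2 * (m : ℝ) ≤ R)
    (hsmall : m * K * (R * Real.exp (-(γ * d))) ≤ τ)
    (hE : ∀ (n : ℕ) i k, k ≠ zs i →
      excess lam dT A zs θs q₀ κ D n i k ≤ -(γ * (n * d))) (n : ℕ) :
    (clampRun lam dT A θs ρ D η θ₀ q₀ π₀ n).Pos ∧
    IsMeanField (clampRun lam dT A θs ρ D η θ₀ q₀ π₀ n).q ∧
    (1 ≤ n → offMass (clampRun lam dT A θs ρ D η θ₀ q₀ π₀ n).q zs ≤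
      m * K * (R * Real.exp (-(γ * (n * d))))) := by
  have hC := h.C_pos
  have hR0 : 0 ≤ R := le_trans (by positivity) hRm
  -- The induction also carries the evidence ratios and the comparability, up to the factor `R`, of
  -- the proportions with those of true classes; the latter prevents the prior from overwhelming the
  -- evidence.
  suffices hmain : ∀ n, (clampRun lam dT A θs ρ D η θ₀ q₀ π₀ n).Pos ∧
      IsMeanField (clampRun lam dT A θs ρ D η θ₀ q₀ π₀ n).q ∧
      (1 ≤ n → offMass (clampRun lam dT A θs ρ D η θ₀ q₀ π₀ n).q zs ≤
        m * K * (R * Real.exp (-(γ * (n * d))))) ∧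
      (∀ i k, (clampRun lam dT A θs ρ D η θ₀ q₀ π₀ n).S i k ≤
        (clampRun lam dT A θs ρ D η θ₀ q₀ π₀ n).S i (zs i) *
          Real.exp (excess lam dT A zs θs q₀ κ D n i k)) ∧
      (∀ i k, (clampRun lam dT A θs ρ D η θ₀ q₀ π₀ n).π k ≤
        R * (clampRun lam dT A θs ρ D η θ₀ q₀ π₀ n).π (zs i)) from
    ⟨(hmain n).1, (hmain n).2.1, (hmain n).2.2.1⟩
  intro n
  induction n with
  | zero =>
    refine ⟨⟨fun i k => ?_, fun k => hπ₀ k⟩, hq₀, fun h0 => absurd h0 (by norm_num),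
      fun i k => ?_, fun i k => ?_⟩
    · simp only [clampRun]
      positivity
    · simp [clampRun, excess]
    · refine le_trans ?_ (hR₀ (zs i))
      change π₀ k ≤ 1
      rw [← hπ₁]
      exact Finset.single_le_sum (fun l _ => (hπ₀ l).le) (Finset.mem_univ k)
  | succ n ih =>
    obtain ⟨hpos, hmf, hoff, hS, hπ⟩ := ih
    set s := clampRun lam dT A θs ρ D η θ₀ q₀ π₀ n with hs
    set L := clampLik lam dT A θs ρ D (n + 1) with hL
    have hs' : clampRun lam dT A θs ρ D η θ₀ q₀ π₀ (n + 1) =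
      gradStep L (clampGrad lam dT A θs ρ D (n + 1)) (A.card : ℝ) (η (n + 1)) s := rfl
    have hm0 : (0 : ℝ) ≤ m * K := by positivity
    have hgain : ∀ i k, gainLik lam A (fun e => winData (window dT (n + 1)) (D e))
        (window dT (n + 1)) (clamp θs ρ s.θ) s.q i k (zs i) ≤
        gainLik lam A (fun e => winData (window dT (n + 1)) (D e)) (window dT (n + 1)) θs
          (refLaw q₀ zs n) i k (zs i) + κ * blockMass (incident A i)
            (fun e => winData (window dT (n + 1)) (D e)) (window dT (n + 1)) := by
      intro i k
      have h1 := h.gainLik_le_of_θ D n hmf (StreamNet.clamp_mem θs h.ρ_pos s.θ) i k (zs i)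
      set M := blockMass (incident A i) (fun e => winData (window dT (n + 1)) (D e))
        (window dT (n + 1)) with hM
      have hM0 : 0 ≤ M := blockMass_nonneg _ _ _
      -- In the first window the label law is `q₀` itself and nothing is replaced; later the
      -- induction hypothesis gives `offMass ≤ τ`.
      rcases n with _ | n
      · have := mul_le_mul_of_nonneg_right hκ0 hM0
        exact h1.trans (add_le_add le_rfl this)
      · have h2 := h.gainLik_le_pointLaw D (n + 1) hmf h.θs_mem i k (zs i)
        have h3 : offMass s.q zs ≤ τ := by
          refine (hoff (Nat.le_add_left 1 n)).trans (le_trans ?_ hsmall)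
          refine mul_le_mul_of_nonneg_left (mul_le_mul_of_nonneg_left
            (Real.exp_le_exp.2 (neg_le_neg (mul_le_mul_of_nonneg_left ?_ hγ))) hR0) hm0
          refine le_mul_of_one_le_left hd ?_
          exact_mod_cast Nat.le_add_left 1 n
        have h4 : 4 * C * offMass s.q zs ≤ 4 * C * τ :=
          mul_le_mul_of_nonneg_left h3 (by positivity)
        have h5 : (2 * C * ρ + 4 * C * offMass s.q zs) * M ≤ κ * M :=
          mul_le_mul_of_nonneg_right (by linarith) hM0
        change _ ≤ gainLik lam A _ _ θs (pointLaw zs) i k (zs i) + κ * M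
        linarith
    have hT : ∀ i k, s.S i k * evidence L s i k ≤ s.S i (zs i) * evidence L s i (zs i) *
        Real.exp (excess lam dT A zs θs q₀ κ D (n + 1) i k) := by
      intro i k
      have e1 := evidence_eq_mul_exp_gainLik lam dT A θs ρ D (n + 1) hmf i k (zs i)
      have e2 : excess lam dT A zs θs q₀ κ D (n + 1) i k =
          excess lam dT A zs θs q₀ κ D n i k + (gainLik lam A
            (fun e => winData (window dT (n + 1)) (D e)) (window dT (n + 1)) θs
            (refLaw q₀ zs n) i k (zs i) + κ * blockMass (incident A i)
            (fun e => winData (window dT (n + 1)) (D e)) (window dT (n + 1))) :=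
        Finset.sum_range_succ _ _
      rw [← hL] at e1
      rw [e1, e2, Real.exp_add]
      have hev := evidence_pos L s i (zs i)
      have hSp := hpos.S i (zs i)
      calc s.S i k * (evidence L s i (zs i) * Real.exp _) ≤
          (s.S i (zs i) * Real.exp (excess lam dT A zs θs q₀ κ D n i k)) *
            (evidence L s i (zs i) * Real.exp _) :=
            mul_le_mul (hS i k) (mul_le_mul_of_nonneg_left (Real.exp_le_exp.2 (hgain i k)) hev.le)
              (by positivity) (by positivity)
        _ = _ := by ring
    have hq : ∀ i k, k ≠ zs i →
        newQ L s i k ≤ R * Real.exp (-(γ * (((n + 1 : ℕ) : ℝ) * d))) := by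
      intro i k hk
      have hev := evidence_pos L s i (zs i)
      have hSp := hpos.S i (zs i)
      have hπp := hpos.π (zs i)
      refine (hpos.newQ_le L i k (zs i)).trans (mul_le_mul ?_ ?_ ?_ hR0)
      · rw [div_le_iff₀ hπp]
        exact hπ i k
      · rw [div_le_iff₀ (by positivity)]
        have h1 := Real.exp_le_exp.2 (hE (n + 1) i k hk)
        calc evidence L s i k * s.S i k = s.S i k * evidence L s i k := mul_comm _ _
          _ ≤ _ := hT i k
          _ ≤ s.S i (zs i) * evidence L s i (zs i) *
              Real.exp (-(γ * (((n + 1 : ℕ) : ℝ) * d))) :=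
            mul_le_mul_of_nonneg_left h1 (by positivity)
          _ = _ := by ring
      · have := evidence_pos L s i k
        have := hpos.S i k
        positivity
    have hmf' : IsMeanField (newQ L s) := hpos.isMeanField_newQ L hK
    have hoff' : offMass (newQ L s) zs ≤
        m * K * (R * Real.exp (-(γ * (((n + 1 : ℕ) : ℝ) * d)))) := by
      unfold offMass
      refine (Finset.sum_le_card_nsmul Finset.univ _
        (K * (R * Real.exp (-(γ * (((n + 1 : ℕ) : ℝ) * d))))) fun i _ => ?_).trans (le_of_eq ?_)
      · refine (Finset.sum_le_card_nsmul _ _ _ fun k hk => hq i k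
          (Finset.ne_of_mem_erase hk)).trans ?_
        rw [nsmul_eq_mul]
        refine mul_le_mul_of_nonneg_right ?_ (by positivity)
        have := Finset.card_le_univ (Finset.univ.erase (zs i))
        rw [Fintype.card_fin] at this
        exact_mod_cast this
      · rw [Finset.card_univ, Fintype.card_fin, nsmul_eq_mul, mul_assoc]
    have hhalf : offMass (newQ L s) zs ≤ 1 / 2 := by
      refine hoff'.trans (le_trans ?_ (hsmall.trans hτ))
      refine mul_le_mul_of_nonneg_left (mul_le_mul_of_nonneg_left
        (Real.exp_le_exp.2 (neg_le_neg (mul_le_mul_of_nonneg_left ?_ hγ))) hR0) hm0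
      refine le_mul_of_one_le_left hd ?_
      exact_mod_cast Nat.le_add_left 1 n
    -- A class that is the true class of some node therefore has proportion at least `1 / (2 * m)`,
    -- whence the requirement `2 * m ≤ R`.
    have hqs : ∀ i, 1 / 2 ≤ newQ L s i (zs i) := by
      intro i
      have h1 := hmf'.2 i
      rw [← Finset.add_sum_erase _ _ (Finset.mem_univ (zs i))] at h1
      have h2 : ∑ k ∈ Finset.univ.erase (zs i), newQ L s i k ≤ offMass (newQ L s) zs :=
        Finset.single_le_sum (f := fun i => ∑ k ∈ Finset.univ.erase (zs i), newQ L s i k)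
          (fun j _ => Finset.sum_nonneg fun k _ => hmf'.1 j k) (Finset.mem_univ i)
      linarith
    rw [hs']
    refine ⟨⟨fun i k => mul_pos (hpos.S i k) (evidence_pos L s i k), fun k => ?_⟩, hmf',
      fun _ => hoff', hT, fun i k => ?_⟩
    · have hm' : (0 : ℝ) < m := Nat.cast_pos.2 hm
      exact mul_pos (by positivity) (Finset.sum_pos (fun j _ => hpos.newQ_pos L hK j k)
        ⟨⟨0, hm⟩, Finset.mem_univ _⟩)
    · have hm' : (0 : ℝ) < m := Nat.cast_pos.2 hm
      change 1 / (m : ℝ) * ∑ j, newQ L s j k ≤ R * (1 / (m : ℝ) * ∑ j, newQ L s j (zs i))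
      have h1 : ∑ j, newQ L s j k ≤ m := by
        refine (Finset.sum_le_card_nsmul _ _ 1 fun j _ => hmf'.le_one j k).trans (le_of_eq ?_)
        simp
      have h2 : 1 / 2 ≤ ∑ j, newQ L s j (zs i) :=
        (hqs i).trans (Finset.single_le_sum (f := fun j => newQ L s j (zs i))
          (fun j _ => hmf'.1 j _) (Finset.mem_univ i))
      calc 1 / (m : ℝ) * ∑ j, newQ L s j k ≤ 1 / (m : ℝ) * m := by gcongr
        _ = (2 * m) * (1 / (m : ℝ) * (1 / 2)) := by field_simp
        _ ≤ R * (1 / (m : ℝ) * ∑ j, newQ L s j (zs i)) := by gcongr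

end Network

/-! ### Mean measures as a deterministic data set. -/

section MeanData

variable {K p m : ℕ}

/-- The mean measures of the Poisson processes on the edges. -/
noncomputable def meanData (lam : BlockIntensity K p) (zs : Fin m → Fin K) (θs : Param p)
    (e : Fin m × Fin m) : Measure ℝ :=
  (volume.restrict (Set.Ici 0)).withDensity
    (fun t => ENNReal.ofReal (lam (zs e.1) (zs e.2) t θs))

/-- The expected change of an edge potential when node `i` is moved from class `l` to `k`. -/
noncomputable def classGain (F : Fin K → Fin K → ℝ → ℝ) (q : Fin m → Fin K → ℝ) (i : Fin m)
    (k l : Fin K) (e : Fin m × Fin m) (t : ℝ) : ℝ :=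
  mfExp q fun z => F (Function.update z i k e.1) (Function.update z i k e.2) t -
    F (Function.update z i l e.1) (Function.update z i l e.2) t

variable {lam : BlockIntensity K p} {Θ : Set (Param p)} {C : ℝ} {A : Finset (Fin m × Fin m)}
  {ν : Fin m × Fin m → Measure ℝ} {I : Set ℝ} {θ θs : Param p} {zs : Fin m → Fin K}

theorem IsMeanField.abs_classGain_le {q : Fin m → Fin K → ℝ} (hq : IsMeanField q)
    {F : Fin K → Fin K → ℝ → ℝ} {t b : ℝ} (hF : ∀ k l, |F k l t| ≤ b) (i : Fin m) (k l : Fin K)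
    (e : Fin m × Fin m) : |classGain F q i k l e t| ≤ 2 * b := by
  have hz : ∀ z : Fin m → Fin K, |F (Function.update z i k e.1) (Function.update z i k e.2) t -
    F (Function.update z i l e.1) (Function.update z i l e.2) t| ≤ 2 * b := fun z =>
    (abs_sub _ _).trans (by
      have h1 := hF (Function.update z i k e.1) (Function.update z i k e.2)
      have h2 := hF (Function.update z i l e.1) (Function.update z i l e.2)
      linarith)
  refine abs_le.2 ⟨?_, ?_⟩
  · rw [← hq.mfExp_const (-(2 * b))]
    exact hq.mfExp_mono fun z => (abs_le.1 (hz z)).1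
  · rw [← hq.mfExp_const (2 * b)]
    exact hq.mfExp_mono fun z => (abs_le.1 (hz z)).2

theorem measurable_classGain {F : Fin K → Fin K → ℝ → ℝ} (hF : ∀ k l, Measurable (F k l))
    (q : Fin m → Fin K → ℝ) (i : Fin m) (k l : Fin K) (e : Fin m × Fin m) :
    Measurable (classGain F q i k l e) :=
  Finset.measurable_sum _ fun _ _ => ((hF _ _).sub (hF _ _)).const_mul _

theorem integral_classGain {F : Fin K → Fin K → ℝ → ℝ} {μ : Measure ℝ}
    (hF : ∀ k l, Integrable (F k l) μ) (q : Fin m → Fin K → ℝ) (i : Fin m) (k l : Fin K)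
    (e : Fin m × Fin m) :
    ∫ t, classGain F q i k l e t ∂μ = mfExp q fun z =>
      (∫ t, F (Function.update z i k e.1) (Function.update z i k e.2) t ∂μ) -
      ∫ t, F (Function.update z i l e.1) (Function.update z i l e.2) t ∂μ := by
  unfold classGain mfExp
  refine (integral_finsetSum Finset.univ fun z _ => ((hF (Function.update z i k e.1)
    (Function.update z i k e.2)).sub (hF (Function.update z i l e.1)
    (Function.update z i l e.2))).const_mul _).trans (Finset.sum_congr rfl fun z _ => ?_)
  beta_reduce
  rw [integral_const_mul, integral_sub (hF _ _) (hF _ _)]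

theorem Bounded.gainLik_eq_sum (h : Bounded lam Θ C)
    (hν : ∀ e ∈ A, IsFiniteMeasure (ν e)) (hν0 : ∀ e ∈ A, ∀ᵐ t ∂(ν e), 0 ≤ t)
    (hI : MeasurableSet I) (hI0 : I ⊆ Set.Ici 0) (hIb : Bornology.IsBounded I)
    (hθ : θ ∈ Θ) (q : Fin m → Fin K → ℝ) (i : Fin m) (k l : Fin K) :
    gainLik lam A ν I θ q i k l = ∑ e ∈ incident A i,
      ((∫ t, classGain (fun k l t => Real.log (lam k l t θ)) q i k l e t ∂(ν e)) -
        ∫ t in I, classGain (fun k l t => lam k l t θ) q i k l e t) := by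
  have := isFiniteMeasure_restrict_of_isBounded hIb
  unfold gainLik blockLik
  simp_rw [← Finset.sum_sub_distrib]
  rw [mfExp_sum]
  refine Finset.sum_congr rfl fun e he => ?_
  have := hν e (incident_subset A i he)
  rw [integral_classGain fun k l => (h.smoothFamily_log k l).integrable
    (hν0 e (incident_subset A i he)) hθ, integral_classGain fun k l =>
    (h.smoothFamily k l).integrable (ae_restrict_nonneg hI hI0 _) hθ, ← mfExp_sub]
  congr 1
  ext z
  ring

theorem Bounded.setIntegral_meanData (h : Bounded lam Θ C) (hθs : θs ∈ Θ)
    (e : Fin m × Fin m) {B : Set ℝ} (hB : MeasurableSet B) (hB0 : B ⊆ Set.Ici 0) (f : ℝ → ℝ) :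
    ∫ t in B, f t ∂(meanData lam zs θs e) = ∫ t in B, f t * lam (zs e.1) (zs e.2) t θs := by
  unfold meanData
  rw [restrict_withDensity hB, Measure.restrict_restrict hB,
    Set.inter_eq_self_of_subset_left hB0,
    integral_withDensity_eq_integral_toReal_smul (h.meas _ _ θs hθs).ennreal_ofReal
      (Eventually.of_forall fun t => ENNReal.ofReal_lt_top)]
  refine setIntegral_congr_fun hB fun t ht => ?_
  simp only [smul_eq_mul]
  rw [ENNReal.toReal_ofReal (h.pos _ _ t (hB0 ht) θs hθs).le, mul_comm]

theorem Bounded.meanData_le (h : Bounded lam Θ C) (hθs : θs ∈ Θ)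
    (e : Fin m × Fin m) {B : Set ℝ} (hB : MeasurableSet B) (hB0 : B ⊆ Set.Ici 0) :
    meanData lam zs θs e B ≤ ENNReal.ofReal C * volume B := by
  unfold meanData
  rw [withDensity_apply _ hB, Measure.restrict_restrict hB,
    Set.inter_eq_self_of_subset_left hB0, ← setLIntegral_const]
  exact setLIntegral_mono' hB fun t ht => ENNReal.ofReal_le_ofReal
    (h.bound _ _ t (hB0 ht) θs hθs)

theorem Bounded.meanData_lt_top (h : Bounded lam Θ C) (hθs : θs ∈ Θ)
    (e : Fin m × Fin m) {B : Set ℝ} (hB : MeasurableSet B) (hB0 : B ⊆ Set.Ici 0)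
    (hBb : Bornology.IsBounded B) : meanData lam zs θs e B < ⊤ :=
  (h.meanData_le hθs e hB hB0).trans_lt
    (ENNReal.mul_lt_top ENNReal.ofReal_lt_top hBb.measure_lt_top)

/-- The population likelihood is the likelihood of the data set `meanData`. Identities that hold for
all finite data, such as `Bounded.excess_eq`, thus compute means by substitution. -/
theorem Bounded.popLik_eq_blockLik (h : Bounded lam Θ C) (hθs : θs ∈ Θ) {dT : ℝ} (hdT : 0 < dT)
    (n : ℕ) (θ : Param p) (z : Fin m → Fin K) :
    popLik lam dT A zs θs (n + 1) θ z =
      blockLik lam A (fun e => winData (window dT (n + 1)) (meanData lam zs θs e))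
        (window dT (n + 1)) θ z := by
  have hB := measurableSet_window dT (n + 1)
  have hB0 := window_subset hdT n
  refine Finset.sum_congr rfl fun e _ => ?_
  beta_reduce
  rw [winData_eq (h.meanData_lt_top hθs e hB hB0 (isBounded_window _ _)),
    h.setIntegral_meanData hθs e hB hB0]
  simp_rw [mul_comm]

theorem setIntegral_Ioc_eq_sum_window {dT : ℝ} (hdT : 0 < dT) {μ : Measure ℝ} {f : ℝ → ℝ}
    (hf : ∀ n : ℕ, IntegrableOn f (window dT (n + 1)) μ) (n : ℕ) :
    ∫ t in Set.Ioc 0 (n * dT), f t ∂μ =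
      ∑ r ∈ Finset.range n, ∫ t in window dT (r + 1), f t ∂μ := by
  have hw : ∀ r : ℕ, window dT (r + 1) = Set.Ioc (r * dT) ((r + 1 : ℕ) * dT) := fun r => by
    unfold window
    push_cast
    rw [add_sub_cancel_right]
  have hle : ∀ r : ℕ, (r : ℝ) * dT ≤ ((r + 1 : ℕ) : ℝ) * dT := fun r => by
    push_cast
    nlinarith
  have key := intervalIntegral.sum_integral_adjacent_intervals (μ := μ) (f := f)
    (a := fun r : ℕ => (r : ℝ) * dT) (n := n) fun r _ => by
      rw [intervalIntegrable_iff_integrableOn_Ioc_of_le (hle r), ← hw]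
      exact hf r
  rw [Nat.cast_zero, zero_mul, intervalIntegral.integral_of_le (by positivity)] at key
  rw [← key]
  refine Finset.sum_congr rfl fun r _ => ?_
  rw [intervalIntegral.integral_of_le (hle r), hw]

end MeanData

/-! ### The accumulated evidence as a Poisson integral, and its tail. -/

section Excess

variable {K p m : ℕ} {lam : BlockIntensity K p} {Θ : Set (Param p)} {C : ℝ}
  {A : Finset (Fin m × Fin m)} {θs : Param p} {zs : Fin m → Fin K} {dT : ℝ}

open Classical in
/-- The integrand of `excess` with respect to the events on an edge. -/
noncomputable def excessKernel (lam : BlockIntensity K p) (dT : ℝ) (zs : Fin m → Fin K)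
    (θs : Param p) (q₀ : Fin m → Fin K → ℝ) (κ : ℝ) (i : Fin m) (k : Fin K)
    (e : Fin m × Fin m) (t : ℝ) : ℝ :=
  (if t ≤ dT then classGain (fun k l t => Real.log (lam k l t θs)) q₀ i k (zs i) e t
    else classGain (fun k l t => Real.log (lam k l t θs)) (pointLaw zs) i k (zs i) e t) + κ

/-- The part of `excess` that does not depend on the events. -/
noncomputable def excessDrift (lam : BlockIntensity K p) (dT : ℝ) (A : Finset (Fin m × Fin m))
    (zs : Fin m → Fin K) (θs : Param p) (q₀ : Fin m → Fin K → ℝ) (κ : ℝ) (n : ℕ) (i : Fin m)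
    (k : Fin K) : ℝ :=
  ∑ r ∈ Finset.range n, ∑ e ∈ incident A i, (κ * volume.real (window dT (r + 1)) -
    ∫ t in window dT (r + 1),
      classGain (fun k l t => lam k l t θs) (refLaw q₀ zs r) i k (zs i) e t)

theorem Bounded.measurable_excessKernel (h : Bounded lam Θ C) (hθs : θs ∈ Θ)
    (q₀ : Fin m → Fin K → ℝ) (κ : ℝ) (i : Fin m) (k : Fin K) (e : Fin m × Fin m) :
    Measurable (excessKernel lam dT zs θs q₀ κ i k e) := by
  have hm : ∀ q : Fin m → Fin K → ℝ,
      Measurable (classGain (fun k l t => Real.log (lam k l t θs)) q i k (zs i) e) := fun q =>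
    measurable_classGain (fun k l => (h.smoothFamily_log k l).meas θs hθs) q i k (zs i) e
  exact (Measurable.ite measurableSet_Iic (hm q₀) (hm _)).add_const κ

theorem Bounded.abs_excessKernel_le (h : Bounded lam Θ C) (hθs : θs ∈ Θ)
    {q₀ : Fin m → Fin K → ℝ} (hq₀ : IsMeanField q₀) {κ : ℝ} (hκ : 0 ≤ κ) (i : Fin m) (k : Fin K)
    (e : Fin m × Fin m) {t : ℝ} (ht : 0 ≤ t) :
    |excessKernel lam dT zs θs q₀ κ i k e t| ≤ 2 * C + κ := by
  refine (abs_add_le _ _).trans (add_le_add ?_ (abs_of_nonneg hκ).le)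
  split_ifs
  · exact hq₀.abs_classGain_le (fun k l => h.bound_log k l t ht θs hθs) _ _ _ _
  · exact (isMeanField_pointLaw zs).abs_classGain_le
      (fun k l => h.bound_log k l t ht θs hθs) _ _ _ _

theorem excessKernel_eq (hdT : 0 < dT) (q₀ : Fin m → Fin K → ℝ) (κ : ℝ) (i : Fin m) (k : Fin K)
    (e : Fin m × Fin m) (r : ℕ) {t : ℝ} (ht : t ∈ window dT (r + 1)) :
    excessKernel lam dT zs θs q₀ κ i k e t =
      classGain (fun k l t => Real.log (lam k l t θs)) (refLaw q₀ zs r) i k (zs i) e t + κ := by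
  have h1 : (((r + 1 : ℕ) : ℝ) - 1) * dT < t := ht.1
  have h2 : t ≤ ((r + 1 : ℕ) : ℝ) * dT := ht.2
  unfold excessKernel
  rcases r with _ | r
  · rw [if_pos (by simpa using h2)]
    rfl
  · rw [if_neg]
    · rfl
    · refine not_le.2 (lt_of_le_of_lt ?_ h1)
      push_cast
      have : 0 ≤ (r : ℝ) * dT := by positivity
      linarith

/-- A single integral over all past windows plus a deterministic term, as needed for a Chernoff
bound on the whole sum. -/
theorem Bounded.excess_eq (h : Bounded lam Θ C) (hθs : θs ∈ Θ) (hdT : 0 < dT)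
    {q₀ : Fin m → Fin K → ℝ} (hq₀ : IsMeanField q₀) {κ : ℝ} (hκ : 0 ≤ κ)
    {D : Fin m × Fin m → Measure ℝ} (hD : ∀ e ∈ A, ∀ n : ℕ, D e (window dT (n + 1)) < ⊤)
    (n : ℕ) (i : Fin m) (k : Fin K) :
    excess lam dT A zs θs q₀ κ D n i k =
      ∑ e ∈ incident A i,
        ∫ t in Set.Ioc 0 (n * dT), excessKernel lam dT zs θs q₀ κ i k e t ∂(D e) +
      excessDrift lam dT A zs θs q₀ κ n i k := by
  have hfin : ∀ e ∈ A, ∀ r : ℕ, IsFiniteMeasure ((D e).restrict (window dT (r + 1))) :=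
    fun e he r => ⟨by simpa using hD e he r⟩
  have hlog : ∀ e ∈ A, ∀ r : ℕ, Integrable
      (classGain (fun k l t => Real.log (lam k l t θs)) (refLaw q₀ zs r) i k (zs i) e)
      ((D e).restrict (window dT (r + 1))) := fun e he r => by
    have := hfin e he r
    refine Integrable.of_bound (measurable_classGain
      (fun k l => (h.smoothFamily_log k l).meas θs hθs) _ _ _ _ _).aestronglyMeasurable (2 * C) ?_
    filter_upwards [ae_restrict_nonneg (measurableSet_window dT (r + 1)) (window_subset hdT r)
      (D e)] with t ht
    exact (isMeanField_refLaw hq₀ zs r).abs_classGain_le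
      (fun k l => h.bound_log k l t ht θs hθs) _ _ _ _
  have hker : ∀ e ∈ A, ∀ r : ℕ, ∫ t in window dT (r + 1),
      excessKernel lam dT zs θs q₀ κ i k e t ∂(D e) =
      (∫ t in window dT (r + 1), classGain (fun k l t => Real.log (lam k l t θs))
        (refLaw q₀ zs r) i k (zs i) e t ∂(D e)) +
      κ * ((D e).restrict (window dT (r + 1))).real Set.univ := fun e he r => by
    have := hfin e he r
    rw [setIntegral_congr_fun (measurableSet_window _ _)
      (fun t ht => excessKernel_eq hdT q₀ κ i k e r ht),
      integral_add (hlog e he r) (integrable_const _), integral_const, smul_eq_mul, mul_comm κ]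
  have hint : ∀ e ∈ A, ∀ r : ℕ, IntegrableOn (excessKernel lam dT zs θs q₀ κ i k e)
      (window dT (r + 1)) (D e) := fun e he r => by
    have := hfin e he r
    refine Integrable.of_bound (h.measurable_excessKernel hθs q₀ κ i k e).aestronglyMeasurable
      (2 * C + κ) ?_
    filter_upwards [ae_restrict_nonneg (measurableSet_window dT (r + 1)) (window_subset hdT r)
      (D e)] with t ht
    exact h.abs_excessKernel_le hθs hq₀ hκ i k e ht
  unfold excess excessDrift
  rw [Finset.sum_congr rfl fun e he => setIntegral_Ioc_eq_sum_window hdT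
    (hint e (incident_subset A i he)) n, Finset.sum_comm, ← Finset.sum_add_distrib]
  refine Finset.sum_congr rfl fun r _ => ?_
  rw [h.gainLik_eq_sum (fun e _ => inferInstance)
    (fun e _ => ae_winData (measurableSet_window _ _) (window_subset hdT r) _)
    (measurableSet_window _ _) (window_subset hdT r) (isBounded_window _ _) hθs, blockMass,
    Finset.mul_sum, ← Finset.sum_add_distrib, ← Finset.sum_add_distrib]
  refine Finset.sum_congr rfl fun e he => ?_
  have heA := incident_subset A i he
  rw [hker e heA r, winData_eq (hD e heA r)]
  ring

end Excess

namespace Network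

variable {K p m : ℕ} {Ω : Type*} [MeasurableSpace Ω] {lam : BlockIntensity K p}
  {Θ : Set (Param p)} {θs : Param p} {C dT ρ : ℝ} {A : Finset (Fin m × Fin m)}
  {zs : Fin m → Fin K} {P : Measure Ω} {N : Fin m × Fin m → Ω → Measure ℝ}

theorem mono (h : Network lam Θ θs C dT ρ A zs P N) {A' : Finset (Fin m × Fin m)} (hA : A' ⊆ A) :
    Network lam Θ θs C dT ρ A' zs P N :=
  { h with
    poisson := fun e he => h.poisson e (hA he)
    indep := h.indep.precomp (g := fun e : {e // e ∈ A'} => (⟨e.1, hA e.2⟩ : {e // e ∈ A}))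
      fun _ _ hee => Subtype.ext (congrArg (fun x : {e // e ∈ A} => x.1) hee) }

theorem lintegral_exp_sum_le [IsProbabilityMeasure P] (h : Network lam Θ θs C dT ρ A zs P N)
    {B : Set ℝ} (hB : MeasurableSet B) (hB0 : B ⊆ Set.Ici 0) (hBb : Bornology.IsBounded B)
    {f : Fin m × Fin m → ℝ → ℝ} (hf : ∀ e, Measurable (f e)) {b : ℝ} (hb : 0 ≤ b) (hb1 : b ≤ 1)
    (hfb : ∀ e, ∀ t ∈ B, |f e t| ≤ b) :
    ∫⁻ ω, ENNReal.ofReal (Real.exp (∑ e ∈ A, ∫ t in B, f e t ∂(N e ω))) ∂P ≤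
      ENNReal.ofReal (Real.exp ((∑ e ∈ A, ∫ t in B, f e t * lam (zs e.1) (zs e.2) t θs)
        + A.card * (b ^ 2 * C * volume.real B))) := by
  have key := lintegral_exp_sum_integral_le (P := P) (N := fun e : {e // e ∈ A} => N e.1)
    (r := fun e t => lam (zs e.1.1) (zs e.1.2) t θs)
    (fun e => h.poisson e.1 e.2) h.indep hB hB0 hBb
    (fun e => h.integrableOn_rate hB hB0 hBb _ _) (fun e => h.rate_nonneg hB0 _ _)
    (fun e => h.rate_le hB0 _ _) A.attach (f := fun e => f e.1) (fun e => hf e.1) hb hb1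
    (fun e => hfb e.1)
  rw [Finset.card_attach,
    Finset.sum_attach A fun e => ∫ t in B, f e t * lam (zs e.1) (zs e.2) t θs] at key
  refine le_trans (le_of_eq (lintegral_congr fun ω => ?_)) key
  rw [Finset.sum_attach A fun e => ∫ t in B, f e t ∂(N e ω)]

theorem aemeasurable_sum_integral (h : Network lam Θ θs C dT ρ A zs P N)
    {B : Set ℝ} (hB : MeasurableSet B) {f : Fin m × Fin m → ℝ → ℝ} (hf : ∀ e, Measurable (f e)) :
    AEMeasurable (fun ω => ∑ e ∈ A, ∫ t in B, f e t ∂(N e ω)) P := by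
  refine (Finset.measurable_sum _ fun e he => ?_).aemeasurable
  exact (measurable_integral_measure (hf e)).comp
    ((measurable_restrict_measure hB).comp (h.poisson e he).measurable)

theorem ae_window_lt_top (h : Network lam Θ θs C dT ρ A zs P N) :
    ∀ᵐ ω ∂P, ∀ e ∈ A, ∀ n : ℕ, N e ω (window dT (n + 1)) < ⊤ := by
  have h1 : ∀ᵐ ω ∂P, ∀ e : {e // e ∈ A}, ∀ n : ℕ, N e.1 ω (window dT (n + 1)) < ⊤ :=
    ae_all_iff.2 fun e => ae_all_iff.2 fun n => (h.poisson e.1 e.2).ae_lt_top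
      (measurableSet_window _ _) (window_subset h.dT_pos n) (isBounded_window _ _)
  filter_upwards [h1] with ω hω e he n using hω ⟨e, he⟩ n

/-- The probability that a window contains many events. -/
theorem measure_blockMass_lt_le [IsProbabilityMeasure P]
    (h : Network lam Θ θs C dT ρ A zs P N) (n : ℕ) (x : ℝ) :
    P {ω | (2 * C * dT + dT + x) * A.card <
      blockMass A (fun e => winData (window dT (n + 1)) (N e ω)) (window dT (n + 1))} ≤
      ENNReal.ofReal (Real.exp (-(x * A.card))) := by
  have hB := measurableSet_window dT (n + 1)
  have hB0 := window_subset h.dT_pos n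
  have hBb := isBounded_window dT (n + 1)
  -- With integrand one, the mean and the quadratic term contribute `C * dT` per edge each, hence `2
  -- * C * dT`.
  have h1 := h.lintegral_exp_sum_le hB hB0 hBb (f := fun _ _ => 1) (fun _ => measurable_const)
    zero_le_one le_rfl (fun e t _ => by simp)
  have h2 := measure_ge_le_exp ((2 * C * dT + x) * A.card) h1
    (h.aemeasurable_sum_integral hB fun _ => measurable_const)
  refine le_trans (measure_mono_ae ?_) (h2.trans (ENNReal.ofReal_le_ofReal
    (Real.exp_le_exp.2 ?_)))
  · filter_upwards [h.ae_window_lt_top] with ω hω hlt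
    have hlt' : (2 * C * dT + dT + x) * A.card <
      blockMass A (fun e => winData (window dT (n + 1)) (N e ω)) (window dT (n + 1)) := hlt
    change (2 * C * dT + x) * (A.card : ℝ) ≤ ∑ e ∈ A, ∫ t in window dT (n + 1), (1 : ℝ) ∂(N e ω)
    have e1 : blockMass A (fun e => winData (window dT (n + 1)) (N e ω)) (window dT (n + 1)) =
        (∑ e ∈ A, ∫ t in window dT (n + 1), (1 : ℝ) ∂(N e ω)) + A.card * dT := by
      unfold blockMass
      rw [Finset.sum_add_distrib, Finset.sum_const, nsmul_eq_mul, volume_real_window h.dT_pos]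
      congr 1
      refine Finset.sum_congr rfl fun e he => ?_
      beta_reduce
      rw [winData_eq (hω e he n), integral_const, smul_eq_mul, mul_one]
    rw [e1] at hlt'
    linarith
  · have h3 : ∀ e ∈ A, ∫ t in window dT (n + 1), 1 * lam (zs e.1) (zs e.2) t θs ≤ C * dT := by
      intro e _
      simp only [one_mul]
      have := norm_setIntegral_le_of_norm_le_const (hBb.measure_lt_top (μ := volume))
        (f := fun t => lam (zs e.1) (zs e.2) t θs) (C := C) fun t ht => by
          rw [Real.norm_of_nonneg (h.rate_nonneg hB0 _ _ t ht)]
          exact h.rate_le hB0 _ _ t ht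
      rw [volume_real_window h.dT_pos] at this
      exact (le_abs_self _).trans this
    have h4 := Finset.sum_le_card_nsmul A _ _ h3
    rw [nsmul_eq_mul] at h4
    rw [volume_real_window h.dT_pos]
    linarith

theorem gainLik_meanData [IsProbabilityMeasure P]
    (h : Network lam Θ θs C dT ρ A zs P N) (hA : 0 < A.card) (n : ℕ)
    (q : Fin m → Fin K → ℝ) (i : Fin m) (k l : Fin K) :
    gainLik lam A (fun e => winData (window dT (n + 1)) (meanData lam zs θs e))
      (window dT (n + 1)) θs q i k l =
    A.card * ((mfExp q fun z => meanLogLik lam dT A P N (n + 1) θs (Function.update z i k)) -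
      mfExp q fun z => meanLogLik lam dT A P N (n + 1) θs (Function.update z i l)) := by
  have ha : (A.card : ℝ) ≠ 0 := (Nat.cast_pos.2 hA).ne'
  rw [← mfExp_sub, ← mfExp_const_mul, gainLik]
  congr 1
  ext z
  rw [h.meanLogLik_eq n h.θs_mem, h.meanLogLik_eq n h.θs_mem,
    h.bdd.popLik_eq_blockLik h.θs_mem h.dT_pos, h.bdd.popLik_eq_blockLik h.θs_mem h.dT_pos,
    ← mul_sub, ← mul_assoc, mul_one_div_cancel ha, one_mul]
  exact (blockLik_sub_eq_incident _ _ _ _ _ fun j hj => by simp [hj]).symm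

/-- In the first window this is the initial condition, where `nodeDegree ≥ c * m ^ rd` brings in a
second factor `c`; afterwards it is identification for a label vector that is wrong at node `i`
only. -/
theorem gainLik_refLaw_le [IsProbabilityMeasure P]
    (h : Network lam Θ θs C dT ρ A zs P N) (hA : 0 < A.card)
    {q₀ : Fin m → Fin K → ℝ} (hq₀ : IsMeanField q₀) {c C' δ rd : ℝ} (hc : 0 < c) (hδ : 0 < δ)
    (hreg : Regular lam dT Θ θs A zs P N q₀ c C' δ rd) (n : ℕ) (i : Fin m) {k : Fin K}
    (hk : k ≠ zs i) :
    gainLik lam A (fun e => winData (window dT (n + 1)) (meanData lam zs θs e))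
      (window dT (n + 1)) θs (refLaw q₀ zs n) i k (zs i) ≤ -(min c (c ^ 2) * (m : ℝ) ^ rd) := by
  have ha : (0 : ℝ) < A.card := Nat.cast_pos.2 hA
  have hd : 0 ≤ (m : ℝ) ^ rd := by positivity
  rw [h.gainLik_meanData hA]
  rcases n with _ | n
  · have h1 := hreg.initial i k hk
    rw [hq₀.mfExpAt_eq, hq₀.mfExpAt_eq] at h1
    have h2 := (hreg.degree i).1
    have h3 : min c (c ^ 2) * (m : ℝ) ^ rd ≤ c ^ 2 * (m : ℝ) ^ rd :=
      mul_le_mul_of_nonneg_right (min_le_right _ _) hd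
    have h4 : c * (c * (m : ℝ) ^ rd) ≤ c * nodeDegree A i := mul_le_mul_of_nonneg_left h2 hc.le
    have h5 : A.card * ((mfExp q₀ fun z => meanLogLik lam dT A P N 1 θs (Function.update z i k)) -
      mfExp q₀ fun z => meanLogLik lam dT A P N 1 θs (Function.update z i (zs i))) ≤
        A.card * (-(c * (nodeDegree A i / A.card))) :=
      mul_le_mul_of_nonneg_left (by linarith) ha.le
    have h6 : A.card * (-(c * (nodeDegree A i / (A.card : ℝ)))) = -(c * nodeDegree A i) := by
      field_simp
    exact h5.trans (by rw [h6]; linarith)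
  · have hne : Function.update zs i k ≠ zs := fun heq => hk (by
      rw [← heq]
      simp)
    have h1 := hreg.identification _ hne θs ⟨h.θs_mem, Metric.mem_ball_self hδ⟩
    have h2 : (1 : ℝ) ≤ hammingDist (Function.update zs i k) zs := by
      exact_mod_cast hammingDist_pos.2 hne
    simp only [refLaw]
    rw [mfExp_pointLaw, mfExp_pointLaw, Function.update_eq_self,
      hreg.stationary (n + 1 + 1) (Nat.le_add_left 1 _) θs h.θs_mem,
      hreg.stationary (n + 1 + 1) (Nat.le_add_left 1 _) θs h.θs_mem]
    have h3 : min c (c ^ 2) * (m : ℝ) ^ rd ≤ c * (m : ℝ) ^ rd :=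
      mul_le_mul_of_nonneg_right (min_le_left _ _) hd
    have h4 : c * (m : ℝ) ^ rd * 1 ≤
        c * (m : ℝ) ^ rd * hammingDist (Function.update zs i k) zs :=
      mul_le_mul_of_nonneg_left h2 (by positivity)
    have h5 : A.card * (meanLogLik lam dT A P N 1 θs (Function.update zs i k) -
        meanLogLik lam dT A P N 1 θs zs) ≤ A.card * (-(c * ((m : ℝ) ^ rd *
          (hammingDist (Function.update zs i k) zs : ℝ) / A.card))) :=
      mul_le_mul_of_nonneg_left (by linarith) ha.le
    have h6 : A.card * (-(c * ((m : ℝ) ^ rd *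
          (hammingDist (Function.update zs i k) zs : ℝ) / A.card))) =
        -(c * (m : ℝ) ^ rd * hammingDist (Function.update zs i k) zs) := by
      field_simp
    exact h5.trans (by rw [h6]; linarith)

theorem excess_meanData_le [IsProbabilityMeasure P]
    (h : Network lam Θ θs C dT ρ A zs P N) (hA : 0 < A.card)
    {q₀ : Fin m → Fin K → ℝ} (hq₀ : IsMeanField q₀) {c C' δ rd : ℝ} (hc : 0 < c) (hδ : 0 < δ)
    (hreg : Regular lam dT Θ θs A zs P N q₀ c C' δ rd) {κ : ℝ} (hκ : 0 ≤ κ) (n : ℕ) (i : Fin m)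
    {k : Fin K} (hk : k ≠ zs i) :
    excess lam dT A zs θs q₀ κ (meanData lam zs θs) n i k ≤
      n * (κ * ((incident A i).card * ((C + 1) * dT)) - min c (c ^ 2) * (m : ℝ) ^ rd) := by
  unfold excess
  refine (Finset.sum_le_card_nsmul _ _ (κ * ((incident A i).card * ((C + 1) * dT)) -
    min c (c ^ 2) * (m : ℝ) ^ rd) fun r _ => ?_).trans (le_of_eq ?_)
  · have h1 := h.gainLik_refLaw_le hA hq₀ hc hδ hreg r i hk
    have h2 : blockMass (incident A i)
        (fun e => winData (window dT (r + 1)) (meanData lam zs θs e)) (window dT (r + 1)) ≤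
        (incident A i).card * ((C + 1) * dT) := by
      unfold blockMass
      refine (Finset.sum_le_card_nsmul _ _ ((C + 1) * dT) fun e _ => ?_).trans
        (le_of_eq (nsmul_eq_mul _ _))
      have hB := measurableSet_window dT (r + 1)
      have hB0 := window_subset h.dT_pos r
      beta_reduce
      rw [winData_eq (h.bdd.meanData_lt_top h.θs_mem e hB hB0 (isBounded_window _ _)),
        measureReal_restrict_apply_univ, volume_real_window h.dT_pos, add_mul, one_mul]
      refine add_le_add ?_ le_rfl
      have h3 := ENNReal.toReal_mono (ENNReal.mul_ne_top ENNReal.ofReal_ne_top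
        (isBounded_window dT (r + 1)).measure_lt_top.ne)
        (h.bdd.meanData_le (zs := zs) h.θs_mem e hB hB0)
      rwa [ENNReal.toReal_mul, ENNReal.toReal_ofReal h.C_pos.le, ← measureReal_def,
        ← measureReal_def, volume_real_window h.dT_pos] at h3
    have h3 := mul_le_mul_of_nonneg_left h2 hκ
    linarith
  · rw [Finset.card_range, nsmul_eq_mul]

/-- The probability that the accumulated evidence for a wrong class is not small. -/
theorem measure_excess_lt_le [IsProbabilityMeasure P]
    (h : Network lam Θ θs C dT ρ A zs P N) (hA : 0 < A.card)
    {q₀ : Fin m → Fin K → ℝ} (hq₀ : IsMeanField q₀) {c δ rd : ℝ} (hc : 0 < c) (hδ : 0 < δ)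
    (hreg : Regular lam dT Θ θs A zs P N q₀ c C δ rd) {κ s : ℝ} (hκ : 0 ≤ κ) (hs : 0 < s)
    (hκ1 : κ * (2 * C * ((C + 1) * dT)) ≤ min c (c ^ 2) / 4) (hs1 : s * (2 * C + κ) ≤ 1)
    (hs2 : s * ((2 * C + κ) ^ 2 * C * dT * (2 * C)) ≤ min c (c ^ 2) / 4)
    (n : ℕ) (i : Fin m) {k : Fin K} (hk : k ≠ zs i) :
    P {ω | -(min c (c ^ 2) / 4 * (n * (m : ℝ) ^ rd)) <
      excess lam dT A zs θs q₀ κ (fun e => N e ω) n i k} ≤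
      ENNReal.ofReal (Real.exp (-(s * (min c (c ^ 2) / 4) * (n * (m : ℝ) ^ rd)))) := by
  have hC := h.C_pos
  have hdT := h.dT_pos
  set c₁ := min c (c ^ 2) with hc₁
  set d := (m : ℝ) ^ rd with hd_def
  have hd : 0 ≤ d := by positivity
  have hB : MeasurableSet (Set.Ioc 0 (n * dT)) := measurableSet_Ioc
  have hB0 : Set.Ioc 0 (n * dT) ⊆ Set.Ici 0 := fun t ht => ht.1.le
  have hBb : Bornology.IsBounded (Set.Ioc 0 (n * dT)) := Metric.isBounded_Ioc _ _
  have hvol : volume.real (Set.Ioc 0 (n * dT)) = n * dT := by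
    rw [Real.volume_real_Ioc, sub_zero, max_eq_left (by positivity)]
  have hI := h.mono (incident_subset A i)
  set f : Fin m × Fin m → ℝ → ℝ := fun e t => s * excessKernel lam dT zs θs q₀ κ i k e t with hf
  have hfm : ∀ e, Measurable (f e) := fun e =>
    (h.bdd.measurable_excessKernel h.θs_mem q₀ κ i k e).const_mul s
  have h1 := hI.lintegral_exp_sum_le hB hB0 hBb hfm (b := s * (2 * C + κ)) (by positivity) hs1
    fun e t ht => by
      rw [abs_mul, abs_of_pos hs]
      exact mul_le_mul_of_nonneg_left
        (h.bdd.abs_excessKernel_le h.θs_mem hq₀ hκ i k e (hB0 ht)) hs.le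
  have hsum : ∀ D : Fin m × Fin m → Measure ℝ,
      (∀ e ∈ A, ∀ n : ℕ, D e (window dT (n + 1)) < ⊤) →
      s * excess lam dT A zs θs q₀ κ D n i k =
        ∑ e ∈ incident A i, ∫ t in Set.Ioc 0 (n * dT), f e t ∂(D e) +
        s * excessDrift lam dT A zs θs q₀ κ n i k := fun D hD => by
    rw [h.bdd.excess_eq h.θs_mem hdT hq₀ hκ hD, mul_add, Finset.mul_sum]
    simp only [hf, integral_const_mul]
  -- The same identity at the mean data eliminates `excessDrift` in favour of the mean of `excess`.
  have hmean := hsum (meanData lam zs θs) fun e _ r => h.bdd.meanData_lt_top h.θs_mem e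
    (measurableSet_window _ _) (window_subset hdT r) (isBounded_window _ _)
  have h2 := measure_ge_le_exp (s * (-(c₁ / 4 * (n * d))) -
    s * excessDrift lam dT A zs θs q₀ κ n i k) h1
    (hI.aemeasurable_sum_integral hB hfm)
  refine le_trans (measure_mono_ae ?_) (h2.trans (ENNReal.ofReal_le_ofReal
    (Real.exp_le_exp.2 ?_)))
  · filter_upwards [h.ae_window_lt_top] with ω hω hlt
    have hlt' : -(c₁ / 4 * (n * d)) < excess lam dT A zs θs q₀ κ (fun e => N e ω) n i k := hlt
    have h3 := hsum (fun e => N e ω) hω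
    have h4 := mul_le_mul_of_nonneg_left hlt'.le hs.le
    change s * (-(c₁ / 4 * (n * d))) - s * excessDrift lam dT A zs θs q₀ κ n i k ≤
      ∑ e ∈ incident A i, ∫ t in Set.Ioc 0 (n * dT), f e t ∂(N e ω)
    linarith
  · have h3 := h.excess_meanData_le hA hq₀ hc hδ hreg hκ n i hk
    have h5 : ∑ e ∈ incident A i, ∫ t in Set.Ioc 0 (n * dT),
        f e t * lam (zs e.1) (zs e.2) t θs =
        ∑ e ∈ incident A i, ∫ t in Set.Ioc 0 (n * dT), f e t ∂(meanData lam zs θs e) :=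
      Finset.sum_congr rfl fun e _ => (h.bdd.setIntegral_meanData h.θs_mem e hB hB0 _).symm
    have hcard : ((incident A i).card : ℝ) ≤ 2 * C * d := by
      have h6 : ((incident A i).card : ℝ) ≤ 2 * nodeDegree A i := by
        exact_mod_cast card_incident_le A i
      linarith [(hreg.degree i).2]
    rw [h5, hvol]
    have h7 : κ * ((incident A i).card * ((C + 1) * dT)) ≤ c₁ / 4 * d := by
      calc κ * ((incident A i).card * ((C + 1) * dT)) ≤ κ * ((2 * C * d) * ((C + 1) * dT)) :=
            mul_le_mul_of_nonneg_left (mul_le_mul_of_nonneg_right hcard (by positivity)) hκ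
        _ = κ * (2 * C * ((C + 1) * dT)) * d := by ring
        _ ≤ c₁ / 4 * d := mul_le_mul_of_nonneg_right hκ1 hd
    have h8 : (incident A i).card * ((s * (2 * C + κ)) ^ 2 * C * (n * dT)) ≤
        s * (n * (c₁ / 4 * d)) := by
      calc (incident A i).card * ((s * (2 * C + κ)) ^ 2 * C * (n * dT)) ≤
            2 * C * d * ((s * (2 * C + κ)) ^ 2 * C * (n * dT)) :=
            mul_le_mul_of_nonneg_right hcard (by positivity)
        _ = s * (n * (s * ((2 * C + κ) ^ 2 * C * dT * (2 * C)) * d)) := by ring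
        _ ≤ s * (n * (c₁ / 4 * d)) := mul_le_mul_of_nonneg_left (mul_le_mul_of_nonneg_left
            (mul_le_mul_of_nonneg_right hs2 hd) (Nat.cast_nonneg n)) hs.le
    have h9 : s * excess lam dT A zs θs q₀ κ (meanData lam zs θs) n i k ≤
        s * (n * (c₁ / 4 * d - c₁ * d)) :=
      mul_le_mul_of_nonneg_left (h3.trans (mul_le_mul_of_nonneg_left (by linarith)
        (Nat.cast_nonneg n))) hs.le
    -- Of the mean decrement `c₁ * n * d`, one quarter is lost to `κ`, one to the quadratic term and
    -- one to the threshold; the last is the exponent.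
    have e1 : s * (n * (c₁ / 4 * d - c₁ * d)) + s * (n * (c₁ / 4 * d)) - s * (-(c₁ / 4 * (n * d)))
        = -(s * (c₁ / 4) * (n * d)) := by ring
    linarith

end Network

/-! ### Behaviour of the algorithm on good data. -/

/-- The gradient noise along the algorithm, passed through the linear filter. -/
noncomputable def filteredNoise {K p m : ℕ} (lam : BlockIntensity K p) (dT : ℝ)
    (A : Finset (Fin m × Fin m)) (zs : Fin m → Fin K) (θs : Param p) (ρ c α : ℝ) (θ₀ : Param p)
    (q₀ : Fin m → Fin K → ℝ) (π₀ : Fin K → ℝ) (D : Fin m × Fin m → Measure ℝ) (n : ℕ) : Param p :=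
  linFilter c α (fun n => gradNoise lam dT A zs θs ρ D (n + 1)
    (clampRun lam dT A θs ρ D (fun j => (j : ℝ) ^ (-α)) θ₀ q₀ π₀ n).θ) n

/-- The event data for which the algorithm can be controlled in all windows. -/
structure GoodData {K p m : ℕ} (lam : BlockIntensity K p) (dT : ℝ)
    (A : Finset (Fin m × Fin m)) (zs : Fin m → Fin K) (θs : Param p) (ρ c α : ℝ) (θ₀ : Param p)
    (q₀ : Fin m → Fin K → ℝ) (π₀ : Fin K → ℝ) (κ γ d b u₀ : ℝ)
    (D : Fin m × Fin m → Measure ℝ) : Prop where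
  finite : ∀ e ∈ A, ∀ n : ℕ, D e (window dT (n + 1)) < ⊤
  evidence : ∀ (n : ℕ) i k, k ≠ zs i → excess lam dT A zs θs q₀ κ D n i k ≤ -(γ * (n * d))
  mass : ∀ n : ℕ, blockMass A (fun e => winData (window dT (n + 1)) (D e)) (window dT (n + 1)) ≤
    (b + ((n + 1 : ℕ) : ℝ)) * A.card
  noise : ∀ n, ‖filteredNoise lam dT A zs θs ρ c α θ₀ q₀ π₀ D n‖ ≤ u₀

namespace Network

variable {K p m : ℕ} {Ω : Type*} [MeasurableSpace Ω] {lam : BlockIntensity K p}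
  {Θ : Set (Param p)} {θs : Param p} {C dT ρ : ℝ} {A : Finset (Fin m × Fin m)}
  {zs : Fin m → Fin K} {P : Measure Ω} {N : Fin m × Fin m → Ω → Measure ℝ}

/-- The events per edge grow at most linearly in `n`, while the mass on wrong labels decays
exponentially. -/
theorem norm_labelError_le_of_goodData (h : Network lam Θ θs C dT ρ A zs P N) (hK : 0 < K)
    (hm : 0 < m) (hA : 0 < A.card) {q₀ : Fin m → Fin K → ℝ}
    (hq₀ : IsMeanField q₀) {π₀ : Fin K → ℝ} (hπ₀ : ∀ k, 0 < π₀ k) (hπ₁ : ∑ k, π₀ k = 1)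
    {θ₀ : Param p} {c α κ γ d b u₀ τ R rr : ℝ} {D : Fin m × Fin m → Measure ℝ}
    (hD : GoodData lam dT A zs θs ρ c α θ₀ q₀ π₀ κ γ d b u₀ D)
    (hτ : τ ≤ 1 / 2) (hκ0 : 2 * C * ρ ≤ κ) (hκ : 2 * C * ρ + 4 * C * τ ≤ κ)
    (hγ : 0 ≤ γ) (hd : 0 ≤ d) (hb : 0 ≤ b) (hR₀ : ∀ k, 1 ≤ R * π₀ k) (hRm : 2 * (m : ℝ) ≤ R)
    (hsmall : m * K * (R * Real.exp (-(γ * d))) ≤ τ)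
    (hrr : ∀ n : ℕ, 2 * C * (b + ((n + 1 : ℕ) : ℝ)) *
      (m * K * (R * Real.exp (-(γ * (((n + 1 : ℕ) : ℝ) * d))))) ≤ rr) (n : ℕ) :
    ‖labelError lam dT A zs θs ρ D (n + 1)
      (clampRun lam dT A θs ρ D (fun j => (j : ℝ) ^ (-α)) θ₀ q₀ π₀ (n + 1)).q
      (clampRun lam dT A θs ρ D (fun j => (j : ℝ) ^ (-α)) θ₀ q₀ π₀ n).θ‖ ≤ rr := by
  have hC := h.C_pos
  have ha : (0 : ℝ) < A.card := Nat.cast_pos.2 hA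
  obtain ⟨-, hmf, hoff⟩ := h.clampRun_concentrates hK hm D (fun j => (j : ℝ) ^ (-α)) θ₀ hq₀ hπ₀ hπ₁
    hτ hκ0 hκ hγ hd hR₀ hRm hsmall hD.evidence (n + 1)
  refine (h.norm_labelError_le D (n + 1) hmf _).trans (le_trans ?_ (hrr n))
  have h1 := hoff (Nat.le_add_left 1 n)
  have h2 := hD.mass n
  have h3 := hmf.offMass_nonneg zs
  calc _ ≤ (1 / (A.card : ℝ)) * (2 * (C * ((b + ((n + 1 : ℕ) : ℝ)) * A.card)) *
        offMass (clampRun lam dT A θs ρ D (fun j => (j : ℝ) ^ (-α)) θ₀ q₀ π₀ (n + 1)).q zs) := by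
        gcongr
    _ = 2 * C * (b + ((n + 1 : ℕ) : ℝ)) *
        offMass (clampRun lam dT A θs ρ D (fun j => (j : ℝ) ^ (-α)) θ₀ q₀ π₀ (n + 1)).q zs := by
        field_simp
    _ ≤ _ := mul_le_mul_of_nonneg_left h1 (by positivity)

/-- The constant of the stability estimate for the stochastic gradient recursion, together with
the resulting bound for the algorithm on good data. -/
theorem exists_run_bound {c C dT α : ℝ} (hc : 0 < c) (hα : 0 < α) (hα1 : α < 1) (p : ℕ) :
    ∃ B : ℝ, 0 < B ∧
      (∀ n, linRec (sgdFactor (min c 1) (C ^ 2 * dT) α)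
        (fun n => ((n + 1 : ℕ) : ℝ) ^ (-α)) n ≤ B) ∧
      ∀ {K m : ℕ} {Ω : Type*} [MeasurableSpace Ω] {lam : BlockIntensity K p}
        {Θ : Set (Param p)} {θs : Param p} {ρ : ℝ} {A : Finset (Fin m × Fin m)}
        {zs : Fin m → Fin K} {P : Measure Ω} [IsProbabilityMeasure P]
        {N : Fin m × Fin m → Ω → Measure ℝ} {q₀ : Fin m → Fin K → ℝ} {δ rd : ℝ},
        Network lam Θ θs C dT ρ A zs P N → 0 < δ → ρ ≤ δ →
        Regular lam dT Θ θs A zs P N q₀ c C δ rd →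
        ∀ {θ₀ : Param p} {π₀ : Fin K → ℝ} {κ γ d b u₀ rr : ℝ} {D : Fin m × Fin m → Measure ℝ},
        GoodData lam dT A zs θs ρ (min c 1) α θ₀ q₀ π₀ κ γ d b u₀ D →
        (∀ n, ‖labelError lam dT A zs θs ρ D (n + 1)
          (clampRun lam dT A θs ρ D (fun j => (j : ℝ) ^ (-α)) θ₀ q₀ π₀ (n + 1)).q
          (clampRun lam dT A θs ρ D (fun j => (j : ℝ) ^ (-α)) θ₀ q₀ π₀ n).θ‖ ≤ rr) →
        B * (‖θ₀ - θs‖ + u₀ + rr) < ρ → ∀ n, 1 ≤ n →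
        ‖(run lam dT A D (fun j => (j : ℝ) ^ (-α)) θ₀ q₀ π₀ n).θ - θs‖ ≤
          B * ((n : ℝ) ^ (-α) * ‖θ₀ - θs‖ +
          Real.sqrt (linRec (sgdFactor (min c 1) (C ^ 2 * dT) α)
            (fun k => ((k + 1 : ℕ) : ℝ) ^ (-α) *
              (‖filteredNoise lam dT A zs θs ρ (min c 1) α θ₀ q₀ π₀ D k‖ ^ 2 + rr ^ 2)) n)) +
          ‖filteredNoise lam dT A zs θs ρ (min c 1) α θ₀ q₀ π₀ D n‖ := by
  -- The stability estimate needs a constant at most one; lowering `c` to `min c 1` only weakens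
  -- monotonicity.
  obtain ⟨B, hB0, hB, hmain⟩ := exists_sgd_bound (E := Param p) (L := C ^ 2 * dT)
    (lt_min hc zero_lt_one) (min_le_right c 1) hα hα1
  refine ⟨B, hB0, hB, ?_⟩
  intro K m Ω _ lam Θ θs ρ A zs P _ N q₀ δ rd h hδ hρδ hreg θ₀ π₀ κ γ d b u₀ rr D hD hr hB' n hn
  set s := clampRun lam dT A θs ρ D (fun j => (j : ℝ) ^ (-α)) θ₀ q₀ π₀ with hs
  have key := hmain (fun n => (s n).θ - θs)
    (filteredNoise lam dT A zs θs ρ (min c 1) α θ₀ q₀ π₀ D)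
    (fun n => gradNoise lam dT A zs θs ρ D (n + 1) (s n).θ)
    (fun n => labelError lam dT A zs θs ρ D (n + 1) (s (n + 1)).q (s n).θ)
    (fun n => popGrad lam dT A zs θs (n + 1) (clamp θs ρ (s n).θ)) ρ rr u₀
    (fun n => clampRun_succ_θ D (fun j => (j : ℝ) ^ (-α)) θ₀ q₀ π₀ n) rfl (fun n => rfl)
    (fun n hn => ?_) hr hD.noise hB'
  -- The confinement just obtained for all windows identifies the retracted algorithm with the
  -- original one.
  · rw [h.bdd.run_eq_clampRun h.isOpen h.dT_pos h.ρ_pos h.ball hD.finite _ _ _ _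
      fun n => (key n).1]
    exact (key n).2 hn
  · rw [clamp_eq h.ρ_pos hn.le]
    have hmem : (s n).θ ∈ Metric.closedBall θs ρ := mem_closedBall_iff_norm.2 hn.le
    refine ⟨(h.inner_popGrad_le hδ hreg n (h.ball hmem)
      (mem_ball_iff_norm.2 (hn.trans_le hρδ))).trans ?_, h.norm_popGrad_le n hmem⟩
    have := mul_le_mul_of_nonneg_right (min_le_left c 1) (sq_nonneg ‖(s n).θ - θs‖)
    linarith

theorem measurable_filteredNoise (h : Network lam Θ θs C dT ρ A zs P N) (c α : ℝ) (θ₀ : Param p)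
    (q₀ : Fin m → Fin K → ℝ) (π₀ : Fin K → ℝ) (n : ℕ) :
    Measurable fun ω => filteredNoise lam dT A zs θs ρ c α θ₀ q₀ π₀ (fun e => N e ω) n :=
  (h.measurable_linFilter (fun n =>
      h.measurable_gradNoise (mΩ' := past dT A N (n + 1)) n
        ((h.measurable_clampRun_θ _ θ₀ q₀ π₀ n).mono (h.past_mono n) le_rfl)
        (fun _ he => h.measurable_past_winData n he)) c α n).mono (h.past_le n) le_rfl

theorem isFilteredNoise_filteredNoise [IsProbabilityMeasure P]
    (h : Network lam Θ θs C dT ρ A zs P N) (hA : 0 < A.card) (c α : ℝ) (θ₀ : Param p)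
    (q₀ : Fin m → Fin K → ℝ) (π₀ : Fin K → ℝ) (j : Fin p) :
    IsFilteredNoise P c α (1 / C) (C ^ 3 * dT) A.card
      (fun n ω => filteredNoise lam dT A zs θs ρ c α θ₀ q₀ π₀ (fun e => N e ω) n j)
      (fun n ω => gradNoise lam dT A zs θs ρ (fun e => N e ω) (n + 1)
        (clampRun lam dT A θs ρ (fun e => N e ω) (fun j => (j : ℝ) ^ (-α)) θ₀ q₀ π₀ n).θ j) :=
  h.isFilteredNoise hA (fun n => h.measurable_clampRun_θ _ θ₀ q₀ π₀ n) c α j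

end Network

/-! ### Moment bounds, and the probability of bad data. -/

section Moments

variable {Ω : Type*} [MeasurableSpace Ω] {P : Measure Ω}

/-- The recursion is linear in its input with non-negative coefficients, so it commutes with
expectations. -/
theorem lintegral_linRec_le {a w : ℕ → ℝ} {f : ℕ → Ω → ℝ} {M : ℝ} (hM : 0 ≤ M)
    (ha : ∀ n, 0 ≤ a n) (hw : ∀ n, 0 ≤ w n) (hf : ∀ n, Measurable (f n)) (hf0 : ∀ n ω, 0 ≤ f n ω)
    (hfM : ∀ n, ∫⁻ ω, ENNReal.ofReal (f n ω) ∂P ≤ ENNReal.ofReal M) (n : ℕ) :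
    Measurable (fun ω => linRec a (fun k => w k * f k ω) n) ∧
    ∫⁻ ω, ENNReal.ofReal (linRec a (fun k => w k * f k ω) n) ∂P ≤
      ENNReal.ofReal (M * linRec a w n) := by
  induction n with
  | zero => simp [linRec]
  | succ n ih =>
    obtain ⟨hm, hi⟩ := ih
    have h0 : ∀ ω, 0 ≤ linRec a (fun k => w k * f k ω) n := fun ω =>
      linRec_nonneg ha (fun k => mul_nonneg (hw k) (hf0 k ω)) n
    have hm1 : Measurable fun ω => a (n + 1) * linRec a (fun k => w k * f k ω) n :=
      hm.const_mul _
    refine ⟨hm1.add ((hf n).const_mul _), ?_⟩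
    simp only [linRec]
    calc ∫⁻ ω, ENNReal.ofReal (a (n + 1) * linRec a (fun k => w k * f k ω) n + w n * f n ω) ∂P
        = ∫⁻ ω, (ENNReal.ofReal (a (n + 1)) * ENNReal.ofReal (linRec a (fun k => w k * f k ω) n) +
            ENNReal.ofReal (w n) * ENNReal.ofReal (f n ω)) ∂P := by
          refine lintegral_congr fun ω => ?_
          rw [ENNReal.ofReal_add (mul_nonneg (ha _) (h0 ω)) (mul_nonneg (hw _) (hf0 n ω)),
            ENNReal.ofReal_mul (ha _), ENNReal.ofReal_mul (hw _)]
      _ = ENNReal.ofReal (a (n + 1)) *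
            ∫⁻ ω, ENNReal.ofReal (linRec a (fun k => w k * f k ω) n) ∂P +
          ENNReal.ofReal (w n) * ∫⁻ ω, ENNReal.ofReal (f n ω) ∂P := by
          rw [lintegral_add_left (hm.ennreal_ofReal.const_mul _),
            lintegral_const_mul _ hm.ennreal_ofReal,
            lintegral_const_mul _ (hf n).ennreal_ofReal]
      _ ≤ ENNReal.ofReal (a (n + 1)) * ENNReal.ofReal (M * linRec a w n) +
          ENNReal.ofReal (w n) * ENNReal.ofReal M := by
          gcongr
          exact hfM n
      _ = ENNReal.ofReal (M * (a (n + 1) * linRec a w n + w n)) := by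
          rw [← ENNReal.ofReal_mul (ha _), ← ENNReal.ofReal_mul (hw _), ← ENNReal.ofReal_add]
          · congr 1
            ring
          · exact mul_nonneg (ha _) (mul_nonneg hM (linRec_nonneg ha hw n))
          · exact mul_nonneg (hw _) hM

theorem measure_lt_le_of_lintegral_le {f : Ω → ℝ} (hf : Measurable f) {M x ε : ℝ} (hx : 0 < x)
    (h : ∫⁻ ω, ENNReal.ofReal (f ω) ∂P ≤ ENNReal.ofReal M) (hM : M ≤ x * ε) :
    P {ω | x < f ω} ≤ ENNReal.ofReal ε := by
  have h1 := mul_meas_ge_le_lintegral₀ (μ := P) hf.ennreal_ofReal.aemeasurable (ENNReal.ofReal x)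
  have h2 : ENNReal.ofReal x * P {ω | x < f ω} ≤ ENNReal.ofReal x * ENNReal.ofReal ε := by
    rw [← ENNReal.ofReal_mul hx.le]
    refine le_trans (mul_le_mul_right (measure_mono fun ω hω => ?_) _)
      (h1.trans (h.trans (ENNReal.ofReal_le_ofReal hM)))
    exact ENNReal.ofReal_le_ofReal (le_of_lt (show x < f ω from hω))
  exact (ENNReal.mul_le_mul_iff_right (by simpa using hx) ENNReal.ofReal_ne_top).1 h2

theorem lintegral_norm_sq_le {p : ℕ} {U : Ω → Param p} (hU : Measurable U) {M : ℝ}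
    (h : ∀ j, ∫⁻ ω, ENNReal.ofReal (U ω j ^ 2) ∂P ≤ ENNReal.ofReal M) :
    ∫⁻ ω, ENNReal.ofReal (‖U ω‖ ^ 2) ∂P ≤ ENNReal.ofReal (p * M) := by
  calc ∫⁻ ω, ENNReal.ofReal (‖U ω‖ ^ 2) ∂P
      = ∫⁻ ω, ∑ j, ENNReal.ofReal (U ω j ^ 2) ∂P := by
        refine lintegral_congr fun ω => ?_
        rw [EuclideanSpace.norm_sq_eq, ENNReal.ofReal_sum_of_nonneg fun j _ => sq_nonneg _]
        simp
    _ = ∑ j, ∫⁻ ω, ENNReal.ofReal (U ω j ^ 2) ∂P :=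
        lintegral_finsetSum _ fun j _ =>
          ((measurable_euclidean_iff.1 hU j).pow_const 2).ennreal_ofReal
    _ ≤ ∑ _j : Fin p, ENNReal.ofReal M := Finset.sum_le_sum fun j _ => h j
    _ = ENNReal.ofReal (p * M) := by
        rw [Finset.sum_const, Finset.card_univ, Fintype.card_fin, nsmul_eq_mul,
          ENNReal.ofReal_mul (Nat.cast_nonneg p), ENNReal.ofReal_natCast]

theorem norm_le_of_abs_le {p : ℕ} {x : Param p} {b : ℝ} (hb : ∀ j, |x j| ≤ b) :
    ‖x‖ ≤ p * b := by
  have h1 : ‖x‖ ≤ ∑ j, |x j| := by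
    have hx : x = ∑ j, EuclideanSpace.single j (x j) := by
      ext i
      simp [Finset.sum_apply, Pi.single_apply]
    conv_lhs => rw [hx]
    exact (norm_sum_le _ _).trans (le_of_eq (Finset.sum_congr rfl fun j _ => by simp))
  exact h1.trans ((Finset.sum_le_card_nsmul _ _ b fun j _ => hb j).trans (le_of_eq (by simp)))

end Moments

namespace Network

variable {K p m : ℕ} {Ω : Type*} [MeasurableSpace Ω] {lam : BlockIntensity K p}
  {Θ : Set (Param p)} {θs : Param p} {C dT ρ : ℝ} {A : Finset (Fin m × Fin m)}
  {zs : Fin m → Fin K} {P : Measure Ω} {N : Fin m × Fin m → Ω → Measure ℝ}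

/-- Union bound over windows, nodes and classes: half of the exponent `2 * s'` absorbs the `m * K`
pairs, the other half is summed over windows. -/
theorem measure_exists_excess_le [IsProbabilityMeasure P]
    (h : Network lam Θ θs C dT ρ A zs P N) (hA : 0 < A.card)
    {q₀ : Fin m → Fin K → ℝ} (hq₀ : IsMeanField q₀) {c δ rd : ℝ} (hc : 0 < c) (hδ : 0 < δ)
    (hreg : Regular lam dT Θ θs A zs P N q₀ c C δ rd) {κ s s' : ℝ} (hκ : 0 ≤ κ) (hs : 0 < s)
    (hκ1 : κ * (2 * C * ((C + 1) * dT)) ≤ min c (c ^ 2) / 4) (hs1 : s * (2 * C + κ) ≤ 1)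
    (hs2 : s * ((2 * C + κ) ^ 2 * C * dT * (2 * C)) ≤ min c (c ^ 2) / 4)
    (hs' : 2 * s' = s * (min c (c ^ 2) / 4)) (hs'0 : 0 ≤ s')
    (hmK : m * K * Real.exp (-(s' * (m : ℝ) ^ rd)) ≤ 1) {ε : ENNReal}
    (hε : ∑' n : ℕ, ENNReal.ofReal (Real.exp (-(s' * (m : ℝ) ^ rd * ((n + 1 : ℕ) : ℝ) ^ (1 : ℝ))))
      ≤ ε) :
    P {ω | ∃ (n : ℕ) (i : Fin m) (k : Fin K), k ≠ zs i ∧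
      -(min c (c ^ 2) / 4 * (n * (m : ℝ) ^ rd)) <
        excess lam dT A zs θs q₀ κ (fun e => N e ω) n i k} ≤ ε := by
  set d := (m : ℝ) ^ rd with hd_def
  have hd : 0 ≤ d := by positivity
  let E : ℕ → Fin m → Fin K → Set Ω := fun n i k => {ω | k ≠ zs i ∧
      -(min c (c ^ 2) / 4 * (((n + 1 : ℕ) : ℝ) * d)) <
        excess lam dT A zs θs q₀ κ (fun e => N e ω) (n + 1) i k}
  have hE : ∀ n i k, P (E n i k) ≤
      ENNReal.ofReal (Real.exp (-(2 * s' * (((n + 1 : ℕ) : ℝ) * d)))) := fun n i k => by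
    by_cases hk : k = zs i
    · have : E n i k = ∅ := Set.eq_empty_of_forall_notMem fun ω hω => hω.1 hk
      rw [this, measure_empty]
      exact bot_le
    · rw [hs']
      exact (measure_mono fun ω hω => hω.2).trans
        (h.measure_excess_lt_le hA hq₀ hc hδ hreg hκ hs hκ1 hs1 hs2 (n + 1) i hk)
  refine le_trans (measure_mono (t := ⋃ n, ⋃ i, ⋃ k, E n i k) ?_)
    ((measure_iUnion_le _).trans (le_trans (ENNReal.tsum_le_tsum fun n => ?_) hε))
  · rintro ω ⟨n, i, k, hk, hlt⟩
    -- For `n = 0` both sides of the inequality vanish.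
    rcases n with _ | n
    · simp [excess] at hlt
    · exact Set.mem_iUnion.2 ⟨n, Set.mem_iUnion.2 ⟨i, Set.mem_iUnion.2 ⟨k, hk, hlt⟩⟩⟩
  · have h1 : P (⋃ i, ⋃ k, E n i k) ≤ ∑ _i : Fin m, ∑ _k : Fin K,
        ENNReal.ofReal (Real.exp (-(2 * s' * (((n + 1 : ℕ) : ℝ) * d)))) :=
      (measure_iUnion_fintype_le _ _).trans (Finset.sum_le_sum fun i _ =>
        (measure_iUnion_fintype_le _ _).trans (Finset.sum_le_sum fun k _ => hE n i k))
    refine h1.trans ?_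
    simp only [Finset.sum_const, Finset.card_univ, Fintype.card_fin, nsmul_eq_mul]
    rw [← ENNReal.ofReal_natCast, ← ENNReal.ofReal_natCast, ← ENNReal.ofReal_mul (by positivity),
      ← ENNReal.ofReal_mul (by positivity), Real.rpow_one]
    refine ENNReal.ofReal_le_ofReal ?_
    have hn : (1 : ℝ) ≤ ((n + 1 : ℕ) : ℝ) := by exact_mod_cast Nat.le_add_left 1 n
    have hx : s' * d ≤ s' * d * ((n + 1 : ℕ) : ℝ) := le_mul_of_one_le_right (by positivity) hn
    have e1 : Real.exp (-(2 * s' * (((n + 1 : ℕ) : ℝ) * d))) =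
        Real.exp (-(s' * d * ((n + 1 : ℕ) : ℝ))) * Real.exp (-(s' * d * ((n + 1 : ℕ) : ℝ))) := by
      rw [← Real.exp_add]
      congr 1
      ring
    have h2 : Real.exp (-(s' * d * ((n + 1 : ℕ) : ℝ))) ≤ Real.exp (-(s' * d)) :=
      Real.exp_le_exp.2 (neg_le_neg hx)
    calc (m : ℝ) * (K * Real.exp (-(2 * s' * (((n + 1 : ℕ) : ℝ) * d)))) =
        m * K * Real.exp (-(s' * d * ((n + 1 : ℕ) : ℝ))) *
          Real.exp (-(s' * d * ((n + 1 : ℕ) : ℝ))) := by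
          rw [e1]
          ring
      _ ≤ 1 * Real.exp (-(s' * d * ((n + 1 : ℕ) : ℝ))) :=
          mul_le_mul_of_nonneg_right ((mul_le_mul_of_nonneg_left h2 (by positivity)).trans hmK)
            (Real.exp_pos _).le
      _ = _ := one_mul _

theorem measure_exists_blockMass_le [IsProbabilityMeasure P]
    (h : Network lam Θ θs C dT ρ A zs P N) {ε : ENNReal}
    (hε : ∑' n : ℕ, ENNReal.ofReal (Real.exp (-(1 * (A.card : ℝ) * ((n + 1 : ℕ) : ℝ) ^ (1 : ℝ))))
      ≤ ε) :
    P {ω | ∃ n : ℕ, (2 * C * dT + dT + ((n + 1 : ℕ) : ℝ)) * A.card <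
      blockMass A (fun e => winData (window dT (n + 1)) (N e ω)) (window dT (n + 1))} ≤ ε := by
  have hset : {ω | ∃ n : ℕ, (2 * C * dT + dT + ((n + 1 : ℕ) : ℝ)) * A.card <
      blockMass A (fun e => winData (window dT (n + 1)) (N e ω)) (window dT (n + 1))} =
      ⋃ n : ℕ, {ω | (2 * C * dT + dT + ((n + 1 : ℕ) : ℝ)) * A.card <
      blockMass A (fun e => winData (window dT (n + 1)) (N e ω)) (window dT (n + 1))} :=
    Set.ofPred_exists _
  rw [hset]
  refine (measure_iUnion_le _).trans (le_trans (ENNReal.tsum_le_tsum fun n => ?_) hε)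
  rw [Real.rpow_one, one_mul, mul_comm (A.card : ℝ)]
  exact h.measure_blockMass_lt_le n _

/-- Coordinatewise; the divisor `p + 1` instead of `p` admits `p = 0`. -/
theorem measure_exists_filteredNoise_le (c α : ℝ) (θ₀ : Param p)
    (q₀ : Fin m → Fin K → ℝ) (π₀ : Fin K → ℝ) {u₀ : ℝ} (hu₀ : 0 ≤ u₀) {ε : ENNReal}
    (hε : ∀ j, P {ω | ∃ n, u₀ / (p + 1) <
      |filteredNoise lam dT A zs θs ρ c α θ₀ q₀ π₀ (fun e => N e ω) n j|} ≤ ε) :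
    P {ω | ∃ n, u₀ < ‖filteredNoise lam dT A zs θs ρ c α θ₀ q₀ π₀ (fun e => N e ω) n‖} ≤
      p * ε := by
  have hsub : {ω | ∃ n, u₀ < ‖filteredNoise lam dT A zs θs ρ c α θ₀ q₀ π₀ (fun e => N e ω) n‖} ⊆
      ⋃ j : Fin p, {ω | ∃ n, u₀ / (p + 1) <
        |filteredNoise lam dT A zs θs ρ c α θ₀ q₀ π₀ (fun e => N e ω) n j|} := by
    rintro ω ⟨n, hn⟩
    by_contra hcon
    have h1 : ∀ j, |filteredNoise lam dT A zs θs ρ c α θ₀ q₀ π₀ (fun e => N e ω) n j| ≤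
        u₀ / (p + 1) := fun j => not_lt.1 fun hlt =>
      hcon (Set.mem_iUnion.2 ⟨j, n, hlt⟩)
    have h2 := norm_le_of_abs_le h1
    have h3 : p * (u₀ / (p + 1)) ≤ u₀ := by
      rw [← mul_div_assoc, div_le_iff₀ (by positivity)]
      linarith
    exact absurd hn (not_lt.2 (h2.trans h3))
  refine (measure_mono hsub).trans ((measure_iUnion_fintype_le _ _).trans
    ((Finset.sum_le_sum fun j _ => hε j).trans (le_of_eq ?_)))
  simp

theorem measure_not_goodData_le (h : Network lam Θ θs C dT ρ A zs P N) (c α : ℝ) (θ₀ : Param p)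
    (q₀ : Fin m → Fin K → ℝ) (π₀ : Fin K → ℝ) (κ γ d b u₀ : ℝ) {ε₁ ε₂ ε₃ : ENNReal}
    (h₁ : P {ω | ∃ (n : ℕ) (i : Fin m) (k : Fin K), k ≠ zs i ∧ -(γ * (n * d)) <
        excess lam dT A zs θs q₀ κ (fun e => N e ω) n i k} ≤ ε₁)
    (h₂ : P {ω | ∃ n : ℕ, (b + ((n + 1 : ℕ) : ℝ)) * A.card <
      blockMass A (fun e => winData (window dT (n + 1)) (N e ω)) (window dT (n + 1))} ≤ ε₂)
    (h₃ : P {ω | ∃ n, u₀ <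
      ‖filteredNoise lam dT A zs θs ρ c α θ₀ q₀ π₀ (fun e => N e ω) n‖} ≤ ε₃) :
    P {ω | ¬ GoodData lam dT A zs θs ρ c α θ₀ q₀ π₀ κ γ d b u₀ fun e => N e ω} ≤
      ε₁ + ε₂ + ε₃ := by
  refine le_trans (measure_mono_ae ?_) ((measure_union_le _ _).trans
    (add_le_add ((measure_union_le _ _).trans (add_le_add h₁ h₂)) h₃))
  filter_upwards [h.ae_window_lt_top] with ω hω hbad
  by_contra hcon
  refine hbad ⟨hω, fun n i k hk => ?_, fun n => ?_, fun n => ?_⟩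
  · exact not_lt.1 fun hlt => hcon (Or.inl (Or.inl ⟨n, i, k, hk, hlt⟩))
  · exact not_lt.1 fun hlt => hcon (Or.inl (Or.inr ⟨n, hlt⟩))
  · exact not_lt.1 fun hlt => hcon (Or.inr ⟨n, hlt⟩)

end Network

/-! ### Exponential decay in `m ^ rd` against powers of `m`. -/

section Growth

theorem tendsto_pow_mul_exp_neg_rpow {γ rd : ℝ} (hγ : 0 < γ) (hrd : 0 < rd) (j : ℕ) :
    Tendsto (fun m : ℕ => (m : ℝ) ^ j * Real.exp (-(γ * (m : ℝ) ^ rd))) atTop (𝓝 0) := by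
  have h1 := tendsto_rpow_mul_exp_neg_mul_atTop_nhds_zero (j / rd) γ hγ
  have h2 : Tendsto (fun m : ℕ => (m : ℝ) ^ rd) atTop atTop :=
    (tendsto_rpow_atTop hrd).comp tendsto_natCast_atTop_atTop
  refine (h1.comp h2).congr fun m => ?_
  simp only [Function.comp]
  rw [← Real.rpow_mul (Nat.cast_nonneg m), mul_div_cancel₀ _ hrd.ne', Real.rpow_natCast, neg_mul]

/-- Absorbs linear growth in the window index uniformly, by `n + 1 ≤ exp n` and `x ≥ 1`. -/
theorem natCast_mul_exp_neg_le {x : ℝ} (hx : 1 ≤ x) (n : ℕ) :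
    ((n + 1 : ℕ) : ℝ) * Real.exp (-(((n + 1 : ℕ) : ℝ) * x)) ≤ Real.exp (-x) := by
  have h1 : ((n + 1 : ℕ) : ℝ) ≤ Real.exp n := by
    push_cast
    exact Real.add_one_le_exp _
  calc ((n + 1 : ℕ) : ℝ) * Real.exp (-(((n + 1 : ℕ) : ℝ) * x)) ≤
      Real.exp n * Real.exp (-(((n + 1 : ℕ) : ℝ) * x)) :=
        mul_le_mul_of_nonneg_right h1 (Real.exp_pos _).le
    _ = Real.exp (n - ((n + 1 : ℕ) : ℝ) * x) := by rw [← Real.exp_add, sub_eq_add_neg]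
    _ ≤ Real.exp (-x) := Real.exp_le_exp.2 (by
        push_cast
        nlinarith [mul_le_mul_of_nonneg_left hx (Nat.cast_nonneg (α := ℝ) n)])

/-- The label laws concentrate so fast that their contribution is negligible in all windows. -/
theorem eventually_label_bounds {γ rd C b Rπ τ : ℝ} (hγ : 0 < γ) (hrd : 0 < rd) (hC : 0 ≤ C)
    (hb : 0 ≤ b) (hRπ : 0 ≤ Rπ) (hτ : 0 < τ) (K : ℕ) :
    ∀ᶠ m : ℕ in atTop,
      m * K * ((Rπ + 2 * m) * Real.exp (-(γ * (m : ℝ) ^ rd))) ≤ τ ∧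
      ∀ a : ℝ, 0 < a → a ≤ (m : ℝ) ^ 2 → ∀ n : ℕ, 2 * C * (b + ((n + 1 : ℕ) : ℝ)) *
        (m * K * ((Rπ + 2 * m) * Real.exp (-(γ * (((n + 1 : ℕ) : ℝ) * (m : ℝ) ^ rd))))) ≤
          1 / Real.sqrt a := by
  have ht : ∀ M : ℝ, Tendsto (fun m : ℕ => M *
      ((m : ℝ) ^ 3 * Real.exp (-(γ * (m : ℝ) ^ rd)))) atTop (𝓝 0) := fun M => by
    simpa using (tendsto_pow_mul_exp_neg_rpow hγ hrd 3).const_mul M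
  have hd : Tendsto (fun m : ℕ => γ * (m : ℝ) ^ rd) atTop atTop :=
    ((tendsto_rpow_atTop hrd).comp tendsto_natCast_atTop_atTop).const_mul_atTop hγ
  filter_upwards [(ht (K * (Rπ + 2))).eventually (gt_mem_nhds hτ),
    (ht (2 * C * (b + 1) * (K * (Rπ + 2)))).eventually (gt_mem_nhds zero_lt_one),
    hd.eventually_ge_atTop 1, eventually_ge_atTop 1] with m h1 h2 h3 h4
  have hm : (1 : ℝ) ≤ m := by exact_mod_cast h4
  have hx := Real.exp_pos (-(γ * (m : ℝ) ^ rd))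
  have hR : Rπ + 2 * m ≤ (Rπ + 2) * m := by
    have := mul_le_mul_of_nonneg_left hm hRπ
    linarith
  have hsq : (m : ℝ) * ((Rπ + 2) * m) ≤ (Rπ + 2) * m ^ 2 := by
    rw [sq]
    linarith
  have hbase : m * K * ((Rπ + 2 * m) * Real.exp (-(γ * (m : ℝ) ^ rd))) ≤
      K * (Rπ + 2) * ((m : ℝ) ^ 2 * Real.exp (-(γ * (m : ℝ) ^ rd))) := by
    calc m * K * ((Rπ + 2 * m) * Real.exp (-(γ * (m : ℝ) ^ rd))) ≤
        m * K * (((Rπ + 2) * m) * Real.exp (-(γ * (m : ℝ) ^ rd))) := by gcongr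
      _ = _ := by ring
  refine ⟨hbase.trans (le_trans ?_ h1.le), fun a ha ham n => ?_⟩
  · have : (m : ℝ) ^ 2 ≤ (m : ℝ) ^ 3 := pow_le_pow_right₀ hm (by norm_num)
    gcongr
  · have hn : (1 : ℝ) ≤ ((n + 1 : ℕ) : ℝ) := by exact_mod_cast Nat.le_add_left 1 n
    -- Because `a ≤ m ^ 2`, a bound by `1 / m` suffices; this is the third power of `m` in the
    -- limits above.
    have hsqrt : 1 / (m : ℝ) ≤ 1 / Real.sqrt a := by
      refine one_div_le_one_div_of_le (Real.sqrt_pos.2 ha) ?_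
      rw [Real.sqrt_le_left (by positivity)]
      exact ham
    have hbn : b + ((n + 1 : ℕ) : ℝ) ≤ (b + 1) * ((n + 1 : ℕ) : ℝ) := by
      have := mul_le_mul_of_nonneg_left hn hb
      linarith
    have he := natCast_mul_exp_neg_le h3 n
    refine le_trans ?_ hsqrt
    rw [le_div_iff₀ (by positivity)]
    calc 2 * C * (b + ((n + 1 : ℕ) : ℝ)) * (m * K * ((Rπ + 2 * m) *
          Real.exp (-(γ * (((n + 1 : ℕ) : ℝ) * (m : ℝ) ^ rd))))) * m ≤
        2 * C * ((b + 1) * ((n + 1 : ℕ) : ℝ)) * (m * K * (((Rπ + 2) * m) *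
          Real.exp (-(γ * (((n + 1 : ℕ) : ℝ) * (m : ℝ) ^ rd))))) * m := by
          gcongr
      _ = 2 * C * (b + 1) * (K * (Rπ + 2)) * ((m : ℝ) ^ 3 * (((n + 1 : ℕ) : ℝ) *
          Real.exp (-(((n + 1 : ℕ) : ℝ) * (γ * (m : ℝ) ^ rd))))) := by
          rw [mul_left_comm γ]
          ring
      _ ≤ 2 * C * (b + 1) * (K * (Rπ + 2)) * ((m : ℝ) ^ 3 *
          Real.exp (-(γ * (m : ℝ) ^ rd))) := by
          gcongr
      _ ≤ 1 := h2.le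

end Growth

/-! ### The rate at a fixed window. -/

/-- The moment bounds for the filtered noise and the bound for the algorithm on good data give a
bound in probability at a fixed window. -/
theorem Network.measure_run_lt_le {K p m : ℕ} {Ω : Type*} [MeasurableSpace Ω]
    {lam : BlockIntensity K p} {Θ : Set (Param p)} {θs : Param p} {C dT ρ : ℝ}
    {A : Finset (Fin m × Fin m)} {zs : Fin m → Fin K} {P : Measure Ω} [IsProbabilityMeasure P]
    {N : Fin m × Fin m → Ω → Measure ℝ} (h : Network lam Θ θs C dT ρ A zs P N)
    (hA : 0 < A.card) {c L α B D δ₀ ε : ℝ} (hc : 0 < c) (hc1 : c ≤ 1) (hα : 0 < α) (hB0 : 0 < B)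
    (hB : ∀ n, linRec (sgdFactor c L α) (fun n => ((n + 1 : ℕ) : ℝ) ^ (-α)) n ≤ B)
    (hD0 : 0 < D) (hδ₀ : 0 ≤ δ₀) (hε : 0 < ε)
    {θ₀ : Param p} {q₀ : Fin m → Fin K → ℝ} {π₀ : Fin K → ℝ} {κ γ d b u₀ : ℝ}
    (hgood : P {ω | ¬ GoodData lam dT A zs θs ρ c α θ₀ q₀ π₀ κ γ d b u₀ fun e => N e ω} ≤
      ENNReal.ofReal (3 * ε))
    (hU : ∀ n j, ∫⁻ ω, ENNReal.ofReal
      (filteredNoise lam dT A zs θs ρ c α θ₀ q₀ π₀ (fun e => N e ω) n j ^ 2) ∂P ≤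
        ENNReal.ofReal (D / A.card))
    {n : ℕ} (hrun : ∀ ω, (GoodData lam dT A zs θs ρ c α θ₀ q₀ π₀ κ γ d b u₀ fun e => N e ω) →
      ‖(run lam dT A (fun e => N e ω) (fun j => (j : ℝ) ^ (-α)) θ₀ q₀ π₀ n).θ - θs‖ ≤
          B * ((n : ℝ) ^ (-α) * ‖θ₀ - θs‖ +
          Real.sqrt (linRec (sgdFactor c L α)
            (fun k => ((k + 1 : ℕ) : ℝ) ^ (-α) *
              (‖filteredNoise lam dT A zs θs ρ c α θ₀ q₀ π₀ (fun e => N e ω) k‖ ^ 2 +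
                (1 / Real.sqrt A.card) ^ 2)) n)) +
          ‖filteredNoise lam dT A zs θs ρ c α θ₀ q₀ π₀ (fun e => N e ω) n‖)
    (hθ₀ : ‖θ₀ - θs‖ ≤ δ₀) {lg : ℝ} (hlg : 1 ≤ lg) :
    P {ω | (B * δ₀ + B * Real.sqrt (B * (p * D + 1) / ε) + Real.sqrt ((p * D + 1) / ε)) *
        ((n : ℝ) ^ (-α) * lg + 1 / Real.sqrt A.card) <
      ‖(run lam dT A (fun e => N e ω) (fun j => (j : ℝ) ^ (-α)) θ₀ q₀ π₀ n).θ - θs‖} ≤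
      ENNReal.ofReal (5 * ε) := by
  have ha : (0 : ℝ) < A.card := Nat.cast_pos.2 hA
  set a : ℝ := (A.card : ℝ) with ha_def
  set U : ℕ → Ω → Param p := fun n ω =>
    filteredNoise lam dT A zs θs ρ c α θ₀ q₀ π₀ (fun e => N e ω) n with hU_def
  have hUm : ∀ n, Measurable (U n) := fun n => h.measurable_filteredNoise c α θ₀ q₀ π₀ n
  have hM0 : 0 < p * D + 1 := by positivity
  have hrr : (1 / Real.sqrt a) ^ 2 = 1 / a := by rw [div_pow, one_pow, Real.sq_sqrt ha.le]
  have hsq : ∀ n, ∫⁻ ω, ENNReal.ofReal (‖U n ω‖ ^ 2) ∂P ≤ ENNReal.ofReal (p * (D / a)) := fun n =>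
    lintegral_norm_sq_le (hUm n) (hU n)
  have hsq' : ∀ n, ∫⁻ ω, ENNReal.ofReal (‖U n ω‖ ^ 2 + (1 / Real.sqrt a) ^ 2) ∂P ≤
      ENNReal.ofReal ((p * D + 1) / a) := fun n => by
    simp_rw [hrr]
    calc ∫⁻ ω, ENNReal.ofReal (‖U n ω‖ ^ 2 + 1 / a) ∂P
        = ∫⁻ ω, (ENNReal.ofReal (‖U n ω‖ ^ 2) + ENNReal.ofReal (1 / a)) ∂P :=
          lintegral_congr fun ω => ENNReal.ofReal_add (by positivity) (by positivity)
      _ = ∫⁻ ω, ENNReal.ofReal (‖U n ω‖ ^ 2) ∂P + ENNReal.ofReal (1 / a) := by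
          rw [lintegral_add_right _ measurable_const, lintegral_const, measure_univ, mul_one]
      _ ≤ ENNReal.ofReal (p * (D / a)) + ENNReal.ofReal (1 / a) := add_le_add (hsq n) le_rfl
      _ = ENNReal.ofReal ((p * D + 1) / a) := by
          rw [← ENNReal.ofReal_add (by positivity) (by positivity)]
          congr 1
          ring
  have hZ := lintegral_linRec_le (P := P) (M := (p * D + 1) / a) (a := sgdFactor c L α)
    (w := fun k => ((k + 1 : ℕ) : ℝ) ^ (-α))
    (f := fun k ω => ‖U k ω‖ ^ 2 + (1 / Real.sqrt a) ^ 2) (by positivity)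
    (sgdFactor_nonneg hc hc1 hα) (fun k => by positivity)
    (fun k => ((hUm k).norm.pow_const 2).add_const _) (fun k ω => by positivity) hsq' n
  set Z : Ω → ℝ := fun ω => linRec (sgdFactor c L α)
    (fun k => ((k + 1 : ℕ) : ℝ) ^ (-α) * (‖U k ω‖ ^ 2 + (1 / Real.sqrt a) ^ 2)) n with hZ_def
  have hPZ : P {ω | B * (p * D + 1) / ε / a < Z ω} ≤ ENNReal.ofReal ε := by
    refine measure_lt_le_of_lintegral_le hZ.1 (by positivity) hZ.2 ?_
    have h1 := mul_le_mul_of_nonneg_left (hB n) (show 0 ≤ (p * D + 1) / a by positivity)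
    refine h1.trans (le_of_eq ?_)
    field_simp
  have hPU : P {ω | (p * D + 1) / ε / a < ‖U n ω‖ ^ 2} ≤ ENNReal.ofReal ε := by
    refine measure_lt_le_of_lintegral_le ((hUm n).norm.pow_const 2) (by positivity) (hsq n) ?_
    have e1 : (p * D + 1) / ε / a * ε = p * (D / a) + 1 / a := by
      field_simp
    rw [e1]
    have : 0 < 1 / a := by positivity
    linarith
  have e5 : ENNReal.ofReal (5 * ε) =
      ENNReal.ofReal (3 * ε) + ENNReal.ofReal ε + ENNReal.ofReal ε := by
    rw [← ENNReal.ofReal_add (by positivity) hε.le, ← ENNReal.ofReal_add (by positivity) hε.le]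
    congr 1
    ring
  rw [e5]
  -- Three ways to fail: bad data, a large weighted sum `Z`, or a large `U n`. Markov's inequality
  -- bounds the last two by `ε` each.
  refine le_trans (measure_mono fun ω hω => ?_) ((measure_union_le _ _).trans
    (add_le_add ((measure_union_le _ _).trans (add_le_add hgood hPZ)) hPU))
  by_contra hcon
  have h1 : GoodData lam dT A zs θs ρ c α θ₀ q₀ π₀ κ γ d b u₀ fun e => N e ω :=
    by_contra fun hn => hcon (Or.inl (Or.inl hn))
  have h2 : Z ω ≤ B * (p * D + 1) / ε / a :=
    not_lt.1 fun hlt => hcon (Or.inl (Or.inr hlt))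
  have h3 : ‖U n ω‖ ^ 2 ≤ (p * D + 1) / ε / a := not_lt.1 fun hlt => hcon (Or.inr hlt)
  have h4 := hrun ω h1
  change _ ≤ B * ((n : ℝ) ^ (-α) * ‖θ₀ - θs‖ + Real.sqrt (Z ω)) + ‖U n ω‖ at h4
  have h5 : Real.sqrt (Z ω) ≤ Real.sqrt (B * (p * D + 1) / ε) * (1 / Real.sqrt a) := by
    rw [mul_one_div, ← Real.sqrt_div' _ ha.le]
    exact Real.sqrt_le_sqrt h2
  have h6 : ‖U n ω‖ ≤ Real.sqrt ((p * D + 1) / ε) * (1 / Real.sqrt a) := by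
    rw [mul_one_div, ← Real.sqrt_div' _ ha.le]
    exact Real.le_sqrt_of_sq_le h3
  -- The logarithmic factor is inserted by `lg ≥ 1`.
  have h7 : (n : ℝ) ^ (-α) * ‖θ₀ - θs‖ ≤ ((n : ℝ) ^ (-α) * lg) * δ₀ := by
    calc (n : ℝ) ^ (-α) * ‖θ₀ - θs‖ ≤ (n : ℝ) ^ (-α) * δ₀ :=
          mul_le_mul_of_nonneg_left hθ₀ (by positivity)
      _ ≤ ((n : ℝ) ^ (-α) * lg) * δ₀ :=
          mul_le_mul_of_nonneg_right (le_mul_of_one_le_right (by positivity) hlg) hδ₀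
  have h8 := mul_le_mul_of_nonneg_left (add_le_add h7 h5) hB0.le
  have hx : 0 ≤ (n : ℝ) ^ (-α) * lg := by positivity
  have hy : 0 ≤ 1 / Real.sqrt a := by positivity
  have hω' : (B * δ₀ + B * Real.sqrt (B * (p * D + 1) / ε) + Real.sqrt ((p * D + 1) / ε)) *
        ((n : ℝ) ^ (-α) * lg + 1 / Real.sqrt a) <
      ‖(run lam dT A (fun e => N e ω) (fun j => (j : ℝ) ^ (-α)) θ₀ q₀ π₀ n).θ - θs‖ := hω
  have h9 : 0 ≤ B * δ₀ * (1 / Real.sqrt a) := by positivity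
  have h10 : 0 ≤ B * Real.sqrt (B * (p * D + 1) / ε) * ((n : ℝ) ^ (-α) * lg) := by positivity
  have h11 : 0 ≤ Real.sqrt ((p * D + 1) / ε) * ((n : ℝ) ^ (-α) * lg) := by positivity
  linarith

end StreamNet

/-! ### Choice of the constants and conclusion. -/

theorem theorem3 {K p : ℕ}
    -- the block model and the true parameter
    (lam : StreamNet.BlockIntensity K p) (Θ : Set (StreamNet.Param p)) (hΘ : IsOpen Θ)
    (θs : StreamNet.Param p) (hθs : θs ∈ Θ)
    -- the fixed window length
    (dT : ℝ) (hdT : 0 < dT)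
    -- for each number of nodes: the network, the true labels and the event data
    (A : (m : ℕ) → Finset (Fin m × Fin m)) (zs : (m : ℕ) → Fin m → Fin K)
    {Ω : ℕ → Type*} [∀ m, MeasurableSpace (Ω m)]
    (P : (m : ℕ) → Measure (Ω m)) [∀ m, IsProbabilityMeasure (P m)]
    (N : (m : ℕ) → Fin m × Fin m → Ω m → Measure ℝ)
    (hN : ∀ m, ∀ e ∈ A m, StreamNet.IsPoissonProcess (P m) (N m e)
      (fun t => lam (zs m e.1) (zs m e.2) t θs))
    (hindep : ∀ m, iIndepFun (fun (e : {e // e ∈ A m}) => N m e.1) (P m))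
    -- initial label laws and class proportions
    (q₀ : (m : ℕ) → Fin m → Fin K → ℝ) (hq₀ : ∀ m, StreamNet.IsMeanField (q₀ m))
    (π₀ : Fin K → ℝ) (hπ₀ : ∀ k, 0 < π₀ k) (hπ₀_sum : ∑ k, π₀ k = 1)
    -- the regularity conditions
    (c C δ rd : ℝ) (hc : 0 < c) (hδ : 0 < δ) (hrd : 0 < rd)
    (hbdd : StreamNet.Bounded lam Θ C)
    (hreg : ∀ᶠ m in atTop, StreamNet.Regular lam dT Θ θs (A m) (zs m) (P m) (N m) (q₀ m)
      c C δ rd)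
    -- the exponent of the step sizes
    (α : ℝ) (hα0 : 0 < α) (hα1 : α < 1) :
    ∃ δ₀ : ℝ, 0 < δ₀ ∧ δ₀ ≤ δ ∧
      ∀ θ₀ : ℕ → StreamNet.Param p, (∀ m, θ₀ m ∈ Metric.ball θs δ₀) →
      -- `W m = T / dT` is the number of windows
      ∀ W : ℕ → ℕ, ∀ ε : ℝ, 0 < ε → ∃ C₀ : ℝ, 0 < C₀ ∧ ∀ᶠ m in atTop,
        ∀ n : ℕ, 1 ≤ n → n ≤ W m →
          P m {ω | C₀ * ((n : ℝ) ^ (-α) *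
                (Real.log (((W m : ℝ) * dT) * ((A m).card : ℝ))) ^ 2
                + 1 / Real.sqrt ((A m).card : ℝ))
              < ‖(StreamNet.run lam dT (A m) (fun e => N m e ω) (fun j => (j : ℝ) ^ (-α))
                  (θ₀ m) (q₀ m) π₀ n).θ - θs‖} ≤ ENNReal.ofReal ε := by
  -- The label of the network with one node exhibits a class.
  have hK : 0 < K := (zs 1 0).pos
  have hC : 0 < C := (hbdd.pos ⟨0, hK⟩ ⟨0, hK⟩ 0 le_rfl θs hθs).trans_le
    (hbdd.bound _ _ 0 le_rfl θs hθs)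
  obtain ⟨ρ₀, hρ₀, hball₀⟩ := Metric.nhds_basis_closedBall.mem_iff.1 (hΘ.mem_nhds hθs)
  obtain ⟨c₁, hc₁⟩ : ∃ c₁, c₁ = min c (c ^ 2) / 4 := ⟨_, rfl⟩
  have hc₁0 : 0 < c₁ := by
    rw [hc₁]
    have : 0 < min c (c ^ 2) := lt_min hc (by positivity)
    positivity
  -- `κ` and then `s` are small enough that the two losses in `measure_excess_lt_le` are a quarter
  -- of the mean decrement each.
  obtain ⟨κ, hκ0, hκ1⟩ : ∃ κ : ℝ, 0 < κ ∧ κ * (2 * C * ((C + 1) * dT)) ≤ c₁ :=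
    ⟨c₁ / (2 * C * ((C + 1) * dT)), by positivity, le_of_eq (by field_simp)⟩
  obtain ⟨s, hs0, hs1, hs2⟩ : ∃ s : ℝ, 0 < s ∧ s * (2 * C + κ) ≤ 1 ∧
      s * ((2 * C + κ) ^ 2 * C * dT * (2 * C)) ≤ c₁ := by
    refine ⟨min (1 / (2 * C + κ)) (c₁ / ((2 * C + κ) ^ 2 * C * dT * (2 * C))),
      lt_min (by positivity) (by positivity), ?_, ?_⟩
    · rw [← le_div_iff₀ (by positivity)]
      exact min_le_left _ _
    · rw [← le_div_iff₀ (by positivity)]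
      exact min_le_right _ _
  obtain ⟨s', hs'⟩ : ∃ s', 2 * s' = s * c₁ := ⟨s * c₁ / 2, by ring⟩
  have hs'0 : 0 < s' := by
    have : 0 < s * c₁ := by positivity
    linarith
  -- The budget `κ` is split: one half for moving the parameter within radius `ρ`, one half for
  -- label laws with wrong mass at most `τ`.
  obtain ⟨ρ, hρ0, hρρ₀, hρδ, hρκ⟩ : ∃ ρ : ℝ, 0 < ρ ∧ ρ ≤ ρ₀ ∧ ρ ≤ δ ∧ 2 * C * ρ ≤ κ / 2 := by
    refine ⟨min (min ρ₀ δ) (κ / (4 * C)), by positivity,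
      (min_le_left _ _).trans (min_le_left _ _), (min_le_left _ _).trans (min_le_right _ _), ?_⟩
    have h1 := min_le_right (min ρ₀ δ) (κ / (4 * C))
    rw [le_div_iff₀ (by positivity)] at h1
    linarith
  obtain ⟨τ, hτ0, hτ1, hτκ⟩ : ∃ τ : ℝ, 0 < τ ∧ τ ≤ 1 / 2 ∧ 4 * C * τ ≤ κ / 2 := by
    refine ⟨min (1 / 2) (κ / (8 * C)), by positivity, min_le_left _ _, ?_⟩
    have h1 := min_le_right (1 / 2) (κ / (8 * C))
    rw [le_div_iff₀ (by positivity)] at h1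
    linarith
  obtain ⟨B, hB0, hB, hrun⟩ :=
    StreamNet.Network.exists_run_bound (C := C) (dT := dT) hc hα0 hα1 p
  obtain ⟨⟨D, hD0, hD⟩, hsup⟩ := StreamNet.exists_filtered_noise_bound
    (c := min c 1) (α := α) (κ₀ := 1 / C) (V₀ := C ^ 3 * dT) (lt_min hc zero_lt_one)
    (min_le_right c 1) hα0 hα1 (by positivity) (by positivity)
  -- Initial error, filtered noise and label error will each be at most `ρ / (4 * B)`, so `B` times
  -- their sum stays below `ρ`.
  have hu₀ : 0 < ρ / (4 * B) := by positivity
  obtain ⟨u₀, hu₀_def⟩ : ∃ u₀, u₀ = ρ / (4 * B) := ⟨_, rfl⟩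
  rw [← hu₀_def] at hu₀
  have hBu : B * (4 * u₀) = ρ := by
    rw [hu₀_def]
    field_simp
  refine ⟨min δ u₀, lt_min hδ hu₀, min_le_left _ _, ?_⟩
  intro θ₀ hθ₀ W ε hε
  -- Three fifths of `ε` go to bad data (evidence, mass, noise) and two to Markov's inequality.
  have hε' : 0 < ε / 5 := by positivity
  have hε'' : 0 < ENNReal.ofReal (ε / 5) := ENNReal.ofReal_pos.2 hε'
  obtain ⟨d₀, -, hd₀⟩ := StreamNet.exists_tsum_exp_le one_pos hs'0 hε''
  obtain ⟨a₁, -, ha₁⟩ := StreamNet.exists_tsum_exp_le one_pos one_pos hε''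
  obtain ⟨a₂, -, ha₂⟩ := hsup (u₀ / (p + 1)) (by positivity) (ENNReal.ofReal (ε / 5 / (p + 1)))
    (ENNReal.ofReal_pos.2 (by positivity))
  have hδ₀ : 0 ≤ min δ u₀ := (lt_min hδ hu₀).le
  refine ⟨B * min δ u₀ + B * Real.sqrt (B * (p * D + 1) / (ε / 5)) +
    Real.sqrt ((p * D + 1) / (ε / 5)), by positivity, ?_⟩
  have hdtop : Tendsto (fun m : ℕ => (m : ℝ) ^ rd) atTop atTop :=
    (tendsto_rpow_atTop hrd).comp tendsto_natCast_atTop_atTop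
  have hatop := hdtop.const_mul_atTop hc
  have hRπ : 0 ≤ ∑ k, 1 / π₀ k := Finset.sum_nonneg fun k _ => (one_div_pos.2 (hπ₀ k)).le
  have hmK : Tendsto (fun m : ℕ => K * ((m : ℝ) ^ 1 * Real.exp (-(s' * (m : ℝ) ^ rd)))) atTop
      (𝓝 0) := by
    simpa using (StreamNet.tendsto_pow_mul_exp_neg_rpow hs'0 hrd 1).const_mul (K : ℝ)
  filter_upwards [hreg, eventually_ge_atTop 1, hdtop.eventually_ge_atTop d₀,
    hatop.eventually_ge_atTop a₁, hatop.eventually_ge_atTop a₂, hatop.eventually_ge_atTop 1,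
    hatop.eventually_ge_atTop (Real.exp 1 / dT), hatop.eventually_ge_atTop (1 / u₀ ^ 2),
    StreamNet.eventually_label_bounds (b := 2 * C * dT + dT) hc₁0 hrd hC.le (by positivity) hRπ
      hτ0 K, hmK.eventually (gt_mem_nhds zero_lt_one)] with
    m hregm hm1 hdm ha1m ha2m ha3m ha4m ha5m hlab hmKm
  intro n hn1 hnW
  -- Every requirement that `|A|` be large follows from this lower bound.
  have hdeg : c * (m : ℝ) ^ rd ≤ (A m).card :=
    (hregm.degree ⟨0, hm1⟩).1.trans (by exact_mod_cast StreamNet.nodeDegree_le_card _ _)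
  have ha1 : (1 : ℝ) ≤ (A m).card := ha3m.trans hdeg
  have ha0 : (0 : ℝ) < (A m).card := by linarith
  have hA : 0 < (A m).card := Nat.cast_pos.1 ha0
  have hasq : ((A m).card : ℝ) ≤ (m : ℝ) ^ 2 := by exact_mod_cast StreamNet.card_le_sq (A m)
  have hnet : StreamNet.Network lam Θ θs C dT ρ (A m) (zs m) (P m) (N m) :=
    { isOpen := hΘ
      bdd := hbdd
      C_pos := hC
      dT_pos := hdT
      ρ_pos := hρ0
      ball := (Metric.closedBall_subset_closedBall hρρ₀).trans hball₀
      poisson := hN m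
      indep := hindep m }
  have hθm : ‖θ₀ m - θs‖ < min δ u₀ := mem_ball_iff_norm.1 (hθ₀ m)
  have hrr : 1 / Real.sqrt (A m).card ≤ u₀ := by
    rw [one_div_le (Real.sqrt_pos.2 ha0) hu₀]
    refine Real.le_sqrt_of_sq_le ?_
    rw [one_div_pow]
    exact ha5m.trans hdeg
  have hlog : 1 ≤ (Real.log (((W m : ℝ) * dT) * ((A m).card : ℝ))) ^ 2 := by
    have hW : (1 : ℝ) ≤ W m := by exact_mod_cast hn1.trans hnW
    have h1 : Real.exp 1 ≤ ((W m : ℝ) * dT) * ((A m).card : ℝ) := by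
      have h2 := ha4m.trans hdeg
      rw [div_le_iff₀ hdT] at h2
      have h3 : (A m).card * dT ≤ W m * ((A m).card * dT) :=
        le_mul_of_one_le_left (by positivity) hW
      linarith
    have h4 : 1 ≤ Real.log (((W m : ℝ) * dT) * ((A m).card : ℝ)) := by
      rw [Real.le_log_iff_exp_le ((Real.exp_pos 1).trans_le h1)]
      exact h1
    exact one_le_pow₀ h4
  -- `R = ∑ k, 1 / π₀ k + 2 * m` serves both the initial proportions and the later ones, which are
  -- at least `1 / (2 * m)` for true classes.
  have hR₀ : ∀ k, 1 ≤ (∑ k, 1 / π₀ k + 2 * m) * π₀ k := fun k => by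
    have h1 : 1 / π₀ k ≤ ∑ k, 1 / π₀ k + 2 * m :=
      (Finset.single_le_sum (f := fun k => 1 / π₀ k) (fun l _ => (one_div_pos.2 (hπ₀ l)).le)
        (Finset.mem_univ k)).trans (le_add_of_nonneg_right (by positivity))
    rwa [div_le_iff₀ (hπ₀ k)] at h1
  have hgood := hnet.measure_not_goodData_le (min c 1) α (θ₀ m) (q₀ m) π₀ κ c₁ ((m : ℝ) ^ rd)
    (2 * C * dT + dT) u₀ (ε₁ := ENNReal.ofReal (ε / 5)) (ε₂ := ENNReal.ofReal (ε / 5))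
    (ε₃ := ENNReal.ofReal (ε / 5))
    (by
      subst hc₁
      exact hnet.measure_exists_excess_le hA (hq₀ m) hc hδ hregm hκ0.le hs0 hκ1 hs1 hs2 hs' hs'0.le
        (by rw [pow_one] at hmKm; linarith) (hd₀ _ hdm))
    (hnet.measure_exists_blockMass_le (ha₁ _ (ha1m.trans hdeg)))
    ((StreamNet.Network.measure_exists_filteredNoise_le (min c 1) α (θ₀ m) (q₀ m) π₀ hu₀.le
      fun j => ha₂ (P m) _ _ _ (ha2m.trans hdeg)
        (hnet.isFilteredNoise_filteredNoise hA (min c 1) α (θ₀ m) (q₀ m) π₀ j)).trans (by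
      rw [← ENNReal.ofReal_natCast, ← ENNReal.ofReal_mul (Nat.cast_nonneg p)]
      refine ENNReal.ofReal_le_ofReal ?_
      rw [← mul_div_assoc, div_le_iff₀ (by positivity)]
      linarith))
  have h3 : ENNReal.ofReal (ε / 5) + ENNReal.ofReal (ε / 5) + ENNReal.ofReal (ε / 5) =
      ENNReal.ofReal (3 * (ε / 5)) := by
    rw [← ENNReal.ofReal_add hε'.le hε'.le, ← ENNReal.ofReal_add (by positivity) hε'.le]
    congr 1
    ring
  rw [h3] at hgood
  have key := hnet.measure_run_lt_le hA (lt_min hc zero_lt_one) (min_le_right c 1) hα0 hB0 hB hD0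
    hδ₀ hε' hgood
    (fun n j => hD (P m) _ _ _ ha1
      (hnet.isFilteredNoise_filteredNoise hA (min c 1) α (θ₀ m) (q₀ m) π₀ j) n)
    (n := n)
    (fun ω hω => hrun hnet hδ hρδ hregm hω
      (hnet.norm_labelError_le_of_goodData hK hm1 hA (hq₀ m) hπ₀ hπ₀_sum hω hτ1 (by linarith)
        (by linarith) hc₁0.le (by positivity) (by positivity) hR₀
        (le_add_of_nonneg_left hRπ) hlab.1 (hlab.2 _ ha0 hasq))
      (by
        have h5 : ‖θ₀ m - θs‖ < u₀ := hθm.trans_le (min_le_right _ _)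
        have h6 := mul_lt_mul_of_pos_left
          (show ‖θ₀ m - θs‖ + u₀ + 1 / Real.sqrt (A m).card < 4 * u₀ by linarith) hB0
        exact h6.trans_eq hBu) n hn1)
    hθm.le hlog
  rwa [show 5 * (ε / 5) = ε by ring] at key
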